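/- **Hypergraphs.** Let $Pr$ be a set with a rank function $rk:Pr\to\mathbb N$ (its elements are the primitive formulas). A hypergraph $G$ over a ranked set $\Sigma$ consists of a finite set of nodes $V_G$, a finite set of hyperedges $E_G$, a string $att_G(e)$ of attachment nodes and a label $lab_G(e)\in\Sigma$ with $rk(lab_G(e))=|att_G(e)|$ for each $e\in E_G$, and a string $ext_G$ of external nodes; $rk(G)=|ext_G|$. Hypergraphs are considered up to isomorphism. For distinct hyperedges $e_1,\dots,e_k$ of $G$ and hypergraphs $H_t$ with $rk(H_t)=|att_G(e_t)|$, $G[e_1/H_1,\dots,e_k/H_k]$ denotes the result of replacing each $e_t$ by $H_t$ (remove $e_t$, add $H_t$, and identify the $s$-th attachment node of $e_t$ with the $s$-th external node of $H_t$ for all $s$). The handle $a^\bullet$ has nodes $1,\dots,n$ ($n=rk(a)$) and one hyperedge labeled by $a$, whose attachment string and the string of external nodes are both $1\dots n$. **The hypergraph Lambek calculus $\mathrm{HL}$.** Let $\$_d$ ($d\in\mathbb N$, $rk(\$_d)=d$) be additional "hole" labels. Formulas of $\mathrm{HL}$: every $p\in Pr$; $\times(M)$ of rank $rk(M)$, for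 a hypergraph $M$ labeled by formulas; $N\div D$ of rank $d$, where $N$ is a formula, $D$ is a hypergraph with $rk(D)=rk(N)$, exactly one hyperedge $e^\$_D$ of $D$ is labeled by a hole label, this label is $\$_d$, and all other labels are formulas. Sequents are $H\to A$ where $A$ is a formula, $H$ is a hypergraph labeled by formulas, and $rk(H)=rk(A)$. The axioms are $A^\bullet\to A$. The rules are: * $(\times L)$: from $H[e/M]\to A$ infer $H[e/\times(M)^\bullet]\to A$; * $(\times R)$: from $H_t\to lab_M(m_t)$, $t=1,\dots,l$, infer $M[m_1/H_1,\dots,m_l/H_l]\to\times(M)$, where $E_M=\{m_1,\dots,m_l\}$; * $(\div L)$: from $H[e/N^\bullet]\to A$ and $H_t\to lab_D(d_t)$, $t=1,\dots,k$, infer $H\left[e/D[e^\$_D/(N\div D)^\bullet,d_1/H_1,\dots,d_k/H_k]\right]\to A$, where $E_D=\{e^\$_D,d_1,\dots,d_k\}$; * $(\div R)$: from $D[e^\$_D/F]\to N$ infer $F\to N\div D$. **The multimodal Lambek calculus $\mathrm{NL}_\Diamond$ without associative modes.** Let $I$ (modes) and $J$ (modalities) be disjoint subsets of $Pr$, and let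 $C\subseteq I$ (commutative modes), such that $rk(i)=3$ for $i\in I\setminus C$ and $rk(x)=2$ for $x\in C\cup J$. Formulas of $\mathrm{NL}_\Diamond$ are built from the elements of $Pr$ of rank 1 by $A\bullet_iB$, $B\backslash_iA$, $A/_iB$ ($i\in I$) and $\Diamond_jA$, $\square_jA$ ($j\in J$). Structured databases are formulas, $(\Pi_1,\Pi_2)^i$ and $\langle\Pi\rangle^j$, where $\Pi,\Pi_1,\Pi_2$ are structured databases, $i\in I$, $j\in J$; $\Delta[\cdot]$ denotes a structured database with one distinguished place. Sequents are $\Pi\to A$. The axioms are $A\to A$. The rules are: * from $\Delta[(A,B)^i]\to T$ infer $\Delta[A\bullet_iB]\to T$; from $\Pi_1\to A_1$ and $\Pi_2\to A_2$ infer $(\Pi_1,\Pi_2)^i\to A_1\bullet_iA_2$; * from $\Delta[A]\to T$ and $\Pi\to B$ infer $\Delta[(\Pi,B\backslash_iA)^i]\to T$ and infer $\Delta[(A/_iB,\Pi)^i]\to T$; * from $(B,\Pi)^i\to A$ infer $\Pi\to B\backslash_iA$; from $(\Pi,B)^i\to A$ infer $\Pi\to A/_iB$; * from $\Delta[\langle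 A\rangle^j]\to T$ infer $\Delta[\Diamond_jA]\to T$; from $\Pi\to A$ infer $\langle\Pi\rangle^j\to\Diamond_jA$; * from $\Delta[A]\to T$ infer $\Delta[\langle\square_jA\rangle^j]\to T$; from $\langle\Pi\rangle^j\to A$ infer $\Pi\to\square_jA$; * for $c\in C$: from $\Delta[(\Pi_1,\Pi_2)^c]\to T$ infer $\Delta[(\Pi_2,\Pi_1)^c]\to T$. **The translations.** All of the following hypergraphs have the single external node $v_1$. * $R^i(A,B)$: nodes $v_1,v_2,v_3$; hyperedges $r_0$ labeled $i$ and attached to $v_1v_2v_3$, $r_1$ labeled $A$ and attached to $v_2$, $r_2$ labeled $B$ and attached to $v_3$. * $K^c(A,B)$: nodes $v_1,v_2$; hyperedges $k_0$ labeled $c$ and attached to $v_1v_2$, and $k_1$ labeled $A$ and $k_2$ labeled $B$, both attached to $v_2$. * $U^j(A)$: nodes $v_1,v_2$; hyperedges $u_0$ labeled $j$ and attached to $v_1v_2$, and $u_1$ labeled $A$ and attached to $v_2$. For $p\in Pr$ of rank 1, $i\in I\setminus C$, $c\in C$, $j\in J$ put $\mu(p)=p$; $\mu(A\bullet_iB)=\times(R^i(\mu(A),\mu(B)))$;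 $\mu(B\backslash_iA)=\mu(A)\div R^i(\mu(B),\$_1)$; $\mu(A/_iB)=\mu(A)\div R^i(\$_1,\mu(B))$; $\mu(A\bullet_cB)=\times(K^c(\mu(A),\mu(B)))$; $\mu(B\backslash_cA)=\mu(A/_cB)=\mu(A)\div K^c(\mu(B),\$_1)$; $\mu(\Diamond_jA)=\times(U^j(\mu(A)))$; $\mu(\square_jA)=\mu(A)\div U^j(\$_1)$. For structured databases put $htree(A)=\mu(A)^\bullet$ for a formula $A$; $htree((\Pi_1,\Pi_2)^i)=R^i[r_1/htree(\Pi_1),r_2/htree(\Pi_2)]$; $htree((\Pi_1,\Pi_2)^c)=K^c[k_1/htree(\Pi_1),k_2/htree(\Pi_2)]$; $htree(\langle\Pi\rangle^j)=U^j[u_1/htree(\Pi)]$ (the labels of the replaced hyperedges are immaterial). **Theorem.** 1. For every structured database $\Pi$ and every formula $T$ of $\mathrm{NL}_\Diamond$, the sequent $\Pi\to T$ is derivable in $\mathrm{NL}_\Diamond$ if and only if $htree(\Pi)\to\mu(T)$ is derivable in $\mathrm{HL}$. 2. Let $G\to X$ be a sequent derivable in $\mathrm{HL}$ such that $X=\mu(A)$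 for some formula $A$ of $\mathrm{NL}_\Diamond$, and every label of $G$ either is of the form $\mu(B)$ for some formula $B$ of $\mathrm{NL}_\Diamond$ or belongs to $I\cup J$. Then there are a structured database $\Pi$ and a formula $T$ of $\mathrm{NL}_\Diamond$ such that $G=htree(\Pi)$, $X=\mu(T)$, and $\Pi\to T$ is derivable in $\mathrm{NL}_\Diamond$. -/

import Mathlib

universe u v

namespace HL

/-- A ranked set: a set together with a rank function. -/
class Ranked (L : Type u) where
  rk : L → ℕ

/-- A hypergraph over a ranked set `L` of labels: finitely many nodes and hyperedges, each hyperedge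
`e` having a string `att e` of attachment nodes and a label of rank `|att e|`, and a string `ext` of
external nodes. -/
structure Hypergraph (L : Type v) [Ranked L] where
  V : Type
  E : Type
  [finV : Finite V]
  [finE : Finite E]
  att : E → List V
  lab : E → L
  ext : List V
  rk_lab : ∀ e, Ranked.rk (lab e) = (att e).length

attribute [instance] Hypergraph.finV Hypergraph.finE

namespace Hypergraph

variable {L : Type v} [Ranked L]

/-- The rank of a hypergraph is the number of its external nodes. -/
instance : Ranked (Hypergraph L) := ⟨fun G => G.ext.length⟩

/-- Isomorphism of hypergraphs. -/
def Iso (G H : Hypergraph L) : Prop :=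
  ∃ (σ : G.V ≃ H.V) (τ : G.E ≃ H.E),
    (∀ e, H.att (τ e) = (G.att e).map σ) ∧ (∀ e, H.lab (τ e) = G.lab e) ∧ H.ext = G.ext.map σ

/-- The identifications made when the hyperedges `m i` of `G` are replaced by the `H i`: the `k`-th
attachment node of `m i` is identified with the `k`-th external node of `H i`. -/
def Glue (G : Hypergraph L) {ι : Type} (m : ι ↪ G.E) (H : ι → Hypergraph L)
    (x y : G.V ⊕ (Σ i, (H i).V)) : Prop :=
  ∃ (i : ι) (k : ℕ) (v : G.V) (w : (H i).V), (G.att (m i))[k]? = some v ∧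
    (H i).ext[k]? = some w ∧ x = Sum.inl v ∧ y = Sum.inr ⟨i, w⟩

/-- Simultaneous replacement `G[m i / H i, i ∈ ι]` of distinct hyperedges `m i` of `G` by the
hypergraphs `H i` (used only when the ranks of `m i` and `H i` agree). `Quot` is the quotient by the
smallest equivalence relation containing `Glue`. -/
def replace (G : Hypergraph L) {ι : Type} (m : ι ↪ G.E) (H : ι → Hypergraph L) :
    Hypergraph L where
  V := Quot (Glue G m H)
  E := {e : G.E // ∀ i, m i ≠ e} ⊕ (Σ i, (H i).E)
  finV := by
    have : Finite ι := Finite.of_injective m m.injective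
    infer_instance
  finE := by
    have : Finite ι := Finite.of_injective m m.injective
    infer_instance
  att := Sum.elim (fun e => (G.att e).map fun v => Quot.mk _ (Sum.inl v))
    (fun p => ((H p.1).att p.2).map fun w => Quot.mk _ (Sum.inr ⟨p.1, w⟩))
  lab := Sum.elim (fun e => G.lab e) (fun p => (H p.1).lab p.2)
  ext := G.ext.map fun v => Quot.mk _ (Sum.inl v)
  rk_lab := by
    rintro (e | p)
    · simpa using G.rk_lab e
    · simpa using (H p.1).rk_lab p.2

/-- Replacement `G[e / H]` of a single hyperedge. -/
def replaceOne (G : Hypergraph L) (e : G.E) (H : Hypergraph L) : Hypergraph L :=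
  G.replace (ι := Unit) ⟨fun _ => e, fun _ _ _ => rfl⟩ (fun _ => H)

/-- Replacement of all hyperedges of `G`. -/
def replaceAll (G : Hypergraph L) (H : G.E → Hypergraph L) : Hypergraph L :=
  G.replace (Function.Embedding.refl G.E) H

/-- The handle `a^•`: one hyperedge labeled by `a`, attached to `1, …, n`, with external nodes
`1, …, n`, where `n` is the rank of `a`. -/
def handle (a : L) : Hypergraph L where
  V := Fin (Ranked.rk a)
  E := Unit
  att _ := List.finRange _
  lab _ := a
  ext := List.finRange _
  rk_lab _ := by simp

end Hypergraph

/-- A hypergraph in which exactly one hyperedge is labeled by a hole label `$_d` instead of an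
element of `L`. Here `E` is the set of the other hyperedges, and `hole` is the string of attachment
nodes of the hole hyperedge, so `d = |hole|`. -/
structure HoleGraph (L : Type v) [Ranked L] where
  V : Type
  E : Type
  [finV : Finite V]
  [finE : Finite E]
  att : E → List V
  lab : E → L
  hole : List V
  ext : List V
  rk_lab : ∀ e, Ranked.rk (lab e) = (att e).length

attribute [instance] HoleGraph.finV HoleGraph.finE

/-- The hypergraph `D[e / a^•]`, `e` being the hole hyperedge of `D`: the hole label is replaced by
the label `a`. Its hyperedges are `none` (the former hole) and `some d` for `d ∈ D.E`. -/
def HoleGraph.fill {L : Type v} [Ranked L] (D : HoleGraph L) (a : L)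
    (ha : Ranked.rk a = D.hole.length) : Hypergraph L where
  V := D.V
  E := Option D.E
  att e := e.elim D.hole D.att
  lab e := e.elim a D.lab
  ext := D.ext
  rk_lab := by
    rintro (_ | e)
    · exact ha
    · exact D.rk_lab e

/-! ### Formulas

Hypergraphs are considered up to isomorphism, and so are the hypergraphs inside formulas. Hence the
formulas are the (rank-correct) formal expressions modulo isomorphism of the hypergraphs in them. -/

/-- Formal expressions `p`, `×(M)`, `N ÷ D`, without the rank conditions. -/
inductive PreFormula (Pr : Type u) : Type (max u 1)
  | prim (p : Pr) : PreFormula Pr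
  | times (V E : Type) [Finite V] [Finite E] (att : E → List V) (lab : E → PreFormula Pr)
      (ext : List V) : PreFormula Pr
  | div (N : PreFormula Pr) (V E : Type) [Finite V] [Finite E] (att : E → List V)
      (lab : E → PreFormula Pr) (hole ext : List V) : PreFormula Pr

namespace PreFormula

variable {Pr : Type u}

def rk [Ranked Pr] : PreFormula Pr → ℕ
  | prim p => Ranked.rk p
  | times _ _ _ _ ext => ext.length
  | div _ _ _ _ _ hole _ => hole.length

/-- The rank conditions in the definition of formulas. -/
def WF [Ranked Pr] : PreFormula Pr → Prop
  | prim _ => True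
  | times _ _ att lab _ => ∀ e, (lab e).WF ∧ (lab e).rk = (att e).length
  | div N _ _ att lab _ ext =>
      (N.WF ∧ N.rk = ext.length) ∧ ∀ e, (lab e).WF ∧ (lab e).rk = (att e).length

/-- Equality of formal expressions up to isomorphism of the hypergraphs in them. -/
inductive Equiv : PreFormula Pr → PreFormula Pr → Prop
  | prim (p : Pr) : Equiv (prim p) (prim p)
  | times {V E V' E' : Type} [Finite V] [Finite E] [Finite V'] [Finite E']
      {att : E → List V} {lab : E → PreFormula Pr} {ext : List V}
      {att' : E' → List V'} {lab' : E' → PreFormula Pr} {ext' : List V'}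
      (σ : V ≃ V') (τ : E ≃ E') (hatt : ∀ e, att' (τ e) = (att e).map σ)
      (hlab : ∀ e, Equiv (lab e) (lab' (τ e))) (hext : ext' = ext.map σ) :
      Equiv (times V E att lab ext) (times V' E' att' lab' ext')
  | div {N N' : PreFormula Pr} {V E V' E' : Type} [Finite V] [Finite E] [Finite V'] [Finite E']
      {att : E → List V} {lab : E → PreFormula Pr} {hole ext : List V}
      {att' : E' → List V'} {lab' : E' → PreFormula Pr} {hole' ext' : List V'}
      (hN : Equiv N N')
      (σ : V ≃ V') (τ : E ≃ E') (hatt : ∀ e, att' (τ e) = (att e).map σ)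
      (hlab : ∀ e, Equiv (lab e) (lab' (τ e))) (hhole : hole' = hole.map σ)
      (hext : ext' = ext.map σ) :
      Equiv (div N V E att lab hole ext) (div N' V' E' att' lab' hole' ext')

theorem Equiv.refl (A : PreFormula Pr) : Equiv A A := by
  induction A with
  | prim p => exact .prim p
  | times V E att lab ext ih =>
    exact .times (_root_.Equiv.refl V) (_root_.Equiv.refl E) (by simp) ih (by simp)
  | div N V E att lab hole ext ihN ih =>
    exact .div ihN (_root_.Equiv.refl V) (_root_.Equiv.refl E) (by simp) ih (by simp) (by simp)

theorem Equiv.symm {A B : PreFormula Pr} (h : Equiv A B) : Equiv B A := by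
  induction h with
  | prim p => exact .prim p
  | times σ τ hatt hlab hext ih =>
    refine .times σ.symm τ.symm (fun e => ?_) (fun e => ?_) ?_
    · have := hatt (τ.symm e)
      simp_all
    · simpa using ih (τ.symm e)
    · simp [hext]
  | div hN σ τ hatt hlab hhole hext ihN ih =>
    refine .div ihN σ.symm τ.symm (fun e => ?_) (fun e => ?_) ?_ ?_
    · have := hatt (τ.symm e)
      simp_all
    · simpa using ih (τ.symm e)
    · simp [hhole]
    · simp [hext]

theorem Equiv.trans {A B C : PreFormula Pr} (h : Equiv A B) (h' : Equiv B C) : Equiv A C := by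
  induction h generalizing C with
  | prim p => exact h'
  | times σ τ hatt hlab hext ih =>
    cases h' with
    | times σ' τ' hatt' hlab' hext' =>
      exact .times (σ.trans σ') (τ.trans τ') (fun e => by simp [hatt', hatt])
        (fun e => ih e (hlab' (τ e))) (by simp [hext', hext])
  | div hN σ τ hatt hlab hhole hext ihN ih =>
    cases h' with
    | div hN' σ' τ' hatt' hlab' hhole' hext' =>
      exact .div (ihN hN') (σ.trans σ') (τ.trans τ') (fun e => by simp [hatt', hatt])
        (fun e => ih e (hlab' (τ e))) (by simp [hhole', hhole]) (by simp [hext', hext])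

theorem Equiv.rk_eq [Ranked Pr] {A B : PreFormula Pr} (h : Equiv A B) : A.rk = B.rk := by
  cases h <;> simp_all [rk]

/-- Rank-correct formal expressions, compared up to isomorphism. -/
instance setoid (Pr : Type u) [Ranked Pr] : Setoid {A : PreFormula Pr // A.WF} where
  r A B := Equiv A.1 B.1
  iseqv := ⟨fun A => .refl A.1, fun h => h.symm, fun h h' => h.trans h'⟩

end PreFormula

/-- The set of formulas of the hypergraph Lambek calculus with primitive formulas `Pr`. -/
def Formula (Pr : Type u) [Ranked Pr] : Type (max u 1) := Quotient (PreFormula.setoid Pr)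

namespace Formula

variable {Pr : Type u} [Ranked Pr]

instance : Ranked (Formula Pr) :=
  ⟨Quotient.lift (fun A => A.1.rk) fun _ _ h => PreFormula.Equiv.rk_eq h⟩

/-- A formal expression representing the formula `A`. -/
noncomputable def repr (A : Formula Pr) : PreFormula Pr := (Quotient.out A).1

theorem repr_wf (A : Formula Pr) : A.repr.WF := (Quotient.out A).2

theorem repr_rk (A : Formula Pr) : A.repr.rk = Ranked.rk A :=
  congrArg (Ranked.rk (L := Formula Pr)) (Quotient.out_eq A)

/-- A primitive formula. -/
def prim (p : Pr) : Formula Pr := Quotient.mk _ ⟨.prim p, trivial⟩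

/-- The formula `×(M)`; its rank is that of `M`. -/
noncomputable def times (M : Hypergraph (Formula Pr)) : Formula Pr :=
  Quotient.mk _ ⟨.times M.V M.E M.att (fun e => (M.lab e).repr) M.ext,
    fun e => ⟨repr_wf _, (repr_rk _).trans (M.rk_lab e)⟩⟩

/-- The formula `N ÷ D`, where `rk N = rk D`; its rank is that of the hole label of `D`. -/
noncomputable def div (N : Formula Pr) (D : HoleGraph (Formula Pr))
    (h : Ranked.rk N = D.ext.length) : Formula Pr :=
  Quotient.mk _ ⟨.div N.repr D.V D.E D.att (fun e => (D.lab e).repr) D.hole D.ext,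
    ⟨repr_wf _, (repr_rk _).trans h⟩, fun e => ⟨repr_wf _, (repr_rk _).trans (D.rk_lab e)⟩⟩

end Formula

/-- Derivability of a sequent `H → A` in the hypergraph Lambek calculus. Antecedents are considered
up to isomorphism (`iso`). Replacing a hyperedge by a handle is the same as relabeling it, so
`H[e/a^•]` is written as a hypergraph `H` with `lab e = a`, and `D[e/a^•]`, for the hole hyperedge
`e` of `D`, as `D.fill a`. In `divR`, the label put on the hole is immaterial, since this hyperedge
is then replaced by `F`. -/
inductive Derivable {Pr : Type u} [Ranked Pr] : Hypergraph (Formula Pr) → Formula Pr → Prop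
  | iso {G H : Hypergraph (Formula Pr)} {A : Formula Pr} :
      G.Iso H → Derivable G A → Derivable H A
  | ax (A : Formula Pr) : Derivable (Hypergraph.handle A) A
  | timesL (H : Hypergraph (Formula Pr)) (e : H.E) (M : Hypergraph (Formula Pr)) (A : Formula Pr) :
      H.lab e = Formula.times M → Derivable (H.replaceOne e M) A → Derivable H A
  | timesR (M : Hypergraph (Formula Pr)) (H : M.E → Hypergraph (Formula Pr)) :
      (∀ m, Derivable (H m) (M.lab m)) → Derivable (M.replaceAll H) (Formula.times M)
  | divL (H : Hypergraph (Formula Pr)) (e : H.E) (A N : Formula Pr) (D : HoleGraph (Formula Pr))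
      (hD : Ranked.rk N = D.ext.length) (K : D.E → Hypergraph (Formula Pr)) :
      H.lab e = N → Derivable H A → (∀ d, Derivable (K d) (D.lab d)) →
      Derivable (H.replaceOne e
        ((D.fill (Formula.div N D hD) rfl).replace Function.Embedding.some K)) A
  | divR (F : Hypergraph (Formula Pr)) (N : Formula Pr) (D : HoleGraph (Formula Pr))
      (hD : Ranked.rk N = D.ext.length) :
      Ranked.rk F = D.hole.length →
      Derivable ((D.fill (Formula.div N D hD) rfl).replaceOne none F) N →
      Derivable F (Formula.div N D hD)

end HL

namespace NLM

/-- Formulas of the multimodal Lambek calculus with primitive formulas `P`, modes `I` and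
modalities `J`. -/
inductive Formula (P I J : Type u) : Type u
  | prim (p : P) : Formula P I J
  /-- `A •_i B` -/
  | prod (i : I) (A B : Formula P I J) : Formula P I J
  /-- `ldiv i B A` is `B \_i A` -/
  | ldiv (i : I) (B A : Formula P I J) : Formula P I J
  /-- `rdiv i A B` is `A /_i B` -/
  | rdiv (i : I) (A B : Formula P I J) : Formula P I J
  | dia (j : J) (A : Formula P I J) : Formula P I J
  | box (j : J) (A : Formula P I J) : Formula P I J

/-- Structured databases: a formula, `(Π₁, Π₂)^i`, or `⟨Π⟩^j`. -/
inductive Database (P I J : Type u) : Type u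
  | form (A : Formula P I J) : Database P I J
  | pair (i : I) (X Y : Database P I J) : Database P I J
  | bracket (j : J) (X : Database P I J) : Database P I J

/-- Structured databases `Δ[·]` with one distinguished place. -/
inductive Ctx (P I J : Type u) : Type u
  | hole : Ctx P I J
  | pairLeft (i : I) (Δ : Ctx P I J) (Y : Database P I J) : Ctx P I J
  | pairRight (i : I) (X : Database P I J) (Δ : Ctx P I J) : Ctx P I J
  | bracket (j : J) (Δ : Ctx P I J) : Ctx P I J

/-- The structured database `Δ[X]`. -/
def Ctx.plug {P I J : Type u} : Ctx P I J → Database P I J → Database P I J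
  | hole, X => X
  | pairLeft i Δ Y, X => .pair i (Δ.plug X) Y
  | pairRight i Y Δ, X => .pair i Y (Δ.plug X)
  | bracket j Δ, X => .bracket j (Δ.plug X)

open Formula Database in
/-- Derivability of a sequent `Π → A` in the multimodal Lambek calculus with the set `C` of
commutative modes and the set `A` of associative modes. -/
inductive Derivable {P I J : Type u} (C A : Set I) : Database P I J → Formula P I J → Prop
  | ax (T : Formula P I J) : Derivable C A (form T) T
  | prodL (Δ : Ctx P I J) (i : I) (S T U : Formula P I J) :
      Derivable C A (Δ.plug (pair i (form S) (form T))) U →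
      Derivable C A (Δ.plug (form (prod i S T))) U
  | prodR (i : I) (X Y : Database P I J) (S T : Formula P I J) :
      Derivable C A X S → Derivable C A Y T → Derivable C A (pair i X Y) (prod i S T)
  | ldivL (Δ : Ctx P I J) (i : I) (X : Database P I J) (S T U : Formula P I J) :
      Derivable C A (Δ.plug (form S)) U → Derivable C A X T →
      Derivable C A (Δ.plug (pair i X (form (ldiv i T S)))) U
  | ldivR (i : I) (X : Database P I J) (S T : Formula P I J) :
      Derivable C A (pair i (form T) X) S → Derivable C A X (ldiv i T S)
  | rdivL (Δ : Ctx P I J) (i : I) (X : Database P I J) (S T U : Formula P I J) :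
      Derivable C A (Δ.plug (form S)) U → Derivable C A X T →
      Derivable C A (Δ.plug (pair i (form (rdiv i S T)) X)) U
  | rdivR (i : I) (X : Database P I J) (S T : Formula P I J) :
      Derivable C A (pair i X (form T)) S → Derivable C A X (rdiv i S T)
  | diaL (Δ : Ctx P I J) (j : J) (S U : Formula P I J) :
      Derivable C A (Δ.plug (bracket j (form S))) U →
      Derivable C A (Δ.plug (form (dia j S))) U
  | diaR (j : J) (X : Database P I J) (S : Formula P I J) :
      Derivable C A X S → Derivable C A (bracket j X) (dia j S)
  | boxL (Δ : Ctx P I J) (j : J) (S U : Formula P I J) :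
      Derivable C A (Δ.plug (form S)) U →
      Derivable C A (Δ.plug (bracket j (form (box j S)))) U
  | boxR (j : J) (X : Database P I J) (S : Formula P I J) :
      Derivable C A (bracket j X) S → Derivable C A X (box j S)
  | perm (Δ : Ctx P I J) (c : I) (X Y : Database P I J) (U : Formula P I J) : c ∈ C →
      Derivable C A (Δ.plug (pair c X Y)) U → Derivable C A (Δ.plug (pair c Y X)) U
  | assocL (Δ : Ctx P I J) (a : I) (X Y Z : Database P I J) (U : Formula P I J) : a ∈ A →
      Derivable C A (Δ.plug (pair a X (pair a Y Z))) U →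
      Derivable C A (Δ.plug (pair a (pair a X Y) Z)) U
  | assocR (Δ : Ctx P I J) (a : I) (X Y Z : Database P I J) (U : Formula P I J) : a ∈ A →
      Derivable C A (Δ.plug (pair a (pair a X Y) Z)) U →
      Derivable C A (Δ.plug (pair a X (pair a Y Z))) U

end NLM

open HL in
/-- The sets of modes `I` and modalities `J` as disjoint sets of primitive formulas of the hypergraph
Lambek calculus, with the set `C ⊆ I` of commutative modes; noncommutative modes have rank 3,
commutative modes and modalities have rank 2. -/
structure ModeSystem (Pr : Type u) [Ranked Pr] where
  I : Set Pr
  J : Set Pr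
  C : Set I
  disj : Disjoint I J
  rk_mode : ∀ i : I, i ∉ C → Ranked.rk i.1 = 3
  rk_comm : ∀ c : I, c ∈ C → Ranked.rk c.1 = 2
  rk_modality : ∀ j : J, Ranked.rk j.1 = 2

namespace ModeSystem

open HL

section Patterns

variable {L : Type v} [Ranked L]

/-- `R^i(A, B)`; the hyperedges `r₀, r₁, r₂` are `0, 1, 2`. -/
def R (i A B : L) (hi : Ranked.rk i = 3) (hA : Ranked.rk A = 1) (hB : Ranked.rk B = 1) :
    HL.Hypergraph L where
  V := Fin 3
  E := Fin 3
  att := ![[0, 1, 2], [1], [2]]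
  lab := ![i, A, B]
  ext := [0]
  rk_lab := by simp [Fin.forall_fin_succ, hi, hA, hB]

/-- `R^i(B, $₁)` -/
def RHoleRight (i B : L) (hi : Ranked.rk i = 3) (hB : Ranked.rk B = 1) : HoleGraph L where
  V := Fin 3
  E := Fin 2
  att := ![[0, 1, 2], [1]]
  lab := ![i, B]
  hole := [2]
  ext := [0]
  rk_lab := by simp [Fin.forall_fin_succ, hi, hB]

/-- `R^i($₁, B)` -/
def RHoleLeft (i B : L) (hi : Ranked.rk i = 3) (hB : Ranked.rk B = 1) : HoleGraph L where
  V := Fin 3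
  E := Fin 2
  att := ![[0, 1, 2], [2]]
  lab := ![i, B]
  hole := [1]
  ext := [0]
  rk_lab := by simp [Fin.forall_fin_succ, hi, hB]

/-- `K^c(A, B)`; the hyperedges `k₀, k₁, k₂` are `0, 1, 2`. -/
def K (c A B : L) (hc : Ranked.rk c = 2) (hA : Ranked.rk A = 1) (hB : Ranked.rk B = 1) :
    HL.Hypergraph L where
  V := Fin 2
  E := Fin 3
  att := ![[0, 1], [1], [1]]
  lab := ![c, A, B]
  ext := [0]
  rk_lab := by simp [Fin.forall_fin_succ, hc, hA, hB]

/-- `K^c(B, $₁)` -/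
def KHole (c B : L) (hc : Ranked.rk c = 2) (hB : Ranked.rk B = 1) : HoleGraph L where
  V := Fin 2
  E := Fin 2
  att := ![[0, 1], [1]]
  lab := ![c, B]
  hole := [1]
  ext := [0]
  rk_lab := by simp [Fin.forall_fin_succ, hc, hB]

/-- `U^j(A)`; the hyperedges `u₀, u₁` are `0, 1`. -/
def U (j A : L) (hj : Ranked.rk j = 2) (hA : Ranked.rk A = 1) : HL.Hypergraph L where
  V := Fin 2
  E := Fin 2
  att := ![[0, 1], [1]]
  lab := ![j, A]
  ext := [0]
  rk_lab := by simp [Fin.forall_fin_succ, hj, hA]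

/-- `U^j($₁)` -/
def UHole (j : L) (hj : Ranked.rk j = 2) : HoleGraph L where
  V := Fin 2
  E := Fin 1
  att := ![[0, 1]]
  lab := ![j]
  hole := [1]
  ext := [0]
  rk_lab := by simp [hj]

end Patterns

variable {Pr : Type u} [Ranked Pr] (S : ModeSystem Pr)

/-- The formulas of the multimodal Lambek calculus with modes `I` and modalities `J`; its primitive
formulas are the elements of `Pr` of rank 1. -/
abbrev Fm : Type u := NLM.Formula {p : Pr // Ranked.rk p = 1} S.I S.J

/-- The structured databases of the same calculus. -/
abbrev Db : Type u := NLM.Database {p : Pr // Ranked.rk p = 1} S.I S.J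

open Classical in
/-- The translation `μ` of formulas, with the information that `μ(A)` has rank 1. -/
noncomputable def muAux : S.Fm → {A : Formula Pr // Ranked.rk A = 1}
  | .prim p => ⟨.prim p.1, p.2⟩
  | .prod i A B =>
      if h : i ∈ S.C then
        ⟨.times (K (.prim i) (muAux A).1 (muAux B).1 (S.rk_comm i h) (muAux A).2 (muAux B).2), rfl⟩
      else
        ⟨.times (R (.prim i) (muAux A).1 (muAux B).1 (S.rk_mode i h) (muAux A).2 (muAux B).2), rfl⟩
  | .ldiv i B A =>
      if h : i ∈ S.C then
        ⟨.div (muAux A).1 (KHole (.prim i) (muAux B).1 (S.rk_comm i h) (muAux B).2) (muAux A).2, rfl⟩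
      else
        ⟨.div (muAux A).1 (RHoleRight (.prim i) (muAux B).1 (S.rk_mode i h) (muAux B).2)
          (muAux A).2, rfl⟩
  | .rdiv i A B =>
      if h : i ∈ S.C then
        ⟨.div (muAux A).1 (KHole (.prim i) (muAux B).1 (S.rk_comm i h) (muAux B).2) (muAux A).2, rfl⟩
      else
        ⟨.div (muAux A).1 (RHoleLeft (.prim i) (muAux B).1 (S.rk_mode i h) (muAux B).2)
          (muAux A).2, rfl⟩
  | .dia j A => ⟨.times (U (.prim j) (muAux A).1 (S.rk_modality j) (muAux A).2), rfl⟩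
  | .box j A => ⟨.div (muAux A).1 (UHole (.prim j) (S.rk_modality j)) (muAux A).2, rfl⟩

/-- The translation `μ` of formulas. -/
noncomputable def mu (A : S.Fm) : Formula Pr := (S.muAux A).1

/-- A formula of rank 1, used only as a label of hyperedges that are replaced at once, so that it
does not matter which one it is. -/
noncomputable def dummy (Pr : Type u) [Ranked Pr] : {A : Formula Pr // Ranked.rk A = 1} :=
  ⟨.times { V := Unit, E := Empty, att := Empty.elim, lab := Empty.elim, ext := [()],
            rk_lab := fun e => e.elim }, rfl⟩

open Classical in
/-- The translation of structured databases into hypergraphs: `htree(A) = μ(A)^•`,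
`htree((Π₁, Π₂)^i) = R^i[r₁/htree(Π₁), r₂/htree(Π₂)]` for noncommutative `i`,
`htree((Π₁, Π₂)^c) = K^c[k₁/htree(Π₁), k₂/htree(Π₂)]` for commutative `c`, and
`htree(⟨Π⟩^j) = U^j[u₁/htree(Π)]`. -/
noncomputable def htree : S.Db → HL.Hypergraph (Formula Pr)
  | .form A => .handle (S.mu A)
  | .pair i X Y =>
      if h : i ∈ S.C then
        (K (.prim i) (dummy Pr).1 (dummy Pr).1 (S.rk_comm i h) (dummy Pr).2 (dummy Pr).2).replace
          (Fin.succEmb 2) ![htree X, htree Y]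
      else
        (R (.prim i) (dummy Pr).1 (dummy Pr).1 (S.rk_mode i h) (dummy Pr).2 (dummy Pr).2).replace
          (Fin.succEmb 2) ![htree X, htree Y]
  | .bracket j X =>
      (U (.prim j) (dummy Pr).1 (S.rk_modality j) (dummy Pr).2).replaceOne (1 : Fin 2) (htree X)

/-- The labels of hyperedges of translated antecedents: the formulas `μ(A)`, and the modes and
modalities as primitive formulas. -/
def labels : Set (Formula Pr) :=
  Set.range S.mu ∪ Formula.prim '' (S.I ∪ S.J)

end ModeSystem

/-! The hypergraph of a structured database is a tree in disguise. A hyperedge labeled by a mode or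
modality joins the root of a subtree to the roots of its arguments, and the leaves are rank-1
hyperedges labeled by translated formulas. Modes and modalities have rank 2 or 3, translations have
rank 1, so the two kinds of hyperedges cannot be confused. `Tree` expresses this shape by multisets
of nodes and labeled attachment strings, and `Represents G X` says that `G` has the shape of `X`.
Two hypergraphs representing the same database are isomorphic (`Represents.iso`). Two databases
represented by the same hypergraph differ only by swaps at commutative modes and by exchanging
formulas with equal translations (`Represents.dbEq`).

From the multimodal to the hypergraph calculus (`Der.derivable`), every logical rule is simulated by
one rule of the hypergraph calculus; the extra premise for the mode or modality of the pattern is an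
axiom. Permutation needs no rule at all, since both databases are represented by the same
hypergraphs.

The converse (`of_derivable`) is an induction on derivations. There is no cut rule, so the labels of
all premises are again translations, modes or modalities. The main work is to invert replacement: if
the antecedent of a premise represents a database, then the pattern inserted by the rule is visible
in that database as a product of two formulas, a bracketed formula, or an outermost pair or bracket
(`IsPat.of_represents`, `IsUPat.of_represents`, `IsHole.of_represents`, `IsUHole.of_represents`).
Premises whose succedent is a mode or modality also occur; for these the induction shows that the
antecedent is just the handle.

The translation is not injective: it forgets the order of the arguments of commutative modes and the
direction of commutative division. The induction therefore produces only some database and some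
formula with the right translations. This suffices for the second claim. For the first one,
derivability must be invariant under these identifications, which is `Der.congr`; it rests on the
interderivability of formulas with equal translations (`Der.of_mu_eq`). -/

namespace HL

/-! ### Sums of finite families of multisets. -/

/-- The sum of a finite family of multisets. -/
noncomputable def msum {α β : Type*} [Finite α] (f : α → Multiset β) : Multiset β :=
  letI := Fintype.ofFinite α
  ∑ a, f a

section msum

variable {α β γ δ : Type*} [Finite α] [Finite β]

theorem msum_eq_sum [h : Fintype α] (f : α → Multiset γ) : msum f = ∑ a, f a := by
  have : Fintype.ofFinite α = h := Subsingleton.elim _ _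
  subst this
  rfl

theorem msum_equiv (τ : α ≃ β) (f : β → Multiset γ) : msum (fun a => f (τ a)) = msum f := by
  let _ := Fintype.ofFinite α
  let _ := Fintype.ofFinite β
  rw [msum_eq_sum, msum_eq_sum]
  exact τ.sum_comp f

theorem msum_sumType (f : α ⊕ β → Multiset γ) :
    msum f = msum (fun a => f (.inl a)) + msum (fun b => f (.inr b)) := by
  let _ := Fintype.ofFinite α
  let _ := Fintype.ofFinite β
  simp only [msum_eq_sum]
  exact Fintype.sum_sum_type f

theorem msum_option (f : Option α → Multiset γ) :
    msum f = f none + msum (fun a => f (some a)) := by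
  let _ := Fintype.ofFinite α
  simp only [msum_eq_sum]
  exact Fintype.sum_option f

theorem msum_sigma {δ : α → Type*} [∀ a, Finite (δ a)] (f : (Σ a, δ a) → Multiset γ) :
    msum f = msum (fun a => msum (fun b => f ⟨a, b⟩)) := by
  let _ := Fintype.ofFinite α
  let _ := fun a => Fintype.ofFinite (δ a)
  simp only [msum_eq_sum]
  exact Fintype.sum_sigma f

theorem map_msum (g : γ → δ) (f : α → Multiset γ) :
    (msum f).map g = msum (fun a => (f a).map g) := by
  let _ := Fintype.ofFinite α
  simp only [msum_eq_sum]
  exact map_sum (Multiset.mapAddMonoidHom g) f Finset.univ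

theorem msum_unit (f : Unit → Multiset γ) : msum f = f () := by
  simp [msum_eq_sum]

theorem msum_mono {f g : α → Multiset γ} (h : ∀ a, f a ≤ g a) : msum f ≤ msum g := by
  let _ := Fintype.ofFinite α
  simp only [msum_eq_sum]
  exact Finset.sum_le_sum fun a _ => h a

theorem mem_msum {f : α → Multiset γ} {x : γ} : x ∈ msum f ↔ ∃ a, x ∈ f a := by
  let _ := Fintype.ofFinite α
  simp [msum_eq_sum, Multiset.mem_sum]

theorem msum_singleton_eq_univ [Fintype α] : msum (fun a : α => {a}) = Finset.univ.val := by
  rw [msum_eq_sum]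
  exact Finset.sum_multiset_singleton _

theorem nodup_msum_singleton : (msum (fun a : α => {a})).Nodup := by
  let _ := Fintype.ofFinite α
  rw [msum_singleton_eq_univ]
  exact Finset.univ.nodup

theorem msum_singleton_map (f : α → γ) :
    msum (fun a => {f a}) = (msum (fun a : α => {a})).map f := by
  simp [map_msum]

/-- The multiplicity of a value is the size of its fibre, so corresponding fibres are equinumerous;
bijections between them glue to one bijection of the index types. -/
theorem exists_equiv_of_msum_eq {f : α → γ} {g : β → γ}
    (h : msum (fun a => {f a}) = msum (fun b => {g b})) : ∃ τ : α ≃ β, ∀ a, g (τ a) = f a := by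
  classical
  let _ := Fintype.ofFinite α
  let _ := Fintype.ofFinite β
  have key : ∀ c, Nonempty ({a // f a = c} ≃ {b // g b = c}) := by
    intro c
    refine ⟨Fintype.equivOfCardEq ?_⟩
    have h1 := congrArg (Multiset.count c) h
    rw [msum_singleton_map f, msum_singleton_map g, msum_singleton_eq_univ,
      msum_singleton_eq_univ, Multiset.count_map, Multiset.count_map] at h1
    rw [Fintype.card_subtype, Fintype.card_subtype]
    simpa [Finset.card_def, Finset.filter_val, eq_comm] using h1
  refine ⟨(Equiv.sigmaFiberEquiv f).symm.trans
    ((Equiv.sigmaCongrRight fun c => (key c).some).trans (Equiv.sigmaFiberEquiv g)), fun a => ?_⟩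
  exact ((key (f a)).some ⟨a, rfl⟩).2

end msum

/-! ### Hypergraphs seen through their multisets of nodes and hyperedges. -/

namespace Hypergraph

variable {L : Type v} [Ranked L]

/-- The multiset of all nodes. -/
noncomputable def nodes (G : Hypergraph L) : Multiset G.V := msum fun v => {v}

/-- The multiset of all hyperedges, given by their labels and attachment strings. -/
noncomputable def edges (G : Hypergraph L) : Multiset (L × List G.V) :=
  msum fun e => {(G.lab e, G.att e)}

/-- Renaming of the nodes of a labeled string of nodes. -/
def rename {L : Type v} {V V' : Type} (f : V → V') (r : L × List V) : L × List V' :=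
  (r.1, r.2.map f)

@[simp] theorem rename_mk {L : Type v} {V V' : Type} (f : V → V') (l : L) (a : List V) :
    rename f (l, a) = (l, a.map f) := rfl

theorem rename_comp {L : Type v} {V V' V'' : Type} (g : V' → V'') (f : V → V') :
    (rename g ∘ rename f : L × List V → L × List V'') = rename (g ∘ f) := by
  funext r
  simp [rename]

theorem rename_id {L : Type v} {V : Type} : (rename id : L × List V → L × List V) = id := by
  funext r
  simp [rename]

theorem nodup_nodes (G : Hypergraph L) : G.nodes.Nodup := nodup_msum_singleton

theorem mem_nodes {G : Hypergraph L} (v : G.V) : v ∈ G.nodes := mem_msum.2 ⟨v, by simp⟩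

theorem mem_edges {G : Hypergraph L} {r : L × List G.V} :
    r ∈ G.edges ↔ ∃ e, (G.lab e, G.att e) = r := by
  simp [edges, mem_msum, eq_comm]

theorem Iso.refl (G : Hypergraph L) : G.Iso G :=
  ⟨Equiv.refl _, Equiv.refl _, by simp, by simp, by simp⟩

theorem Iso.symm {G H : Hypergraph L} : G.Iso H → H.Iso G := by
  rintro ⟨σ, τ, hatt, hlab, hext⟩
  refine ⟨σ.symm, τ.symm, fun e => ?_, fun e => ?_, ?_⟩
  · have := hatt (τ.symm e)
    simp_all
  · have := hlab (τ.symm e)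
    simp_all
  · simp [hext]

theorem Iso.trans {G H K : Hypergraph L} : G.Iso H → H.Iso K → G.Iso K := by
  rintro ⟨σ, τ, hatt, hlab, hext⟩ ⟨σ', τ', hatt', hlab', hext'⟩
  exact ⟨σ.trans σ', τ.trans τ', fun e => by simp [hatt', hatt], fun e => by simp [hlab', hlab],
    by simp [hext', hext]⟩

theorem Iso.exists_map {G H : Hypergraph L} : G.Iso H → ∃ f : G.V → H.V,
    H.nodes = G.nodes.map f ∧ H.edges = G.edges.map (rename f) ∧ H.ext = G.ext.map f := by
  rintro ⟨σ, τ, hatt, hlab, hext⟩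
  refine ⟨σ, ?_, ?_, hext⟩
  · rw [nodes, nodes, ← msum_singleton_map, ← msum_equiv σ]
  · rw [edges, edges, map_msum, ← msum_equiv τ]
    simp [hatt, hlab]

/-- `G.nodes` and `H.nodes` list every node exactly once, so a map carrying one to the other is
automatically bijective. A bijection of hyperedges exists because the multisets of labeled
attachment strings agree. Isomorphisms are thereby reduced to identities between multisets. -/
theorem iso_of_map {G H : Hypergraph L} (f : G.V → H.V) (hV : G.nodes.map f = H.nodes)
    (hE : G.edges.map (rename f) = H.edges) (hext : H.ext = G.ext.map f) : G.Iso H := by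
  have hf : Function.Bijective f := by
    have hn : (G.nodes.map f).Nodup := hV ▸ H.nodup_nodes
    refine ⟨fun x y hxy => Multiset.inj_on_of_nodup_map hn x (mem_nodes x) y (mem_nodes y) hxy,
      fun w => ?_⟩
    have hw : w ∈ G.nodes.map f := hV ▸ mem_nodes w
    obtain ⟨v, -, hv⟩ := Multiset.mem_map.1 hw
    exact ⟨v, hv⟩
  have hE' : msum (fun e => {(G.lab e, (G.att e).map f)}) =
      msum (fun e => {(H.lab e, H.att e)}) := by
    rw [edges, map_msum] at hE
    simpa [edges] using hE
  obtain ⟨τ, hτ⟩ := exists_equiv_of_msum_eq hE'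
  refine ⟨Equiv.ofBijective f hf, τ, fun e => ?_, fun e => ?_, hext⟩
  · exact congrArg Prod.snd (hτ e)
  · exact congrArg Prod.fst (hτ e)

/-! ### Nodes and hyperedges of a replacement. -/

section replace

variable (G : Hypergraph L) {ι : Type} (m : ι ↪ G.E) (H : ι → Hypergraph L)

/-- The node of a replacement coming from a node of the host. -/
def inHost (v : G.V) : (G.replace m H).V := Quot.mk _ (.inl v)

/-- The node of a replacement coming from a node of an inserted hypergraph. -/
def inPart (i : ι) (w : (H i).V) : (G.replace m H).V := Quot.mk _ (.inr ⟨i, w⟩)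

variable {G m H}

theorem map_inPart_ext (hlen : ∀ i, (H i).ext.length = (G.att (m i)).length) (i : ι) :
    (H i).ext.map (inPart G m H i) = (G.att (m i)).map (inHost G m H) := by
  refine List.ext_getElem (by simp [hlen]) fun k h1 h2 => ?_
  simp only [List.getElem_map]
  refine (Quot.sound ⟨i, k, _, _, ?_, ?_, rfl, rfl⟩).symm <;> simp

/-- The replaced hyperedges are added on the left rather than subtracted on the right, which avoids
truncated subtraction; each use cancels them once the labels and attachments are known. -/
theorem edges_replace [Finite ι] : (G.replace m H).edges +
      msum (fun i => {(G.lab (m i), (G.att (m i)).map (inHost G m H))}) =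
    G.edges.map (rename (inHost G m H)) +
      msum (fun i => (H i).edges.map (rename (inPart G m H i))) := by
  have hb : Function.Bijective (Sum.elim Subtype.val m : {e : G.E // ∀ i, m i ≠ e} ⊕ ι → G.E) := by
    constructor
    · rintro (⟨a, ha⟩ | a) (⟨b, hb⟩ | b) h
      · simp_all
      · exact absurd h.symm (ha b)
      · exact absurd h (hb a)
      · simpa using h
    · intro e
      by_cases h : ∀ i, m i ≠ e
      · exact ⟨.inl ⟨e, h⟩, rfl⟩
      · push Not at h
        obtain ⟨i, hi⟩ := h
        exact ⟨.inr i, hi⟩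
  have h1 : G.edges.map (rename (inHost G m H)) =
      msum (fun e : {e : G.E // ∀ i, m i ≠ e} => {(G.lab e, (G.att e).map (inHost G m H))}) +
      msum (fun i => {(G.lab (m i), (G.att (m i)).map (inHost G m H))}) := by
    rw [edges, map_msum, ← msum_equiv (Equiv.ofBijective _ hb), msum_sumType]
    rfl
  have h2 : (G.replace m H).edges =
      msum (fun e : {e : G.E // ∀ i, m i ≠ e} => {(G.lab e, (G.att e).map (inHost G m H))}) +
      msum (fun i => (H i).edges.map (rename (inPart G m H i))) := by
    refine (msum_sumType (α := {e : G.E // ∀ i, m i ≠ e}) (β := Σ i, (H i).E) _).trans ?_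
    congr 1
    refine (msum_sigma _).trans ?_
    congr 1
    funext i
    rw [edges, map_msum]
    rfl
  rw [h1, h2]
  abel

/-- If the external nodes of each inserted hypergraph are distinct, gluing never merges two host
nodes and never touches an inner node. What remains is the host together with the inner nodes `W i`.
Distinctness need not be assumed: it follows from `hW`, because a multiset of all nodes has no
repetitions. -/
theorem nodes_replace [Finite ι] (hlen : ∀ i, (H i).ext.length = (G.att (m i)).length)
    (W : ∀ i, Multiset (H i).V) (hW : ∀ i, (H i).nodes = ↑(H i).ext + W i) :
    (G.replace m H).nodes =
      G.nodes.map (inHost G m H) + msum (fun i => (W i).map (inPart G m H i)) := by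
  classical
  have hnd : ∀ i, (H i).ext.Nodup ∧ ∀ w ∈ W i, w ∉ (H i).ext := by
    intro i
    have := (H i).nodup_nodes
    rw [hW i, Multiset.nodup_add] at this
    exact ⟨Multiset.coe_nodup.1 this.1, fun w hw hw' =>
      Multiset.disjoint_left.1 this.2.2 (Multiset.mem_coe.2 hw') hw⟩
  -- This is a section of the quotient map: an external node goes to the host node at the same
  -- position of the attachment string, an inner node to itself. For an inner node `List.idxOf`
  -- returns the length of the string of external nodes, which is out of range for the attachment
  -- string by `hlen`.
  let φ : (G.replace m H).V → G.V ⊕ (Σ i, (H i).V) := Quot.lift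
    (Sum.elim .inl fun p => ((G.att (m p.1))[List.idxOf p.2 (H p.1).ext]?).elim (.inr p) .inl) (by
      rintro _ _ ⟨i, k, v, w, hv, hw, rfl, rfl⟩
      obtain ⟨hk, hw⟩ := List.getElem?_eq_some_iff.1 hw
      have : List.idxOf w (H i).ext = k := by
        rw [← hw]
        exact (hnd i).1.idxOf_getElem k hk
      simp [this, hv])
  have hφ1 : ∀ v, φ (inHost G m H v) = .inl v := fun v => rfl
  have hφ2 : ∀ i, ∀ w ∈ W i, φ (inPart G m H i w) = .inr ⟨i, w⟩ := by
    intro i w hw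
    have : List.idxOf w (H i).ext = (G.att (m i)).length := by
      rw [← hlen]
      exact List.idxOf_eq_length ((hnd i).2 w hw)
    change ((G.att (m i))[List.idxOf w (H i).ext]?).elim
      (Sum.inr ⟨i, w⟩ : G.V ⊕ (Σ i, (H i).V)) Sum.inl = _
    rw [this]
    simp
  refine (Multiset.Nodup.ext (nodup_nodes _) ?_).2 ?_
  · refine Multiset.Nodup.of_map φ ?_
    rw [Multiset.map_add, Multiset.map_map, map_msum]
    have h1 : G.nodes.map (φ ∘ inHost G m H) = G.nodes.map .inl := rfl
    have h2 : (fun i => ((W i).map (inPart G m H i)).map φ) =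
        fun i => (W i).map fun w => .inr ⟨i, w⟩ := by
      funext i
      rw [Multiset.map_map]
      exact Multiset.map_congr rfl fun w hw => hφ2 i w hw
    rw [h1, h2]
    -- After applying `φ` the right-hand side is a part of the list of all elements of the disjoint
    -- union, hence free of repetitions.
    refine Multiset.nodup_of_le ?_ (nodup_msum_singleton (α := G.V ⊕ (Σ i, (H i).V)))
    rw [msum_sumType, msum_sigma, msum_singleton_map]
    refine add_le_add le_rfl (msum_mono fun i => ?_)
    rw [msum_singleton_map (fun w => (Sum.inr ⟨i, w⟩ : G.V ⊕ (Σ i, (H i).V)))]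
    refine Multiset.map_le_map ?_
    change W i ≤ (H i).nodes
    rw [hW i]
    exact Multiset.le_add_left _ _
  · intro q
    refine ⟨fun _ => ?_, fun _ => mem_nodes q⟩
    rw [Multiset.mem_add]
    obtain ⟨x | ⟨i, w⟩, rfl⟩ := Quot.exists_rep q
    · exact .inl (Multiset.mem_map_of_mem _ (mem_nodes x))
    · have hw := mem_nodes w
      rw [hW i, Multiset.mem_add] at hw
      rcases hw with hw | hw
      · left
        have h3 := List.mem_map_of_mem (f := inPart G m H i) (Multiset.mem_coe.1 hw)
        rw [map_inPart_ext hlen i] at h3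
        obtain ⟨v, -, hv⟩ := List.mem_map.1 h3
        exact Multiset.mem_map.2 ⟨v, mem_nodes v, hv⟩
      · exact .inr (mem_msum.2 ⟨i, Multiset.mem_map_of_mem _ hw⟩)

end replace

theorem nodes_handle (a : L) : (handle a).nodes = ↑(handle a).ext := by
  rw [nodes]
  exact msum_singleton_eq_univ (α := Fin (Ranked.rk a))

theorem edges_handle (a : L) : (handle a).edges = {(a, (handle a).ext)} := msum_unit _

theorem Iso.handle {a : L} {G : Hypergraph L} (h : G.Iso (handle a)) :
    G.nodes = ↑G.ext ∧ G.edges = {(a, G.ext)} ∧ G.ext.length = Ranked.rk a := by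
  obtain ⟨f, h1, h2, h3⟩ := h.symm.exists_map
  rw [h1, h2, h3, nodes_handle, edges_handle]
  refine ⟨rfl, rfl, ?_⟩
  exact (List.length_map _).trans List.length_finRange

section replaceOne

variable {G : Hypergraph L} {e : G.E} {H : Hypergraph L} {x : G.V} {y : H.V}

variable (G e H) in
/-- The node of `G[e/H]` coming from a node of `G`. -/
def oneHost (v : G.V) : (G.replaceOne e H).V := Quot.mk _ (.inl v)

variable (G e H) in
/-- The node of `G[e/H]` coming from a node of `H`. -/
def onePart (w : H.V) : (G.replaceOne e H).V := Quot.mk _ (.inr ⟨(), w⟩)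

theorem replaceOne_ext : (G.replaceOne e H).ext = G.ext.map (oneHost G e H) := rfl

theorem oneHost_eq (hx : G.att e = [x]) (hy : H.ext = [y]) : oneHost G e H x = onePart G e H y :=
  Quot.sound ⟨(), 0, x, y, by change (G.att e)[0]? = _; simp [hx], by simp [hy], rfl, rfl⟩

theorem edges_replaceOne : (G.replaceOne e H).edges + {(G.lab e, (G.att e).map (oneHost G e H))} =
    G.edges.map (rename (oneHost G e H)) + H.edges.map (rename (onePart G e H)) := by
  have := edges_replace (G := G) (m := ⟨fun _ : Unit => e, fun _ _ _ => rfl⟩) (H := fun _ => H)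
  rw [msum_unit, msum_unit] at this
  exact this

theorem nodes_replaceOne (hx : G.att e = [x]) (hy : H.ext = [y]) {W : Multiset H.V}
    (hW : H.nodes = y ::ₘ W) :
    (G.replaceOne e H).nodes = G.nodes.map (oneHost G e H) + W.map (onePart G e H) := by
  have := nodes_replace (G := G) (m := ⟨fun _ : Unit => e, fun _ _ _ => rfl⟩) (H := fun _ => H)
    (fun _ => by change H.ext.length = (G.att e).length; simp [hx, hy]) (fun _ => W)
    (fun _ => by rw [hW, hy]; rfl)
  rw [msum_unit] at this
  exact this

/-- All of `H` may be collapsed onto `x`, because gluing identifies nodes of `H` with `x` only. This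
transports information on `G[e/H]` back to `G`. -/
theorem exists_retraction_host (hx : G.att e = [x]) :
    ∃ ρ : (G.replaceOne e H).V → G.V, (∀ v, ρ (oneHost G e H v) = v) ∧
      ∀ w, ρ (onePart G e H w) = x := by
  refine ⟨Quot.lift (Sum.elim id fun _ => x) ?_, fun _ => rfl, fun _ => rfl⟩
  rintro _ _ ⟨i, k, v, w, hv, hw, rfl, rfl⟩
  have hv' := List.mem_of_getElem? hv
  change v ∈ G.att e at hv'
  rw [hx] at hv'
  simpa using hv'

/-- Dually, the host may be collapsed onto the single external node of `H`, which recovers `H` from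
`G[e/H]`. -/
theorem exists_retraction_part (hy : H.ext = [y]) :
    ∃ ρ : (G.replaceOne e H).V → H.V, (∀ v, ρ (oneHost G e H v) = y) ∧
      ∀ w, ρ (onePart G e H w) = w := by
  refine ⟨Quot.lift (Sum.elim (fun _ => y) fun p => p.2) ?_, fun _ => rfl, fun _ => rfl⟩
  rintro _ _ ⟨i, k, v, w, hv, hw, rfl, rfl⟩
  have hw' := List.mem_of_getElem? hw
  rw [hy] at hw'
  simpa [eq_comm] using hw'

end replaceOne

end Hypergraph

namespace HoleGraph

variable {L : Type v} [Ranked L]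

/-- The multiset of all nodes. -/
noncomputable def nodes (D : HoleGraph L) : Multiset D.V := msum fun v => {v}

/-- Isomorphism of hypergraphs with a hole. -/
def Iso (D D' : HoleGraph L) : Prop :=
  ∃ (σ : D.V ≃ D'.V) (τ : D.E ≃ D'.E), (∀ e, D'.att (τ e) = (D.att e).map σ) ∧
    (∀ e, D'.lab (τ e) = D.lab e) ∧ D'.hole = D.hole.map σ ∧ D'.ext = D.ext.map σ

end HoleGraph

/-! ### Formulas of the hypergraph calculus determine their constituents up to isomorphism. -/

namespace Formula

variable {Pr : Type u} [Ranked Pr]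

theorem eq_of_repr_equiv {A B : Formula Pr} (h : PreFormula.Equiv A.repr B.repr) : A = B := by
  rw [← Quotient.out_eq A, ← Quotient.out_eq B]
  exact Quotient.sound h

theorem prim_injective : Function.Injective (prim : Pr → Formula Pr) := by
  intro p q h
  have h' : PreFormula.Equiv (.prim p) (.prim q) := Quotient.exact h
  cases h'
  rfl

theorem prim_ne_times (p : Pr) (M : Hypergraph (Formula Pr)) : prim p ≠ times M := by
  intro h
  have h' : PreFormula.Equiv _ _ := Quotient.exact h
  cases h'

theorem prim_ne_div (p : Pr) (N : Formula Pr) (D : HoleGraph (Formula Pr))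
    (hD : Ranked.rk N = D.ext.length) : prim p ≠ div N D hD := by
  intro h
  have h' : PreFormula.Equiv _ _ := Quotient.exact h
  cases h'

theorem times_ne_div (M : Hypergraph (Formula Pr)) (N : Formula Pr) (D : HoleGraph (Formula Pr))
    (hD : Ranked.rk N = D.ext.length) : times M ≠ div N D hD := by
  intro h
  have h' : PreFormula.Equiv _ _ := Quotient.exact h
  cases h'

/-- Only chosen representatives of the labels are stored in `times M`. Equivalent representatives
come from equal labels, so the isomorphism obtained preserves labels exactly. -/
theorem iso_of_times_eq {M M' : Hypergraph (Formula Pr)} (h : times M = times M') : M.Iso M' := by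
  have h' : PreFormula.Equiv _ _ := Quotient.exact h
  cases h' with
  | times σ τ hatt hlab hext =>
    exact ⟨σ, τ, hatt, fun e => (eq_of_repr_equiv (hlab e)).symm, hext⟩

theorem times_eq_of_iso {M M' : Hypergraph (Formula Pr)} (h : M.Iso M') : times M = times M' := by
  obtain ⟨σ, τ, hatt, hlab, hext⟩ := h
  refine Quotient.sound (PreFormula.Equiv.times σ τ hatt (fun e => ?_) hext)
  rw [hlab]
  exact PreFormula.Equiv.refl _

theorem iso_of_div_eq {N N' : Formula Pr} {D D' : HoleGraph (Formula Pr)}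
    {hD : Ranked.rk N = D.ext.length} {hD' : Ranked.rk N' = D'.ext.length}
    (h : div N D hD = div N' D' hD') : N = N' ∧ D.Iso D' := by
  have h' : PreFormula.Equiv _ _ := Quotient.exact h
  cases h' with
  | div hN σ τ hatt hlab hhole hext =>
    exact ⟨eq_of_repr_equiv hN, σ, τ, hatt, fun e => (eq_of_repr_equiv (hlab e)).symm,
      hhole, hext⟩

end Formula

end HL

/-! ### The patterns of the translation, uniformly for commutative and noncommutative modes. -/

namespace ModeSystem

open HL

variable {Pr : Type u} [Ranked Pr] (S : ModeSystem Pr)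

/-- The shape of a mode hyperedge: `a` is the attachment string of a hyperedge labeled by the mode
`i` at the node `v`, whose two arguments are at the nodes `y` and `z`, and `N` collects the
attachment nodes other than `v`. -/
def Att {V : Type} (i : S.I) (v y z : V) (a : List V) (N : Multiset V) : Prop :=
  (i ∉ S.C ∧ a = [v, y, z] ∧ N = {y, z}) ∨ (i ∈ S.C ∧ a = [v, y] ∧ z = y ∧ N = {y})

/-- `Att` with the arguments in the order `left, right` or `right, left`. -/
def AttSide {V : Type} (r : Bool) (i : S.I) (v p q : V) (a : List V) (N : Multiset V) : Prop :=
  match r with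
  | true => S.Att i v p q a N
  | false => S.Att i v q p a N

/-- `B \_i A` or `A /_i B`. -/
def divFm (r : Bool) (i : S.I) (B A : S.Fm) : S.Fm :=
  match r with
  | true => .ldiv i B A
  | false => .rdiv i A B

/-- `(X, Y)^i` or `(Y, X)^i`. -/
def pairDb (r : Bool) (i : S.I) (X Y : S.Db) : S.Db :=
  match r with
  | true => .pair i X Y
  | false => .pair i Y X

/-- The hypergraph `M` is `R^i(A, B)` or `K^i(A, B)`, up to isomorphism. -/
def IsPat (M : HL.Hypergraph (Formula Pr)) (i : S.I) (A B : Formula Pr) : Prop :=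
  ∃ (v y z : M.V) (a : List M.V) (N : Multiset M.V) (τ : Fin 3 ≃ M.E),
    S.Att i v y z a N ∧ M.nodes = v ::ₘ N ∧ M.ext = [v] ∧
    (M.lab (τ 0) = .prim i ∧ M.att (τ 0) = a) ∧ (M.lab (τ 1) = A ∧ M.att (τ 1) = [y]) ∧
    (M.lab (τ 2) = B ∧ M.att (τ 2) = [z])

/-- The hypergraph `M` is `U^j(A)`, up to isomorphism. -/
def IsUPat (M : HL.Hypergraph (Formula Pr)) (j : S.J) (A : Formula Pr) : Prop :=
  ∃ (v y : M.V) (τ : Fin 2 ≃ M.E), M.nodes = {v, y} ∧ M.ext = [v] ∧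
    (M.lab (τ 0) = .prim j ∧ M.att (τ 0) = [v, y]) ∧ (M.lab (τ 1) = A ∧ M.att (τ 1) = [y])

/-- The hypergraph `D` is `R^i(B, $₁)`, `R^i($₁, B)` or `K^i(B, $₁)`, up to isomorphism. -/
def IsHole (r : Bool) (D : HoleGraph (Formula Pr)) (i : S.I) (B : Formula Pr) : Prop :=
  ∃ (v p q : D.V) (a : List D.V) (N : Multiset D.V) (τ : Fin 2 ≃ D.E),
    S.AttSide r i v p q a N ∧ D.nodes = v ::ₘ N ∧ D.ext = [v] ∧ D.hole = [q] ∧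
    (D.lab (τ 0) = .prim i ∧ D.att (τ 0) = a) ∧ (D.lab (τ 1) = B ∧ D.att (τ 1) = [p])

/-- The hypergraph `D` is `U^j($₁)`, up to isomorphism. -/
def IsUHole (D : HoleGraph (Formula Pr)) (j : S.J) : Prop :=
  ∃ (v y : D.V) (τ : Fin 1 ≃ D.E), D.nodes = {v, y} ∧ D.ext = [v] ∧ D.hole = [y] ∧
    (D.lab (τ 0) = .prim j ∧ D.att (τ 0) = [v, y])

variable {S}

theorem Att.map {V V' : Type} {i : S.I} {v y z : V} {a : List V} {N : Multiset V}
    (h : S.Att i v y z a N) (f : V → V') : S.Att i (f v) (f y) (f z) (a.map f) (N.map f) := by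
  rcases h with ⟨hi, rfl, rfl⟩ | ⟨hi, rfl, rfl, rfl⟩
  · exact .inl ⟨hi, by simp, by simp⟩
  · exact .inr ⟨hi, by simp, rfl, by simp⟩

theorem AttSide.map {V V' : Type} {r : Bool} {i : S.I} {v y z : V} {a : List V} {N : Multiset V}
    (h : S.AttSide r i v y z a N) (f : V → V') :
    S.AttSide r i (f v) (f y) (f z) (a.map f) (N.map f) := by
  cases r <;> exact Att.map h f

theorem map_nodes_equiv {V V' : Type} [Finite V] [Finite V'] (σ : V ≃ V') :
    msum (fun v : V' => {v}) = (msum (fun v : V => {v})).map σ := by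
  rw [← msum_singleton_map, ← msum_equiv σ]

theorem IsPat.iso {M M' : HL.Hypergraph (Formula Pr)} {i : S.I} {A B : Formula Pr}
    (h : S.IsPat M i A B) (hM : M.Iso M') : S.IsPat M' i A B := by
  obtain ⟨v, y, z, a, N, τ, hA, hV, he, h0, h1, h2⟩ := h
  obtain ⟨σ, τ', hatt, hlab, hext⟩ := hM
  refine ⟨σ v, σ y, σ z, a.map σ, N.map σ, τ.trans τ', hA.map σ, ?_, by simp [hext, he], ?_, ?_, ?_⟩
  · rw [Hypergraph.nodes, map_nodes_equiv σ]
    change M.nodes.map σ = _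
    simp [hV]
  all_goals simp [*]

theorem IsUPat.iso {M M' : HL.Hypergraph (Formula Pr)} {j : S.J} {A : Formula Pr}
    (h : S.IsUPat M j A) (hM : M.Iso M') : S.IsUPat M' j A := by
  obtain ⟨v, y, τ, hV, he, h0, h1⟩ := h
  obtain ⟨σ, τ', hatt, hlab, hext⟩ := hM
  refine ⟨σ v, σ y, τ.trans τ', ?_, by simp [hext, he], ?_, ?_⟩
  · rw [Hypergraph.nodes, map_nodes_equiv σ]
    change M.nodes.map σ = _
    simp [hV]
  all_goals simp [*]

theorem IsHole.iso {r : Bool} {D D' : HoleGraph (Formula Pr)} {i : S.I} {B : Formula Pr}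
    (h : S.IsHole r D i B) (hD : D.Iso D') : S.IsHole r D' i B := by
  obtain ⟨v, y, z, a, N, τ, hA, hV, he, hh, h0, h1⟩ := h
  obtain ⟨σ, τ', hatt, hlab, hhole, hext⟩ := hD
  refine ⟨σ v, σ y, σ z, a.map σ, N.map σ, τ.trans τ', hA.map σ, ?_, by simp [hext, he],
    by simp [hhole, hh], ?_, ?_⟩
  · rw [HoleGraph.nodes, map_nodes_equiv σ]
    change D.nodes.map σ = _
    simp [hV]
  all_goals simp [*]

theorem IsUHole.iso {D D' : HoleGraph (Formula Pr)} {j : S.J}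
    (h : S.IsUHole D j) (hD : D.Iso D') : S.IsUHole D' j := by
  obtain ⟨v, y, τ, hV, he, hh, h0⟩ := h
  obtain ⟨σ, τ', hatt, hlab, hhole, hext⟩ := hD
  refine ⟨σ v, σ y, τ.trans τ', ?_, by simp [hext, he], by simp [hhole, hh], ?_⟩
  · rw [HoleGraph.nodes, map_nodes_equiv σ]
    change D.nodes.map σ = _
    simp [hV]
  all_goals simp [*]

theorem msum_fin_one {β : Type*} (f : Fin 1 → Multiset β) : msum f = f 0 := by
  simp [msum_eq_sum]

theorem msum_fin_two {β : Type*} (f : Fin 2 → Multiset β) : msum f = f 0 + f 1 := by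
  simp [msum_eq_sum]

theorem msum_fin_three {β : Type*} (f : Fin 3 → Multiset β) : msum f = f 0 + f 1 + f 2 := by
  simp [msum_eq_sum, Fin.sum_univ_three]

theorem isPat_K {c : S.I} (hc : c ∈ S.C) {A B : Formula Pr} (h1 h2 h3) :
    S.IsPat (K (.prim c.1) A B h1 h2 h3) c A B :=
  ⟨(0 : Fin 2), (1 : Fin 2), (1 : Fin 2), _, _, Equiv.refl _, .inr ⟨hc, rfl, rfl, rfl⟩,
    msum_fin_two _, rfl, ⟨rfl, rfl⟩, ⟨rfl, rfl⟩, ⟨rfl, rfl⟩⟩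

theorem isPat_R {i : S.I} (hi : i ∉ S.C) {A B : Formula Pr} (h1 h2 h3) :
    S.IsPat (R (.prim i.1) A B h1 h2 h3) i A B :=
  ⟨(0 : Fin 3), (1 : Fin 3), (2 : Fin 3), _, _, Equiv.refl _, .inl ⟨hi, rfl, rfl⟩,
    (msum_fin_three _).trans (add_assoc _ _ _), rfl, ⟨rfl, rfl⟩, ⟨rfl, rfl⟩, ⟨rfl, rfl⟩⟩

theorem isUPat_U (j : S.J) {A : Formula Pr} (h1 h2) : S.IsUPat (U (.prim j.1) A h1 h2) j A :=
  ⟨(0 : Fin 2), (1 : Fin 2), Equiv.refl _, msum_fin_two _, rfl, ⟨rfl, rfl⟩, ⟨rfl, rfl⟩⟩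

theorem isHole_KHole (r : Bool) {c : S.I} (hc : c ∈ S.C) {B : Formula Pr} (h1 h2) :
    S.IsHole r (KHole (.prim c.1) B h1 h2) c B := by
  refine ⟨(0 : Fin 2), (1 : Fin 2), (1 : Fin 2), [(0 : Fin 2), (1 : Fin 2)], {(1 : Fin 2)},
    Equiv.refl _, ?_, msum_fin_two _, rfl, rfl, ⟨rfl, rfl⟩, ⟨rfl, rfl⟩⟩
  cases r <;> exact .inr ⟨hc, rfl, rfl, rfl⟩

theorem isHole_RHoleRight {i : S.I} (hi : i ∉ S.C) {B : Formula Pr} (h1 h2) :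
    S.IsHole true (RHoleRight (.prim i.1) B h1 h2) i B :=
  ⟨(0 : Fin 3), (1 : Fin 3), (2 : Fin 3), _, _, Equiv.refl _, .inl ⟨hi, rfl, rfl⟩,
    (msum_fin_three _).trans (add_assoc _ _ _), rfl, rfl, ⟨rfl, rfl⟩, ⟨rfl, rfl⟩⟩

theorem isHole_RHoleLeft {i : S.I} (hi : i ∉ S.C) {B : Formula Pr} (h1 h2) :
    S.IsHole false (RHoleLeft (.prim i.1) B h1 h2) i B :=
  ⟨(0 : Fin 3), (2 : Fin 3), (1 : Fin 3), _, _, Equiv.refl _, .inl ⟨hi, rfl, rfl⟩,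
    (msum_fin_three _).trans (add_assoc _ _ _), rfl, rfl, ⟨rfl, rfl⟩, ⟨rfl, rfl⟩⟩

theorem isUHole_UHole (j : S.J) (h1) : S.IsUHole (UHole (.prim j.1 : Formula Pr) h1) j :=
  ⟨(0 : Fin 2), (1 : Fin 2), Equiv.refl _, msum_fin_two _, rfl, rfl, ⟨rfl, rfl⟩⟩

theorem rk_mu (A : S.Fm) : Ranked.rk (S.mu A) = 1 := (S.muAux A).2

theorem mu_prim (p : {p : Pr // Ranked.rk p = 1}) : S.mu (.prim p) = .prim p.1 := by
  simp [mu, muAux]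

theorem exists_mu_prod (i : S.I) (A B : S.Fm) :
    ∃ M, S.mu (.prod i A B) = .times M ∧ S.IsPat M i (S.mu A) (S.mu B) := by
  by_cases h : i ∈ S.C
  · exact ⟨K (.prim i.1) (S.mu A) (S.mu B) (S.rk_comm i h) (rk_mu A) (rk_mu B),
      by simp only [mu, muAux, dif_pos h], isPat_K h _ _ _⟩
  · exact ⟨R (.prim i.1) (S.mu A) (S.mu B) (S.rk_mode i h) (rk_mu A) (rk_mu B),
      by simp only [mu, muAux, dif_neg h], isPat_R h _ _ _⟩

theorem exists_mu_dia (j : S.J) (A : S.Fm) :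
    ∃ M, S.mu (.dia j A) = .times M ∧ S.IsUPat M j (S.mu A) :=
  ⟨U (.prim j.1) (S.mu A) (S.rk_modality j) (rk_mu A), by simp only [mu, muAux], isUPat_U j _ _⟩

theorem exists_mu_divFm (r : Bool) (i : S.I) (B A : S.Fm) :
    ∃ D hD, S.mu (S.divFm r i B A) = .div (S.mu A) D hD ∧ S.IsHole r D i (S.mu B) := by
  by_cases h : i ∈ S.C
  · refine ⟨KHole (.prim i.1) (S.mu B) (S.rk_comm i h) (rk_mu B), rk_mu A, ?_,
      isHole_KHole r h _ _⟩
    cases r <;> simp only [divFm, mu, muAux, dif_pos h]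
  · cases r
    · exact ⟨RHoleLeft (.prim i.1) (S.mu B) (S.rk_mode i h) (rk_mu B), rk_mu A,
        by simp only [divFm, mu, muAux, dif_neg h], isHole_RHoleLeft h (S.rk_mode i h) (rk_mu B)⟩
    · exact ⟨RHoleRight (.prim i.1) (S.mu B) (S.rk_mode i h) (rk_mu B), rk_mu A,
        by simp only [divFm, mu, muAux, dif_neg h], isHole_RHoleRight h (S.rk_mode i h) (rk_mu B)⟩

theorem exists_mu_box (j : S.J) (A : S.Fm) :
    ∃ D hD, S.mu (.box j A) = .div (S.mu A) D hD ∧ S.IsUHole D j :=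
  ⟨UHole (.prim j.1) (S.rk_modality j), rk_mu A, by simp only [mu, muAux],
    isUHole_UHole j (S.rk_modality j)⟩

theorem mu_prod_congr {i : S.I} {A A' B B' : S.Fm} (hA : S.mu A = S.mu A')
    (hB : S.mu B = S.mu B') : S.mu (.prod i A B) = S.mu (.prod i A' B') := by
  have hA' := Subtype.ext (a1 := S.muAux A) (a2 := S.muAux A') hA
  have hB' := Subtype.ext (a1 := S.muAux B) (a2 := S.muAux B') hB
  simp only [mu, muAux, hA', hB']

/-- Both arguments of `K` hang on the same node, so exchanging their hyperedges is an isomorphism.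
-/
theorem mu_prod_swap {c : S.I} (hc : c ∈ S.C) (A B : S.Fm) :
    S.mu (.prod c A B) = S.mu (.prod c B A) := by
  simp only [mu, muAux, dif_pos hc]
  refine Formula.times_eq_of_iso ⟨Equiv.refl _, (Equiv.swap (1 : Fin 3) 2 : Fin 3 ≃ Fin 3), ?_, ?_, rfl⟩
  · intro e
    change Fin 3 at e
    fin_cases e <;> rfl
  · intro e
    change Fin 3 at e
    fin_cases e <;> rfl

theorem mu_divFm_congr {r : Bool} {i : S.I} {A A' B B' : S.Fm} (hA : S.mu A = S.mu A')
    (hB : S.mu B = S.mu B') : S.mu (S.divFm r i B A) = S.mu (S.divFm r i B' A') := by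
  have hA' := Subtype.ext (a1 := S.muAux A) (a2 := S.muAux A') hA
  have hB' := Subtype.ext (a1 := S.muAux B) (a2 := S.muAux B') hB
  cases r <;> simp only [divFm, mu, muAux, hA', hB']

theorem mu_dia_congr {j : S.J} {A A' : S.Fm} (hA : S.mu A = S.mu A') :
    S.mu (.dia j A) = S.mu (.dia j A') := by
  have hA' := Subtype.ext (a1 := S.muAux A) (a2 := S.muAux A') hA
  simp only [mu, muAux, hA']

theorem mu_box_congr {j : S.J} {A A' : S.Fm} (hA : S.mu A = S.mu A') :
    S.mu (.box j A) = S.mu (.box j A') := by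
  have hA' := Subtype.ext (a1 := S.muAux A) (a2 := S.muAux A') hA
  simp only [mu, muAux, hA']

theorem times_eq_mu {M : HL.Hypergraph (Formula Pr)} {F : S.Fm} (h : Formula.times M = S.mu F) :
    (∃ i A B, F = .prod i A B ∧ S.IsPat M i (S.mu A) (S.mu B)) ∨
      ∃ j A, F = .dia j A ∧ S.IsUPat M j (S.mu A) := by
  have hdiv : ∀ r i B A, F ≠ S.divFm r i B A := by
    rintro r i B A rfl
    obtain ⟨D, hD, h', -⟩ := exists_mu_divFm r i B A
    exact Formula.times_ne_div _ _ _ _ (h.trans h')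
  cases F with
  | prim p => exact absurd (h.trans (mu_prim p)).symm (Formula.prim_ne_times _ _)
  | prod i A B =>
    obtain ⟨M', h', hM'⟩ := exists_mu_prod i A B
    exact .inl ⟨i, A, B, rfl, hM'.iso (Formula.iso_of_times_eq (h.trans h')).symm⟩
  | ldiv i B A => exact absurd rfl (hdiv true i B A)
  | rdiv i A B => exact absurd rfl (hdiv false i B A)
  | dia j A =>
    obtain ⟨M', h', hM'⟩ := exists_mu_dia j A
    exact .inr ⟨j, A, rfl, hM'.iso (Formula.iso_of_times_eq (h.trans h')).symm⟩
  | box j A =>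
    obtain ⟨D, hD, h', -⟩ := exists_mu_box j A
    exact absurd (h.trans h') (Formula.times_ne_div _ _ _ _)

theorem holeIso_symm {D D' : HoleGraph (Formula Pr)} : D.Iso D' → D'.Iso D := by
  rintro ⟨σ, τ, hatt, hlab, hhole, hext⟩
  refine ⟨σ.symm, τ.symm, fun e => ?_, fun e => ?_, by simp [hhole], by simp [hext]⟩
  · have := hatt (τ.symm e)
    simp_all
  · have := hlab (τ.symm e)
    simp_all

theorem div_eq_mu {N : Formula Pr} {D : HoleGraph (Formula Pr)} {hD : Ranked.rk N = D.ext.length}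
    {F : S.Fm} (h : Formula.div N D hD = S.mu F) :
    (∃ r i B A, F = S.divFm r i B A ∧ N = S.mu A ∧ S.IsHole r D i (S.mu B)) ∨
      ∃ j A, F = .box j A ∧ N = S.mu A ∧ S.IsUHole D j := by
  have hdiv : ∀ r i B A, F = S.divFm r i B A → N = S.mu A ∧ S.IsHole r D i (S.mu B) := by
    rintro r i B A rfl
    obtain ⟨D, hD, h', hD'⟩ := exists_mu_divFm r i B A
    obtain ⟨h1, h2⟩ := Formula.iso_of_div_eq (h.trans h')
    exact ⟨h1, hD'.iso (holeIso_symm h2)⟩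
  cases F with
  | prim p => exact absurd (h.trans (mu_prim p)).symm (Formula.prim_ne_div _ _ _ _)
  | prod i A B =>
    obtain ⟨M', h', hM'⟩ := exists_mu_prod i A B
    exact absurd (h.trans h').symm (Formula.times_ne_div _ _ _ _)
  | ldiv i B A => exact .inl ⟨true, i, B, A, rfl, hdiv true i B A rfl⟩
  | rdiv i A B => exact .inl ⟨false, i, B, A, rfl, hdiv false i B A rfl⟩
  | dia j A =>
    obtain ⟨M', h', hM'⟩ := exists_mu_dia j A
    exact absurd (h.trans h').symm (Formula.times_ne_div _ _ _ _)
  | box j A =>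
    obtain ⟨D', hD', h', hU⟩ := exists_mu_box j A
    obtain ⟨h1, h2⟩ := Formula.iso_of_div_eq (h.trans h')
    exact .inr ⟨j, A, rfl, h1, hU.iso (holeIso_symm h2)⟩

theorem rk_mode_ne_one (i : S.I) : Ranked.rk i.1 ≠ 1 := by
  by_cases h : i ∈ S.C
  · simp [S.rk_comm i h]
  · simp [S.rk_mode i h]

/-- The ranks differ. This is what tells a structural hyperedge of a tree from a leaf. -/
theorem prim_mode_ne_mu (i : S.I) (A : S.Fm) : Formula.prim i.1 ≠ S.mu A := fun h =>
  rk_mode_ne_one i ((congrArg Ranked.rk h).trans (rk_mu A))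

theorem prim_modality_ne_mu (j : S.J) (A : S.Fm) : Formula.prim j.1 ≠ S.mu A := fun h => by
  have := (S.rk_modality j).symm.trans ((congrArg Ranked.rk h).trans (rk_mu A))
  omega

theorem prim_mode_ne_modality (i : S.I) (j : S.J) :
    (Formula.prim i.1 : Formula Pr) ≠ .prim j.1 := fun h =>
  Set.disjoint_left.1 S.disj i.2 (Formula.prim_injective h ▸ j.2)

theorem prim_mode_injective {i i' : S.I} (h : (Formula.prim i.1 : Formula Pr) = .prim i'.1) :
    i = i' := Subtype.ext (Formula.prim_injective h)

theorem prim_modality_injective {j j' : S.J} (h : (Formula.prim j.1 : Formula Pr) = .prim j'.1) :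
    j = j' := Subtype.ext (Formula.prim_injective h)

/-- Whether `i` is commutative is a property of `i` alone, so both shapes are of the same kind, and
all nodes can be read off the attachment string. -/
theorem Att.inj {V : Type} {i : S.I} {v y z v' y' z' : V} {a : List V} {N N' : Multiset V}
    (h : S.Att i v y z a N) (h' : S.Att i v' y' z' a N') :
    v = v' ∧ y = y' ∧ z = z' ∧ N = N' := by
  rcases h with ⟨hi, rfl, rfl⟩ | ⟨hi, rfl, rfl, rfl⟩ <;>
    rcases h' with ⟨hi', h1, rfl⟩ | ⟨hi', h1, rfl, rfl⟩ <;> simp_all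

end ModeSystem

/-! ### Which formulas have the same translation. -/

namespace ModeSystem

open HL

variable {Pr : Type u} [Ranked Pr] {S : ModeSystem Pr}

/-- Two descriptions of the same pattern differ by a permutation of its three hyperedges. The mode
hyperedge is fixed because its label is not a translation. The argument hyperedges can be exchanged
only if they are attached to the same node, which happens only for commutative modes. -/
theorem IsPat.unique {M : HL.Hypergraph (Formula Pr)} {i i' : S.I} {A B A' B' : S.Fm}
    (h : S.IsPat M i (S.mu A) (S.mu B)) (h' : S.IsPat M i' (S.mu A') (S.mu B')) :
    i' = i ∧ ((S.mu A' = S.mu A ∧ S.mu B' = S.mu B) ∨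
      (i ∈ S.C ∧ S.mu A' = S.mu B ∧ S.mu B' = S.mu A)) := by
  obtain ⟨v, y, z, a, N, τ, hA, hV, he, ⟨l0, a0⟩, ⟨l1, a1⟩, ⟨l2, a2⟩⟩ := h
  obtain ⟨v', y', z', a', N', τ', hA', hV', he', ⟨l0', a0'⟩, ⟨l1', a1'⟩, ⟨l2', a2'⟩⟩ := h'
  obtain ⟨π, hπ⟩ : ∃ π : Fin 3 ≃ Fin 3, ∀ k, τ' k = τ (π k) :=
    ⟨τ'.trans τ.symm, fun k => by simp⟩
  have hπ01 : π 0 ≠ π 1 := π.injective.ne (by decide)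
  have hπ02 : π 0 ≠ π 2 := π.injective.ne (by decide)
  have hπ12 : π 1 ≠ π 2 := π.injective.ne (by decide)
  simp only [hπ] at l0' a0' l1' a1' l2' a2'
  generalize π 0 = k0 at *
  generalize π 1 = k1 at *
  generalize π 2 = k2 at *
  have h0 : k0 = 0 := by
    fin_cases k0
    · rfl
    · exact absurd (l0'.symm.trans l1) (prim_mode_ne_mu _ _)
    · exact absurd (l0'.symm.trans l2) (prim_mode_ne_mu _ _)
  subst h0
  obtain rfl := prim_mode_injective (l0'.symm.trans l0)
  obtain rfl := a0'.symm.trans a0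
  obtain ⟨rfl, rfl, rfl, rfl⟩ := hA.inj hA'
  refine ⟨rfl, ?_⟩
  -- For a noncommutative mode the nodes are `v`, `y`, `z`, listed without repetition.
  have hyz : i' ∈ S.C ∨ z ≠ y := by
    rcases hA with ⟨-, rfl, rfl⟩ | ⟨hi, -⟩
    · right
      rintro rfl
      have := M.nodup_nodes
      simp [hV] at this
    · exact .inl hi
  fin_cases k1
  · simp at hπ01
  · fin_cases k2
    · simp at hπ02
    · simp at hπ12
    · exact .inl ⟨l1'.symm.trans l1, l2'.symm.trans l2⟩
  · fin_cases k2
    · simp at hπ02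
    · refine .inr ⟨hyz.resolve_right fun hne => hne ?_, l1'.symm.trans l2, l2'.symm.trans l1⟩
      simpa using a2.symm.trans a1'
    · simp at hπ12

theorem IsUPat.unique {M : HL.Hypergraph (Formula Pr)} {j j' : S.J} {A A' : S.Fm}
    (h : S.IsUPat M j (S.mu A)) (h' : S.IsUPat M j' (S.mu A')) :
    j' = j ∧ S.mu A' = S.mu A := by
  obtain ⟨v, y, τ, hV, he, ⟨l0, a0⟩, ⟨l1, a1⟩⟩ := h
  obtain ⟨v', y', τ', hV', he', ⟨l0', a0'⟩, ⟨l1', a1'⟩⟩ := h'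
  obtain ⟨π, hπ⟩ : ∃ π : Fin 2 ≃ Fin 2, ∀ k, τ' k = τ (π k) :=
    ⟨τ'.trans τ.symm, fun k => by simp⟩
  have hπ01 : π 0 ≠ π 1 := π.injective.ne (by decide)
  simp only [hπ] at l0' a0' l1' a1'
  generalize π 0 = k0 at *
  generalize π 1 = k1 at *
  have h0 : k0 = 0 := by
    fin_cases k0
    · rfl
    · exact absurd (l0'.symm.trans l1) (prim_modality_ne_mu _ _)
  subst h0
  refine ⟨prim_modality_injective (l0'.symm.trans l0), ?_⟩
  fin_cases k1
  · simp at hπ01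
  · exact l1'.symm.trans l1

theorem IsPat.not_isUPat {M : HL.Hypergraph (Formula Pr)} {i : S.I} {j : S.J}
    {A B A' : Formula Pr} (h : S.IsPat M i A B) (h' : S.IsUPat M j A') : False := by
  obtain ⟨v, y, z, a, N, τ, -⟩ := h
  obtain ⟨v', y', τ', -⟩ := h'
  have := Fintype.card_congr (τ.trans τ'.symm)
  simp at this

/-- The mode hyperedge is again recognized by its label, and then the only other hyperedge is the
argument. Reading the same attachment string with the hole on two different sides makes the argument
node and the hole node coincide, which a noncommutative pattern forbids. -/
theorem IsHole.unique {D : HoleGraph (Formula Pr)} {r r' : Bool} {i i' : S.I} {B B' : S.Fm}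
    (h : S.IsHole r D i (S.mu B)) (h' : S.IsHole r' D i' (S.mu B')) :
    i' = i ∧ S.mu B' = S.mu B ∧ (r' = r ∨ i ∈ S.C) := by
  obtain ⟨v, p, q, a, N, τ, hA, hV, he, hh, ⟨l0, a0⟩, ⟨l1, a1⟩⟩ := h
  obtain ⟨v', p', q', a', N', τ', hA', hV', he', hh', ⟨l0', a0'⟩, ⟨l1', a1'⟩⟩ := h'
  obtain ⟨π, hπ⟩ : ∃ π : Fin 2 ≃ Fin 2, ∀ k, τ' k = τ (π k) :=
    ⟨τ'.trans τ.symm, fun k => by simp⟩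
  have hπ01 : π 0 ≠ π 1 := π.injective.ne (by decide)
  simp only [hπ] at l0' a0' l1' a1'
  generalize π 0 = k0 at *
  generalize π 1 = k1 at *
  have h0 : k0 = 0 := by
    fin_cases k0
    · rfl
    · exact absurd (l0'.symm.trans l1) (prim_mode_ne_mu _ _)
  have h1 : k1 = 1 := by
    fin_cases k1
    · exact absurd h0 hπ01
    · rfl
  subst h0 h1
  obtain rfl := prim_mode_injective (l0'.symm.trans l0)
  obtain rfl := a0'.symm.trans a0
  refine ⟨rfl, l1'.symm.trans l1, ?_⟩
  have hpp : p = p' := by simpa using a1.symm.trans a1'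
  have hqq : q = q' := by simpa using hh.symm.trans hh'
  subst hpp hqq
  rw [or_iff_not_imp_right]
  intro hi
  by_contra hr
  have hpq : p = q := by
    cases r <;> cases r'
    · exact absurd rfl hr
    · exact (Att.inj hA hA').2.2.1
    · exact (Att.inj hA hA').2.1
    · exact absurd rfl hr
  subst hpq
  have hnd := nodup_msum_singleton (α := D.V)
  change D.nodes.Nodup at hnd
  have hN : N = {p, p} := by
    cases r
    · rcases hA with ⟨-, -, h⟩ | ⟨h, -⟩
      exacts [h, absurd h hi]
    · rcases hA with ⟨-, -, h⟩ | ⟨h, -⟩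
      exacts [h, absurd h hi]
  rw [hV, hN] at hnd
  simp at hnd

theorem IsUHole.unique {D : HoleGraph (Formula Pr)} {j j' : S.J}
    (h : S.IsUHole D j) (h' : S.IsUHole D j') : j' = j := by
  obtain ⟨v, y, τ, hV, he, hh, ⟨l0, a0⟩⟩ := h
  obtain ⟨v', y', τ', hV', he', hh', ⟨l0', a0'⟩⟩ := h'
  obtain ⟨π, hπ⟩ : ∃ π : Fin 1 ≃ Fin 1, ∀ k, τ' k = τ (π k) :=
    ⟨τ'.trans τ.symm, fun k => by simp⟩
  rw [hπ, Subsingleton.elim (π 0) 0] at l0'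
  exact prim_modality_injective (l0'.symm.trans l0)

theorem IsHole.not_isUHole {D : HoleGraph (Formula Pr)} {r : Bool} {i : S.I} {j : S.J}
    {B : Formula Pr} (h : S.IsHole r D i B) (h' : S.IsUHole D j) : False := by
  obtain ⟨v, p, q, a, N, τ, -⟩ := h
  obtain ⟨v', y', τ', -⟩ := h'
  have := Fintype.card_congr (τ.trans τ'.symm)
  simp at this

theorem mu_eq_prod {F : S.Fm} {i : S.I} {A B : S.Fm} (h : S.mu F = S.mu (.prod i A B)) :
    ∃ A' B', F = .prod i A' B' ∧ ((S.mu A' = S.mu A ∧ S.mu B' = S.mu B) ∨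
      (i ∈ S.C ∧ S.mu A' = S.mu B ∧ S.mu B' = S.mu A)) := by
  obtain ⟨M, hM, hP⟩ := exists_mu_prod i A B
  rcases times_eq_mu (hM.symm.trans h.symm) with ⟨i', A', B', rfl, hP'⟩ | ⟨j, A', rfl, hP'⟩
  · obtain ⟨rfl, h2⟩ := hP.unique hP'
    exact ⟨A', B', rfl, h2⟩
  · exact (hP.not_isUPat hP').elim

theorem mu_eq_dia {F : S.Fm} {j : S.J} {A : S.Fm} (h : S.mu F = S.mu (.dia j A)) :
    ∃ A', F = .dia j A' ∧ S.mu A' = S.mu A := by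
  obtain ⟨M, hM, hP⟩ := exists_mu_dia j A
  rcases times_eq_mu (hM.symm.trans h.symm) with ⟨i', A', B', rfl, hP'⟩ | ⟨j, A', rfl, hP'⟩
  · exact (hP'.not_isUPat hP).elim
  · obtain ⟨rfl, h2⟩ := hP.unique hP'
    exact ⟨A', rfl, h2⟩

theorem mu_eq_divFm {F : S.Fm} {r : Bool} {i : S.I} {A B : S.Fm}
    (h : S.mu F = S.mu (S.divFm r i B A)) :
    ∃ r' B' A', F = S.divFm r' i B' A' ∧ S.mu B' = S.mu B ∧ S.mu A' = S.mu A ∧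
      (r' = r ∨ i ∈ S.C) := by
  obtain ⟨D, hD, hM, hP⟩ := exists_mu_divFm r i B A
  rcases div_eq_mu (hM.symm.trans h.symm) with ⟨r', i', B', A', rfl, hN, hP'⟩ | ⟨j, A', rfl, hN, hP'⟩
  · obtain ⟨rfl, h2, h3⟩ := hP.unique hP'
    exact ⟨r', B', A', rfl, h2, hN.symm, h3⟩
  · exact (hP.not_isUHole hP').elim

theorem mu_eq_box {F : S.Fm} {j : S.J} {A : S.Fm} (h : S.mu F = S.mu (.box j A)) :
    ∃ A', F = .box j A' ∧ S.mu A' = S.mu A := by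
  obtain ⟨D, hD, hM, hP⟩ := exists_mu_box j A
  rcases div_eq_mu (hM.symm.trans h.symm) with ⟨r', i', B', A', rfl, hN, hP'⟩ | ⟨j, A', rfl, hN, hP'⟩
  · exact (hP'.not_isUHole hP).elim
  · obtain rfl := hP.unique hP'
    exact ⟨A', rfl, hN.symm⟩

theorem mu_eq_prim {F : S.Fm} {p : {p : Pr // Ranked.rk p = 1}} (h : S.mu F = S.mu (.prim p)) :
    F = .prim p := by
  have h1 : ∀ M, Formula.times M ≠ S.mu F := fun M hM =>
    Formula.prim_ne_times p.1 M ((mu_prim p).symm.trans (h.symm.trans hM.symm))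
  have h2 : ∀ N D hD, Formula.div N D hD ≠ S.mu F := fun N D hD hM =>
    Formula.prim_ne_div p.1 N D hD ((mu_prim p).symm.trans (h.symm.trans hM.symm))
  cases F with
  | prim q =>
    rw [mu_prim, mu_prim] at h
    rw [Subtype.ext (Formula.prim_injective h)]
  | prod i A B =>
    obtain ⟨M, hM, -⟩ := exists_mu_prod i A B
    exact absurd hM.symm (h1 M)
  | ldiv i B A =>
    obtain ⟨D, hD, hM, -⟩ := exists_mu_divFm true i B A
    exact absurd hM.symm (h2 _ _ _)
  | rdiv i A B =>
    obtain ⟨D, hD, hM, -⟩ := exists_mu_divFm false i B A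
    exact absurd hM.symm (h2 _ _ _)
  | dia j A =>
    obtain ⟨M, hM, -⟩ := exists_mu_dia j A
    exact absurd hM.symm (h1 M)
  | box j A =>
    obtain ⟨D, hD, hM, -⟩ := exists_mu_box j A
    exact absurd hM.symm (h2 _ _ _)

/-! ### Invariance of derivability under identifications made by the translation -/

variable (S) in
/-- Derivability in the multimodal calculus without associative modes. -/
abbrev Der (X : S.Db) (T : S.Fm) : Prop := NLM.Derivable S.C ∅ X T

variable (S) in
/-- Databases that are equal up to replacing formulas by formulas with the same translation and
swapping arguments of commutative modes. -/
inductive DbEq : S.Db → S.Db → Prop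
  | form {A A' : S.Fm} : S.mu A = S.mu A' → DbEq (.form A) (.form A')
  | pair {i : S.I} {X Y X' Y' : S.Db} : DbEq X X' → DbEq Y Y' →
      DbEq (.pair i X Y) (.pair i X' Y')
  | swap {c : S.I} {X Y X' Y' : S.Db} : c ∈ S.C → DbEq X Y' → DbEq Y X' →
      DbEq (.pair c X Y) (.pair c X' Y')
  | bracket {j : S.J} {X X' : S.Db} : DbEq X X' → DbEq (.bracket j X) (.bracket j X')

theorem DbEq.pairDb {r r' : Bool} {i : S.I} {X Y X' Y' : S.Db} (hX : S.DbEq X X')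
    (hY : S.DbEq Y Y') (hr : r' = r ∨ i ∈ S.C) :
    S.DbEq (S.pairDb r i X Y) (S.pairDb r' i X' Y') := by
  rcases hr with rfl | hc
  · cases r'
    · exact .pair hY hX
    · exact .pair hX hY
  · cases r <;> cases r'
    · exact .pair hY hX
    · exact .swap hc hY hX
    · exact .swap hc hX hY
    · exact .pair hX hY

theorem DbEq.of_pairDb {r : Bool} {i : S.I} {X Y Z : S.Db} (h : S.DbEq (S.pairDb r i X Y) Z) :
    ∃ r' X' Y', Z = S.pairDb r' i X' Y' ∧ S.DbEq X X' ∧ S.DbEq Y Y' ∧ (r' = r ∨ i ∈ S.C) := by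
  cases r
  · cases h with
    | pair hX hY => exact ⟨false, _, _, rfl, hY, hX, .inl rfl⟩
    | swap hc hX hY => exact ⟨true, _, _, rfl, hY, hX, .inr hc⟩
  · cases h with
    | pair hX hY => exact ⟨true, _, _, rfl, hX, hY, .inl rfl⟩
    | swap hc hX hY => exact ⟨false, _, _, rfl, hX, hY, .inr hc⟩

/-- The distinguished place survives, but swaps may move it to the other side of a pair, so the
context changes too. The last clause allows the content of the place to be exchanged, as the left
rules do. -/
theorem DbEq.of_plug {Δ : NLM.Ctx {p : Pr // Ranked.rk p = 1} S.I S.J} {Y X' : S.Db}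
    (h : S.DbEq (Δ.plug Y) X') : ∃ (Δ' : NLM.Ctx {p : Pr // Ranked.rk p = 1} S.I S.J) (Y' : S.Db),
      X' = Δ'.plug Y' ∧ S.DbEq Y Y' ∧ ∀ Z Z', S.DbEq Z Z' → S.DbEq (Δ.plug Z) (Δ'.plug Z') := by
  induction Δ generalizing X' with
  | hole => exact ⟨.hole, X', rfl, h, fun Z Z' hZ => hZ⟩
  | pairLeft i Δ W ih =>
    cases h with
    | pair hX hY =>
      obtain ⟨Δ', Y', rfl, h1, h2⟩ := ih hX
      exact ⟨.pairLeft i Δ' _, Y', rfl, h1, fun Z Z' hZ => .pair (h2 Z Z' hZ) hY⟩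
    | swap hc hX hY =>
      obtain ⟨Δ', Y', rfl, h1, h2⟩ := ih hX
      exact ⟨.pairRight i _ Δ', Y', rfl, h1, fun Z Z' hZ => .swap hc (h2 Z Z' hZ) hY⟩
  | pairRight i W Δ ih =>
    cases h with
    | pair hX hY =>
      obtain ⟨Δ', Y', rfl, h1, h2⟩ := ih hY
      exact ⟨.pairRight i _ Δ', Y', rfl, h1, fun Z Z' hZ => .pair hX (h2 Z Z' hZ)⟩
    | swap hc hX hY =>
      obtain ⟨Δ', Y', rfl, h1, h2⟩ := ih hY
      exact ⟨.pairLeft i Δ' _, Y', rfl, h1, fun Z Z' hZ => .swap hc hX (h2 Z Z' hZ)⟩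
  | bracket j Δ ih =>
    cases h with
    | bracket hX =>
      obtain ⟨Δ', Y', rfl, h1, h2⟩ := ih hX
      exact ⟨.bracket j Δ', Y', rfl, h1, fun Z Z' hZ => .bracket (h2 Z Z' hZ)⟩

namespace Der

open NLM

variable {Δ : NLM.Ctx {p : Pr // Ranked.rk p = 1} S.I S.J}

theorem divL {r : Bool} {i : S.I} {X : S.Db} {A B U : S.Fm} (h : S.Der (Δ.plug (.form A)) U)
    (h' : S.Der X B) : S.Der (Δ.plug (S.pairDb r i X (.form (S.divFm r i B A)))) U := by
  cases r
  · exact .rdivL Δ i X A B U h h'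
  · exact .ldivL Δ i X A B U h h'

theorem divR {r : Bool} {i : S.I} {X : S.Db} {A B : S.Fm}
    (h : S.Der (S.pairDb r i (.form B) X) A) : S.Der X (S.divFm r i B A) := by
  cases r
  · exact .rdivR i X A B h
  · exact .ldivR i X A B h

theorem comm {r r' : Bool} {i : S.I} {X Y : S.Db} {U : S.Fm} (hr : r' = r ∨ i ∈ S.C)
    (h : S.Der (Δ.plug (S.pairDb r i X Y)) U) : S.Der (Δ.plug (S.pairDb r' i X Y)) U := by
  rcases hr with rfl | hc
  · exact h
  · cases r <;> cases r'
    · exact h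
    · exact .perm Δ i Y X U hc h
    · exact .perm Δ i X Y U hc h
    · exact h

theorem divFm_mono {r r' : Bool} {i : S.I} {A A' B B' : S.Fm} (hA : S.Der (.form A) A')
    (hB : S.Der (.form B') B) (hr : r' = r ∨ i ∈ S.C) :
    S.Der (.form (S.divFm r i B A)) (S.divFm r' i B' A') :=
  divR (comm (Δ := .hole) hr (divL (Δ := .hole) hA hB))

theorem prod_mono {i : S.I} {A A' B B' : S.Fm} (hA : S.Der (.form A) A')
    (hB : S.Der (.form B) B') : S.Der (.form (.prod i A B)) (.prod i A' B') :=
  .prodL .hole i A B _ (.prodR i _ _ _ _ hA hB)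

theorem prod_swap {c : S.I} (hc : c ∈ S.C) {A A' B B' : S.Fm} (hA : S.Der (.form A) B')
    (hB : S.Der (.form B) A') : S.Der (.form (.prod c A B)) (.prod c A' B') :=
  .prodL .hole c A B _ (.perm .hole c _ _ _ hc (.prodR c _ _ _ _ hB hA))

theorem of_mu_eq_divFm {r : Bool} {i : S.I} {A B F : S.Fm}
    (hA : ∀ A', S.mu A' = S.mu A → S.Der (.form A) A' ∧ S.Der (.form A') A)
    (hB : ∀ B', S.mu B' = S.mu B → S.Der (.form B) B' ∧ S.Der (.form B') B)
    (h : S.mu F = S.mu (S.divFm r i B A)) :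
    S.Der (.form (S.divFm r i B A)) F ∧ S.Der (.form F) (S.divFm r i B A) := by
  obtain ⟨r', B', A', rfl, h1, h2, h3⟩ := mu_eq_divFm h
  exact ⟨divFm_mono (hA A' h2).1 (hB B' h1).2 h3,
    divFm_mono (hA A' h2).2 (hB B' h1).1 (h3.imp_left Eq.symm)⟩

/-- Both directions are proved together because division is contravariant in its denominator. Each
case applies the right and left rule of the main connective to the constituents, with a permutation
where the translation has forgotten an order or a direction. -/
theorem of_mu_eq (A : S.Fm) :
    ∀ F, S.mu F = S.mu A → S.Der (.form A) F ∧ S.Der (.form F) A := by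
  induction A with
  | prim p =>
    intro F h
    obtain rfl := mu_eq_prim h
    exact ⟨.ax _, .ax _⟩
  | prod i A B hA hB =>
    intro F h
    obtain ⟨A', B', rfl, ⟨h1, h2⟩ | ⟨hc, h1, h2⟩⟩ := mu_eq_prod h
    · exact ⟨prod_mono (hA _ h1).1 (hB _ h2).1, prod_mono (hA _ h1).2 (hB _ h2).2⟩
    · exact ⟨prod_swap hc (hA _ h2).1 (hB _ h1).1, prod_swap hc (hB _ h1).2 (hA _ h2).2⟩
  | ldiv i B A hB hA => exact fun F h => of_mu_eq_divFm (r := true) hA hB h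
  | rdiv i A B hA hB => exact fun F h => of_mu_eq_divFm (r := false) hA hB h
  | dia j A hA =>
    intro F h
    obtain ⟨A', rfl, h1⟩ := mu_eq_dia h
    exact ⟨.diaL .hole j _ _ (.diaR j _ _ (hA _ h1).1), .diaL .hole j _ _ (.diaR j _ _ (hA _ h1).2)⟩
  | box j A hA =>
    intro F h
    obtain ⟨A', rfl, h1⟩ := mu_eq_box h
    exact ⟨.boxR j _ _ (.boxL .hole j _ _ (hA _ h1).1), .boxR j _ _ (.boxL .hole j _ _ (hA _ h1).2)⟩

/-- Two independent changes of side occur: the swap of the pair and the change of direction of the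
division. If they disagree, the mode is commutative and a permutation repairs it. -/
theorem congr_divL {r : Bool} {i : S.I} {X X' : S.Db} {A B U U' : S.Fm}
    (ih : ∀ X' U', S.DbEq (Δ.plug (.form A)) X' → S.mu U' = S.mu U → S.Der X' U')
    (ih' : ∀ X' U', S.DbEq X X' → S.mu U' = S.mu B → S.Der X' U')
    (hX : S.DbEq (Δ.plug (S.pairDb r i X (.form (S.divFm r i B A)))) X')
    (hU : S.mu U' = S.mu U) : S.Der X' U' := by
  obtain ⟨Δ', Z, rfl, h1, h2⟩ := hX.of_plug
  obtain ⟨r', X1, _, rfl, h3, h4, h5⟩ := h1.of_pairDb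
  cases h4 with
  | form h4 =>
    obtain ⟨r'', B', A', rfl, h6, h7, h8⟩ := mu_eq_divFm h4.symm
    refine comm (r := r'') ?_ (divL (ih _ _ (h2 _ _ (.form h7.symm)) hU) (ih' _ _ h3 h6))
    rcases h5 with rfl | h5
    · exact h8.imp_left Eq.symm
    · exact .inr h5

theorem congr_divR {r : Bool} {i : S.I} {X X' : S.Db} {A B U' : S.Fm}
    (ih : ∀ X' U', S.DbEq (S.pairDb r i (.form B) X) X' → S.mu U' = S.mu A → S.Der X' U')
    (hX : S.DbEq X X') (hU : S.mu U' = S.mu (S.divFm r i B A)) : S.Der X' U' := by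
  obtain ⟨r', B', A', rfl, h1, h2, h3⟩ := mu_eq_divFm hU
  exact divR (ih _ _ (DbEq.pairDb (.form h1.symm) hX h3) h2)

/-- Derivability is invariant under the identifications made by the translation. -/
theorem congr {X X' : S.Db} {U U' : S.Fm} (h : S.Der X U) (hX : S.DbEq X X')
    (hU : S.mu U' = S.mu U) : S.Der X' U' := by
  induction h generalizing X' U' with
  | ax T =>
    cases hX with
    | form hA =>
      rename_i A'
      -- Interderivability of formulas is used only at axioms. Every logical rule is applied anew to
      -- modified premises, so no cut is needed.
      exact (of_mu_eq A' U' (hU.trans hA)).1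
  | prodL Δ i A B U _ ih =>
    obtain ⟨Δ', Z, rfl, h1, h2⟩ := hX.of_plug
    cases h1 with
    | form h1 =>
      obtain ⟨A', B', rfl, h3⟩ := mu_eq_prod h1.symm
      refine .prodL Δ' i A' B' _ (ih (h2 _ _ ?_) hU)
      rcases h3 with ⟨h3, h4⟩ | ⟨hc, h3, h4⟩
      · exact .pair (.form h3.symm) (.form h4.symm)
      · exact .swap hc (.form h4.symm) (.form h3.symm)
  | prodR i X Y A B _ _ ihX ihY =>
    obtain ⟨r', X1, Y1, rfl, h1, h2, h3⟩ := DbEq.of_pairDb (r := true) hX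
    obtain ⟨A', B', rfl, ⟨h4, h5⟩ | ⟨hc, h4, h5⟩⟩ := mu_eq_prod hU
    · exact comm (Δ := .hole) (r := true) h3 (.prodR i _ _ _ _ (ihX h1 h4) (ihY h2 h5))
    · exact comm (Δ := .hole) (r := false) (.inr hc) (.prodR i _ _ _ _ (ihY h2 h4) (ihX h1 h5))
  | ldivL Δ i X A B U _ _ ih ih' =>
    exact congr_divL (r := true) (fun _ _ => ih) (fun _ _ => ih') hX hU
  | rdivL Δ i X A B U _ _ ih ih' =>
    exact congr_divL (r := false) (fun _ _ => ih) (fun _ _ => ih') hX hU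
  | ldivR i X A B _ ih => exact congr_divR (r := true) (fun _ _ => ih) hX hU
  | rdivR i X A B _ ih => exact congr_divR (r := false) (fun _ _ => ih) hX hU
  | diaL Δ j A U _ ih =>
    obtain ⟨Δ', Z, rfl, h1, h2⟩ := hX.of_plug
    cases h1 with
    | form h1 =>
      obtain ⟨A', rfl, h3⟩ := mu_eq_dia h1.symm
      exact .diaL Δ' j A' _ (ih (h2 _ _ (.bracket (.form h3.symm))) hU)
  | diaR j X A _ ih =>
    cases hX with
    | bracket hX =>
      obtain ⟨A', rfl, h3⟩ := mu_eq_dia hU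
      exact .diaR j _ _ (ih hX h3)
  | boxL Δ j A U _ ih =>
    obtain ⟨Δ', Z, rfl, h1, h2⟩ := hX.of_plug
    cases h1 with
    | bracket h1 =>
      cases h1 with
      | form h1 =>
        obtain ⟨A', rfl, h3⟩ := mu_eq_box h1.symm
        exact .boxL Δ' j A' _ (ih (h2 _ _ (.form h3.symm)) hU)
  | boxR j X A _ ih =>
    obtain ⟨A', rfl, h3⟩ := mu_eq_box hU
    exact .boxR j _ _ (ih (.bracket hX) h3)
  | perm Δ c X Y U hc _ ih =>
    obtain ⟨Δ', Z, rfl, h1, h2⟩ := hX.of_plug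
    obtain ⟨r', Y1, X1, rfl, h3, h4, h5⟩ := DbEq.of_pairDb (r := true) h1
    -- The premise of the permutation is already related to `X'` itself: the rule is absorbed by the
    -- relation `DbEq`.
    exact ih (h2 _ _ (DbEq.pairDb (r := false) h3 h4 (.inr hc))) hU
  | assocL Δ a X Y Z U ha => exact ha.elim
  | assocR Δ a X Y Z U ha => exact ha.elim

end Der

end ModeSystem

/-! ### Trees: the shape of the hypergraph of a database. -/

namespace ModeSystem

open HL HL.Hypergraph

variable {Pr : Type u} [Ranked Pr] {S : ModeSystem Pr}

variable (S) in
/-- `Tree v E W X`: the hyperedges in `E` form a copy of `htree X` with root `v`, where `W` collects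
the nodes other than the root. -/
inductive Tree {V : Type} : V → Multiset (Formula Pr × List V) → Multiset V → S.Db → Prop
  | form (v : V) (A : S.Fm) : Tree v {(S.mu A, [v])} 0 (.form A)
  | pair {i : S.I} {v y z : V} {a : List V} {N : Multiset V}
      {E₁ E₂ : Multiset (Formula Pr × List V)} {W₁ W₂ : Multiset V} {X Y : S.Db} :
      S.Att i v y z a N → Tree y E₁ W₁ X → Tree z E₂ W₂ Y →
      Tree v ((.prim i.1, a) ::ₘ (E₁ + E₂)) (N + (W₁ + W₂)) (.pair i X Y)
  | bracket {j : S.J} (v : V) {y : V} {E : Multiset (Formula Pr × List V)} {W : Multiset V}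
      {X : S.Db} : Tree y E W X →
      Tree v ((.prim j.1, [v, y]) ::ₘ E) (y ::ₘ W) (.bracket j X)

section Att

variable {V : Type} {i : S.I} {v y z : V} {a : List V} {N W₁ W₂ : Multiset V}

theorem Att.head (h : S.Att i v y z a N) : a.head? = some v := by
  rcases h with ⟨-, rfl, -⟩ | ⟨-, rfl, -⟩ <;> rfl

theorem Att.left_mem (h : S.Att i v y z a N) : y ∈ N := by
  rcases h with ⟨-, -, rfl⟩ | ⟨-, -, -, rfl⟩ <;> simp

theorem Att.right_mem (h : S.Att i v y z a N) : z ∈ N := by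
  rcases h with ⟨-, -, rfl⟩ | ⟨-, -, rfl, rfl⟩ <;> simp

theorem Att.mem_tail (h : S.Att i v y z a N) {u : V} : u ∈ a.tail ↔ u ∈ N := by
  rcases h with ⟨-, rfl, rfl⟩ | ⟨-, rfl, rfl, rfl⟩ <;> simp

/-- Distinctness of the nodes makes the two subtrees disjoint, except that for a commutative mode
they have the same root. -/
theorem Att.nodup (h : S.Att i v y z a N) (hn : (v ::ₘ (N + (W₁ + W₂))).Nodup) :
    (y ::ₘ W₁).Nodup ∧ (z ::ₘ W₂).Nodup ∧ v ∉ y ::ₘ W₁ ∧ v ∉ z ::ₘ W₂ ∧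
      (∀ u ∈ W₁, u ∉ z ::ₘ W₂) ∧ (∀ u ∈ W₂, u ∉ y ::ₘ W₁) ∧ (i ∉ S.C → y ≠ z) ∧ v ∉ N := by
  have key : ∀ u ∈ W₁, ∀ w ∈ W₂, u ≠ w := by
    rintro u h1 _ h2 rfl
    simp only [Multiset.nodup_cons, Multiset.nodup_add] at hn
    exact Multiset.disjoint_left.1 hn.2.2.1.2.2 h1 h2
  rcases h with ⟨hi, rfl, rfl⟩ | ⟨hi, rfl, rfl, rfl⟩ <;>
    simp [Multiset.nodup_add] at hn ⊢ <;> grind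

end Att

namespace Tree

variable {V : Type} {v : V} {E : Multiset (Formula Pr × List V)} {W : Multiset V} {X : S.Db}

theorem map (h : S.Tree v E W X) {V' : Type} (f : V → V') :
    S.Tree (f v) (E.map (rename f)) (W.map f) X := by
  induction h with
  | form v A => simpa using Tree.form (f v) A
  | pair hA _ _ h1 h2 => simpa using Tree.pair (hA.map f) h1 h2
  | bracket v _ ih => simpa using Tree.bracket (f v) ih

theorem mem_tail (h : S.Tree v E W X) {r : Formula Pr × List V} (hr : r ∈ E) {u : V}
    (hu : u ∈ r.2.tail) : u ∈ W := by
  induction h with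
  | form v A =>
    rw [Multiset.mem_singleton] at hr
    subst hr
    simp at hu
  | pair hA _ _ h1 h2 =>
    simp only [Multiset.mem_cons, Multiset.mem_add] at hr ⊢
    rcases hr with rfl | hr | hr
    · exact .inl (hA.mem_tail.1 hu)
    · exact .inr (.inl (h1 hr))
    · exact .inr (.inr (h2 hr))
  | bracket v _ ih =>
    rw [Multiset.mem_cons] at hr ⊢
    rcases hr with rfl | hr
    · simpa using Or.inl hu
    · exact .inr (ih hr)

theorem mem_att (h : S.Tree v E W X) {r : Formula Pr × List V} (hr : r ∈ E) {u : V}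
    (hu : u ∈ r.2) : u ∈ v ::ₘ W := by
  induction h with
  | form v A =>
    rw [Multiset.mem_singleton] at hr
    subst hr
    simpa using hu
  | @pair i v y z a N E₁ E₂ W₁ W₂ X Y hA _ _ h1 h2 =>
    simp only [Multiset.mem_cons, Multiset.mem_add] at hr h1 h2 ⊢
    rcases hr with rfl | hr | hr
    · rcases hA with ⟨-, rfl, rfl⟩ | ⟨-, rfl, rfl, rfl⟩ <;> simp at hu ⊢ <;> grind
    · rcases h1 hr with rfl | h
      · exact .inr (.inl hA.left_mem)
      · exact .inr (.inr (.inl h))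
    · rcases h2 hr with rfl | h
      · exact .inr (.inl hA.right_mem)
      · exact .inr (.inr (.inr h))
  | bracket v _ ih =>
    simp only [Multiset.mem_cons] at hr ih ⊢
    rcases hr with rfl | hr
    · simp at hu
      grind
    · exact .inr (ih hr)

theorem mem_att_of_head (h : S.Tree v E W X) {r : Formula Pr × List V} (hr : r ∈ E) {u : V}
    (hu : r.2.head? = some u) : u ∈ v ::ₘ W := by
  refine h.mem_att hr ?_
  exact List.mem_of_head? hu

theorem exists_root (h : S.Tree v E W X) : ∃ r ∈ E, r.2.head? = some v := by
  cases h with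
  | form v A => exact ⟨_, Multiset.mem_singleton_self _, rfl⟩
  | pair hA _ _ => exact ⟨_, Multiset.mem_cons_self _ _, hA.head⟩
  | bracket v _ => exact ⟨_, Multiset.mem_cons_self _ _, rfl⟩

/-- In a pair or bracket the root occurs in the attachment string of the structural hyperedge only,
so a leaf attached to the root leaves no room for anything else. The formula is determined only up
to its translation. -/
theorem eq_form (h : S.Tree v E W X) (hv : v ∉ W) {A : S.Fm} (hA : (S.mu A, [v]) ∈ E) :
    ∃ A', X = .form A' ∧ S.mu A' = S.mu A ∧ E = {(S.mu A, [v])} ∧ W = 0 := by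
  cases h with
  | form v A' =>
    rw [Multiset.mem_singleton] at hA
    have : S.mu A = S.mu A' := congrArg Prod.fst hA
    exact ⟨A', rfl, this.symm, by rw [this], rfl⟩
  | pair hAtt h1 h2 =>
    exfalso
    simp only [Multiset.mem_cons, Multiset.mem_add, not_or] at hA hv
    rcases hA with hA | hA | hA
    · exact prim_mode_ne_mu _ _ (congrArg Prod.fst hA).symm
    · rcases Multiset.mem_cons.1 (h1.mem_att hA (List.mem_singleton_self v)) with rfl | h
      · exact hv.1 hAtt.left_mem
      · exact hv.2.1 h
    · rcases Multiset.mem_cons.1 (h2.mem_att hA (List.mem_singleton_self v)) with rfl | h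
      · exact hv.1 hAtt.right_mem
      · exact hv.2.2 h
  | bracket v h1 =>
    exfalso
    simp only [Multiset.mem_cons, not_or] at hA hv
    rcases hA with hA | hA
    · exact prim_modality_ne_mu _ _ (congrArg Prod.fst hA).symm
    · rcases Multiset.mem_cons.1 (h1.mem_att hA (List.mem_singleton_self v)) with rfl | h
      · exact hv.1 rfl
      · exact hv.2 h

/-- A mode hyperedge starting at the root cannot lie in a proper subtree, since the nodes of these
subtrees do not include the root. It is therefore the top hyperedge, and its attachment string
yields the roots of the subtrees. -/
theorem eq_pair (h : S.Tree v E W X) (hv : v ∉ W) {i : S.I} {y z : V} {a : List V}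
    {N : Multiset V} (hA : S.Att i v y z a N) (hr : (.prim i.1, a) ∈ E) :
    ∃ E₁ E₂ W₁ W₂ X₁ X₂, S.Tree y E₁ W₁ X₁ ∧ S.Tree z E₂ W₂ X₂ ∧ X = .pair i X₁ X₂ ∧
      E = (.prim i.1, a) ::ₘ (E₁ + E₂) ∧ W = N + (W₁ + W₂) := by
  cases h with
  | form v A' =>
    rw [Multiset.mem_singleton] at hr
    exact absurd (congrArg Prod.fst hr) (prim_mode_ne_mu _ _)
  | pair hAtt h1 h2 =>
    simp only [Multiset.mem_cons, Multiset.mem_add, not_or] at hr hv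
    rcases hr with hr | hr | hr
    · obtain rfl := prim_mode_injective (congrArg Prod.fst hr)
      obtain rfl := congrArg Prod.snd hr
      obtain ⟨-, rfl, rfl, rfl⟩ := hA.inj hAtt
      exact ⟨_, _, _, _, _, _, h1, h2, rfl, rfl, rfl⟩
    · rcases Multiset.mem_cons.1 (h1.mem_att_of_head hr hA.head) with rfl | h
      · exact absurd hAtt.left_mem hv.1
      · exact absurd h hv.2.1
    · rcases Multiset.mem_cons.1 (h2.mem_att_of_head hr hA.head) with rfl | h
      · exact absurd hAtt.right_mem hv.1
      · exact absurd h hv.2.2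
  | bracket v h1 =>
    simp only [Multiset.mem_cons, not_or] at hr hv
    rcases hr with hr | hr
    · exact absurd (congrArg Prod.fst hr) (prim_mode_ne_modality _ _)
    · rcases Multiset.mem_cons.1 (h1.mem_att_of_head hr hA.head) with rfl | h
      · exact absurd rfl hv.1
      · exact absurd h hv.2

theorem eq_bracket (h : S.Tree v E W X) (hv : v ∉ W) {j : S.J} {y : V}
    (hr : (.prim j.1, [v, y]) ∈ E) :
    ∃ E₁ W₁ X₁, S.Tree y E₁ W₁ X₁ ∧ X = .bracket j X₁ ∧
      E = (.prim j.1, [v, y]) ::ₘ E₁ ∧ W = y ::ₘ W₁ := by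
  cases h with
  | form v A' =>
    rw [Multiset.mem_singleton] at hr
    exact absurd (congrArg Prod.fst hr) (prim_modality_ne_mu _ _)
  | pair hAtt h1 h2 =>
    simp only [Multiset.mem_cons, Multiset.mem_add, not_or] at hr hv
    rcases hr with hr | hr | hr
    · exact absurd (congrArg Prod.fst hr).symm (prim_mode_ne_modality _ _)
    · rcases Multiset.mem_cons.1 (h1.mem_att_of_head hr rfl) with rfl | h
      · exact absurd hAtt.left_mem hv.1
      · exact absurd h hv.2.1
    · rcases Multiset.mem_cons.1 (h2.mem_att_of_head hr rfl) with rfl | h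
      · exact absurd hAtt.right_mem hv.1
      · exact absurd h hv.2.2
  | bracket v h1 =>
    simp only [Multiset.mem_cons, not_or] at hr hv
    rcases hr with hr | hr
    · obtain rfl := prim_modality_injective (congrArg Prod.fst hr)
      have h2 := congrArg Prod.snd hr
      simp only [List.cons.injEq, true_and, and_true] at h2
      subst h2
      exact ⟨_, _, _, h1, rfl, rfl, rfl⟩
    · rcases Multiset.mem_cons.1 (h1.mem_att_of_head hr rfl) with rfl | h
      · exact absurd rfl hv.1
      · exact absurd h hv.2

/-- `E₀` and `W₀` form the context `Δ` with root `v` and its place at the node `x`. -/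
def IsCtx (S : ModeSystem Pr) {V : Type} (v x : V) (E₀ : Multiset (Formula Pr × List V))
    (W₀ : Multiset V) (Δ : NLM.Ctx {p : Pr // Ranked.rk p = 1} S.I S.J) : Prop :=
  ∀ ⦃V' : Type⦄ (f : V → V') ⦃Z : S.Db⦄ ⦃E W⦄, S.Tree (f x) E W Z →
    S.Tree (f v) (E₀.map (rename f) + E) (W₀.map f + W) (Δ.plug Z)

theorem isCtx_hole (v : V) : IsCtx S v v 0 0 .hole := by
  intro V' f Z E W h
  simpa [NLM.Ctx.plug] using h

theorem isCtx_pairLeft {i : S.I} {y z x : V} {a : List V} {N : Multiset V}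
    {E₀ E₂ : Multiset (Formula Pr × List V)} {W₀ W₂ : Multiset V} {Y : S.Db}
    {Δ : NLM.Ctx {p : Pr // Ranked.rk p = 1} S.I S.J}
    (hA : S.Att i v y z a N) (h : IsCtx S y x E₀ W₀ Δ) (h2 : S.Tree z E₂ W₂ Y) :
    IsCtx S v x ((.prim i.1, a) ::ₘ (E₀ + E₂)) (N + (W₀ + W₂)) (.pairLeft i Δ Y) := by
  intro V' f Z E W hZ
  have := Tree.pair (hA.map f) (h f hZ) (h2.map f)
  rw [add_right_comm (E₀.map _), add_right_comm (W₀.map f), ← add_assoc (N.map f),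
    ← Multiset.cons_add] at this
  simpa [NLM.Ctx.plug] using this

theorem isCtx_pairRight {i : S.I} {y z x : V} {a : List V} {N : Multiset V}
    {E₀ E₁ : Multiset (Formula Pr × List V)} {W₀ W₁ : Multiset V} {Y : S.Db}
    {Δ : NLM.Ctx {p : Pr // Ranked.rk p = 1} S.I S.J}
    (hA : S.Att i v y z a N) (h1 : S.Tree y E₁ W₁ Y) (h : IsCtx S z x E₀ W₀ Δ) :
    IsCtx S v x ((.prim i.1, a) ::ₘ (E₁ + E₀)) (N + (W₁ + W₀)) (.pairRight i Y Δ) := by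
  intro V' f Z E W hZ
  have := Tree.pair (hA.map f) (h1.map f) (h f hZ)
  rw [← add_assoc (E₁.map _), ← add_assoc (W₁.map f), ← add_assoc (N.map f),
    ← Multiset.cons_add] at this
  simpa [NLM.Ctx.plug] using this

theorem isCtx_bracket {j : S.J} {y x : V} {E₀ : Multiset (Formula Pr × List V)} {W₀ : Multiset V}
    {Δ : NLM.Ctx {p : Pr // Ranked.rk p = 1} S.I S.J} (h : IsCtx S y x E₀ W₀ Δ) :
    IsCtx S v x ((.prim j.1, [v, y]) ::ₘ E₀) (y ::ₘ W₀) (.bracket j Δ) := by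
  intro V' f Z E W hZ
  simpa [NLM.Ctx.plug] using Tree.bracket (f v) (h f hZ)

/-- A context is known only through its behavior under plugging. Its nodes are found by plugging in
some tree and discarding the inner nodes of that tree. -/
theorem IsCtx.mem_att {x : V} {E₀ : Multiset (Formula Pr × List V)} {W₀ : Multiset V}
    {Δ : NLM.Ctx {p : Pr // Ranked.rk p = 1} S.I S.J} (h : IsCtx S v x E₀ W₀ Δ)
    {Y : S.Db} (hY : S.Tree x E W Y) {r : Formula Pr × List V} (hr : r ∈ E₀) {u : V}
    (hu : u ∈ r.2) (hW : u ∉ W) : u ∈ v ::ₘ W₀ := by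
  have := h id hY
  rw [rename_id, Multiset.map_id, Multiset.map_id] at this
  have h2 := this.mem_att (Multiset.mem_add.2 (.inl hr)) hu
  simp only [id_eq, Multiset.mem_cons, Multiset.mem_add] at h2 ⊢
  tauto

/-- This cuts a tree at a place given in the database. The context part is required to work after
any renaming of nodes, because it will be used inside other hypergraphs: in a replacement, or after
collapsing one. -/
theorem exists_of_plug {Δ : NLM.Ctx {p : Pr // Ranked.rk p = 1} S.I S.J} {Y : S.Db}
    (h : S.Tree v E W (Δ.plug Y)) : ∃ x E₀ W₀ E₁ W₁, S.Tree x E₁ W₁ Y ∧ E = E₀ + E₁ ∧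
      W = W₀ + W₁ ∧ IsCtx S v x E₀ W₀ Δ := by
  induction Δ generalizing v E W with
  | hole => exact ⟨v, 0, 0, E, W, h, by simp, by simp, isCtx_hole v⟩
  | pairLeft i Δ Z ih =>
    cases h with
    | pair hA h1 h2 =>
      obtain ⟨x, E₀, W₀, E₁, W₁, h3, rfl, rfl, h4⟩ := ih h1
      refine ⟨x, _, _, E₁, W₁, h3, ?_, ?_, isCtx_pairLeft hA h4 h2⟩
      · rw [add_right_comm, Multiset.cons_add]
      · abel
  | pairRight i Z Δ ih =>
    cases h with
    | pair hA h1 h2 =>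
      obtain ⟨x, E₀, W₀, E₁, W₁, h3, rfl, rfl, h4⟩ := ih h2
      refine ⟨x, _, _, E₁, W₁, h3, ?_, ?_, isCtx_pairRight hA h1 h4⟩
      · rw [← add_assoc, Multiset.cons_add]
      · abel
  | bracket j Δ ih =>
    cases h with
    | bracket v h1 =>
      obtain ⟨x, E₀, W₀, E₁, W₁, h3, rfl, rfl, h4⟩ := ih h1
      exact ⟨x, _, _, E₁, W₁, h3, by simp, by simp, isCtx_bracket h4⟩

/-- This cuts a tree at a place given by a hyperedge: each hyperedge is the top hyperedge of exactly
the subtree it belongs to, rooted at its first attachment node. At a commutative mode two subtrees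
have this root, and the one containing the hyperedge is taken. -/
theorem exists_plug_of_mem (h : S.Tree v E W X) (hn : (v ::ₘ W).Nodup)
    {r : Formula Pr × List V} (hr : r ∈ E) :
    ∃ Δ Y x E₀ W₀ E₁ W₁, X = Δ.plug Y ∧ S.Tree x E₁ W₁ Y ∧ (x ::ₘ W₁).Nodup ∧ r ∈ E₁ ∧
      r.2.head? = some x ∧ E = E₀ + E₁ ∧ W = W₀ + W₁ ∧ IsCtx S v x E₀ W₀ Δ := by
  have base : ∀ {v E W X}, S.Tree v E W X → (v ::ₘ W).Nodup → r ∈ E → r.2.head? = some v →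
      ∃ Δ Y x E₀ W₀ E₁ W₁, X = Δ.plug Y ∧ S.Tree x E₁ W₁ Y ∧ (x ::ₘ W₁).Nodup ∧ r ∈ E₁ ∧
        r.2.head? = some x ∧ E = E₀ + E₁ ∧ W = W₀ + W₁ ∧ IsCtx S v x E₀ W₀ Δ :=
    fun {v E W X} h hn hr hv =>
      ⟨.hole, X, v, 0, 0, E, W, rfl, h, hn, hr, hv, by simp, by simp, isCtx_hole v⟩
  induction h with
  | form v A =>
    refine base (.form v A) hn hr ?_
    rw [Multiset.mem_singleton] at hr
    rw [hr]
    rfl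
  | pair hA t1 t2 ih1 ih2 =>
    obtain ⟨hn1, hn2, -⟩ := hA.nodup hn
    have hr' := hr
    simp only [Multiset.mem_cons, Multiset.mem_add] at hr
    rcases hr with rfl | hr | hr
    · exact base (.pair hA t1 t2) hn hr' hA.head
    · obtain ⟨Δ, Z, x, E₀, W₀, E₁, W₁, rfl, h1, h2, h3, h4, rfl, rfl, h5⟩ := ih1 hn1 hr
      refine ⟨_, Z, x, _, _, E₁, W₁, rfl, h1, h2, h3, h4, ?_, ?_, isCtx_pairLeft hA h5 t2⟩
      · rw [add_right_comm, Multiset.cons_add]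
      · abel
    · obtain ⟨Δ, Z, x, E₀, W₀, E₁, W₁, rfl, h1, h2, h3, h4, rfl, rfl, h5⟩ := ih2 hn2 hr
      refine ⟨_, Z, x, _, _, E₁, W₁, rfl, h1, h2, h3, h4, ?_, ?_, isCtx_pairRight hA t1 h5⟩
      · rw [← add_assoc, Multiset.cons_add]
      · abel
  | bracket v t ih =>
    have hr' := hr
    simp only [Multiset.mem_cons] at hr
    rcases hr with rfl | hr
    · exact base (.bracket v t) hn hr' rfl
    · obtain ⟨Δ, Z, x, E₀, W₀, E₁, W₁, rfl, h1, h2, h3, h4, rfl, rfl, h5⟩ :=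
        ih (Multiset.nodup_cons.1 hn).2 hr
      exact ⟨_, Z, x, _, _, E₁, W₁, rfl, h1, h2, h3, h4, by simp, by simp, isCtx_bracket h5⟩

/-- Every hyperedge labeled by a translated formula is a leaf, where trees can be grafted. -/
theorem exists_plug_form (h : S.Tree v E W X) (hn : (v ::ₘ W).Nodup) {A : S.Fm} {x : V}
    (hr : (S.mu A, [x]) ∈ E) :
    ∃ Δ A' E₀, X = Δ.plug (.form A') ∧ S.mu A' = S.mu A ∧ E = E₀ + {(S.mu A, [x])} ∧
      IsCtx S v x E₀ W Δ := by
  obtain ⟨Δ, Z, x', E₀, W₀, E₁, W₁, rfl, h1, h2, h3, h4, rfl, rfl, h5⟩ :=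
    h.exists_plug_of_mem hn hr
  obtain rfl : x = x' := by simpa using h4
  obtain ⟨A', rfl, h6, rfl, rfl⟩ := h1.eq_form (Multiset.nodup_cons.1 h2).1 h3
  exact ⟨Δ, A', E₀, rfl, h6, rfl, by simpa using h5⟩

/-- Trees for the same database are related by a renaming of nodes. -/
theorem exists_rename (h : S.Tree v E W X) (hn : (v ::ₘ W).Nodup) {V' : Type} {v' : V'}
    {E' : Multiset (Formula Pr × List V')} {W' : Multiset V'} (h' : S.Tree v' E' W' X) :
    ∃ f : V → V', f v = v' ∧ E.map (rename f) = E' ∧ W.map f = W' := by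
  classical
  induction h generalizing v' E' W' with
  | form v A =>
    cases h' with
    | form => exact ⟨fun _ => v', rfl, by simp, by simp⟩
  | @pair i v y z a N E₁ E₂ W₁ W₂ X Y hA t1 t2 ih1 ih2 =>
    cases h' with
    | @pair _ _ y' z' a' N' E₁' E₂' W₁' W₂' _ _ hA' t1' t2' =>
      obtain ⟨hn1, hn2, hv1, hv2, hd1, hd2, hyz, -⟩ := hA.nodup hn
      obtain ⟨f1, hf1, hE1, hW1⟩ := ih1 hn1 t1'
      obtain ⟨f2, hf2, hE2, hW2⟩ := ih2 hn2 t2'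
      -- The renamings of the subtrees are pasted together. In the commutative case the shared root
      -- is treated by `f1`; this does no harm, as the second tree has a shared root as well.
      let f : V → V' := fun u => if u = v then v' else if u ∈ y ::ₘ W₁ then f1 u else f2 u
      have hfv : f v = v' := if_pos rfl
      have g1 : ∀ u ∈ y ::ₘ W₁, f u = f1 u := by
        intro u hu
        have : u ≠ v := fun h => hv1 (h ▸ hu)
        simp only [f, if_neg this, if_pos hu]
      have hfy : f y = y' := (g1 y (Multiset.mem_cons_self _ _)).trans hf1
      have hfz : f z = z' := by
        rcases hA with ⟨hi, rfl, rfl⟩ | ⟨hi, rfl, rfl, rfl⟩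
        · have h1 : z ≠ v := fun h => hv2 (h ▸ Multiset.mem_cons_self _ _)
          have h2 : z ∉ y ::ₘ W₁ := by
            rw [Multiset.mem_cons, not_or]
            exact ⟨(hyz hi).symm, fun h => hd1 z h (Multiset.mem_cons_self _ _)⟩
          simp only [f, if_neg h1, if_neg h2, hf2]
        · rcases hA' with ⟨hi', -⟩ | ⟨hi', rfl, rfl, rfl⟩
          · exact absurd hi hi'
          · exact hfy
      have g2 : ∀ u ∈ z ::ₘ W₂, f u = f2 u := by
        intro u hu
        rcases Multiset.mem_cons.1 hu with rfl | hu'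
        · rw [hfz, hf2]
        · have h1 : u ≠ v := fun h => hv2 (h ▸ hu)
          simp only [f, if_neg h1, if_neg (hd2 u hu')]
      have hAf : a.map f = a' ∧ N.map f = N' := by
        rcases hA with ⟨hi, rfl, rfl⟩ | ⟨hi, rfl, rfl, rfl⟩ <;>
          rcases hA' with ⟨hi', rfl, rfl⟩ | ⟨hi', rfl, rfl, rfl⟩ <;>
          first
          | exact absurd hi' hi
          | exact absurd hi hi'
          | simp [hfv, hfy, hfz]
      have e1 : E₁.map (rename f) = E₁' := by
        rw [← hE1]
        refine Multiset.map_congr rfl fun r hr => ?_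
        exact Prod.ext rfl (List.map_congr_left fun u hu => g1 u (t1.mem_att hr hu))
      have e2 : E₂.map (rename f) = E₂' := by
        rw [← hE2]
        refine Multiset.map_congr rfl fun r hr => ?_
        exact Prod.ext rfl (List.map_congr_left fun u hu => g2 u (t2.mem_att hr hu))
      have w1 : W₁.map f = W₁' := by
        rw [← hW1]
        exact Multiset.map_congr rfl fun u hu => g1 u (Multiset.mem_cons_of_mem hu)
      have w2 : W₂.map f = W₂' := by
        rw [← hW2]
        exact Multiset.map_congr rfl fun u hu => g2 u (Multiset.mem_cons_of_mem hu)
      exact ⟨f, hfv, by simp [hAf.1, e1, e2], by simp [hAf.2, w1, w2]⟩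
  | @bracket j v y E W X t ih =>
    cases h' with
    | @bracket _ _ y' E' W' _ t' =>
      obtain ⟨f1, hf1, hE1, hW1⟩ := ih (Multiset.nodup_cons.1 hn).2 t'
      let f : V → V' := fun u => if u = v then v' else f1 u
      have hfv : f v = v' := if_pos rfl
      have g1 : ∀ u ∈ y ::ₘ W, f u = f1 u := by
        intro u hu
        have : u ≠ v := fun h => (Multiset.nodup_cons.1 hn).1 (h ▸ hu)
        simp only [f, if_neg this]
      have hfy : f y = y' := (g1 y (Multiset.mem_cons_self _ _)).trans hf1
      have e1 : E.map (rename f) = E' := by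
        rw [← hE1]
        refine Multiset.map_congr rfl fun r hr => ?_
        exact Prod.ext rfl (List.map_congr_left fun u hu => g1 u (t.mem_att hr hu))
      have w1 : W.map f = W' := by
        rw [← hW1]
        exact Multiset.map_congr rfl fun u hu => g1 u (Multiset.mem_cons_of_mem hu)
      exact ⟨f, hfv, by simp [hfv, hfy, e1], by simp [hfy, w1]⟩

/-! ### A hypergraph determines its database up to the commutative modes -/

open scoped Classical in
/-- The hyperedges with first attachment node `u`. -/
noncomputable def out (E : Multiset (Formula Pr × List V)) (u : V) :
    Multiset (Formula Pr × List V) := E.filter fun r => r.2.head? = some u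

open scoped Classical in
theorem out_add (E E' : Multiset (Formula Pr × List V)) (u : V) :
    out (E + E') u = out E u + out E' u := Multiset.filter_add _ _ _

open scoped Classical in
theorem out_cons_of_ne {E : Multiset (Formula Pr × List V)} {u v : V} {l : Formula Pr} {a : List V}
    (hr : a.head? = some v) (hu : u ≠ v) : out ((l, a) ::ₘ E) u = out E u :=
  Multiset.filter_cons_of_neg _ fun h => hu (Option.some_injective _ (h.symm.trans hr))

open scoped Classical in
theorem card_out_cons {E : Multiset (Formula Pr × List V)} {v : V} {l : Formula Pr} {a : List V}
    (hr : a.head? = some v) : (out ((l, a) ::ₘ E) v).card = (out E v).card + 1 := by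
  simp [out, hr]

open scoped Classical in
theorem out_eq_zero (h : S.Tree v E W X) {u : V} (hu : u ∉ v ::ₘ W) : out E u = 0 :=
  Multiset.filter_eq_nil.2 fun _ hr hh => hu (h.mem_att_of_head hr hh)

variable (S) in
/-- The numbers of hyperedges leaving the arguments of mode hyperedges. -/
def OutCard (E : Multiset (Formula Pr × List V)) : Prop :=
  (∀ (i : S.I) x y z a N, S.Att i x y z a N → (.prim i.1, a) ∈ E →
    (i ∈ S.C → (out E y).card = 2) ∧
    (i ∉ S.C → (out E y).card = 1 ∧ (out E z).card = 1)) ∧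
  ∀ (j : S.J) x y, (.prim j.1, [x, y]) ∈ E → (out E y).card = 1

-- A tree has one hyperedge leaving its root, and two trees sharing a root have two. Hyperedges
-- elsewhere do not interfere, because a hyperedge starts at a node of its own subtree and subtrees
-- overlap at most in their roots.
open scoped Classical in
theorem outCard (h : S.Tree v E W X) (hn : (v ::ₘ W).Nodup) :
    (out E v).card = 1 ∧ OutCard S E := by
  induction h with
  | form v A =>
    refine ⟨?_, ?_, ?_⟩
    · simp [out, Multiset.filter_singleton]
    · intro i x y z a N hA hr
      rw [Multiset.mem_singleton] at hr
      exact absurd (congrArg Prod.fst hr) (prim_mode_ne_mu _ _)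
    · intro j x y hr
      rw [Multiset.mem_singleton] at hr
      exact absurd (congrArg Prod.fst hr) (prim_modality_ne_mu _ _)
  | @pair i v y z a N E₁ E₂ W₁ W₂ X Y hA t1 t2 ih1 ih2 =>
    obtain ⟨hn1, hn2, hv1, hv2, hd1, hd2, hyz, -⟩ := hA.nodup hn
    obtain ⟨c1, o1, b1⟩ := ih1 hn1
    obtain ⟨c2, o2, b2⟩ := ih2 hn2
    have hvy : y ≠ v := fun h => hv1 (h ▸ Multiset.mem_cons_self _ _)
    have hvz : z ≠ v := fun h => hv2 (h ▸ Multiset.mem_cons_self _ _)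
    have k1 : ∀ u ∈ W₁, out ((.prim i.1, a) ::ₘ (E₁ + E₂)) u = out E₁ u := by
      intro u hu
      rw [out_cons_of_ne hA.head (fun h => hv1 (h ▸ Multiset.mem_cons_of_mem hu)), out_add,
        t2.out_eq_zero (hd1 u hu), add_zero]
    have k2 : ∀ u ∈ W₂, out ((.prim i.1, a) ::ₘ (E₁ + E₂)) u = out E₂ u := by
      intro u hu
      rw [out_cons_of_ne hA.head (fun h => hv2 (h ▸ Multiset.mem_cons_of_mem hu)), out_add,
        t1.out_eq_zero (hd2 u hu), zero_add]
    refine ⟨?_, ?_, ?_⟩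
    · rw [card_out_cons hA.head, out_add, t1.out_eq_zero hv1, t2.out_eq_zero hv2]
      rfl
    · intro i' x' y' z' a' N' hA' hr
      simp only [Multiset.mem_cons, Multiset.mem_add] at hr
      rcases hr with hr | hr | hr
      · obtain rfl := prim_mode_injective (congrArg Prod.fst hr)
        obtain rfl := congrArg Prod.snd hr
        obtain ⟨-, rfl, rfl, rfl⟩ := hA'.inj hA
        rw [out_cons_of_ne hA.head hvy, out_cons_of_ne hA.head hvz, out_add, out_add]
        constructor
        · intro hi
          rcases hA with ⟨hi', -⟩ | ⟨-, -, rfl, -⟩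
          · exact absurd hi hi'
          · simp [c1, c2]
        · intro hi
          have h1 : y' ∉ z' ::ₘ W₂ := by
            rw [Multiset.mem_cons, not_or]
            exact ⟨hyz hi, fun h => hd2 _ h (Multiset.mem_cons_self _ _)⟩
          have h2 : z' ∉ y' ::ₘ W₁ := by
            rw [Multiset.mem_cons, not_or]
            exact ⟨(hyz hi).symm, fun h => hd1 _ h (Multiset.mem_cons_self _ _)⟩
          simp [t1.out_eq_zero h2, t2.out_eq_zero h1, c1, c2]
      · have hy' := t1.mem_tail hr (hA'.mem_tail.2 hA'.left_mem)
        have hz' := t1.mem_tail hr (hA'.mem_tail.2 hA'.right_mem)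
        rw [k1 _ hy', k1 _ hz']
        exact o1 i' x' y' z' a' N' hA' hr
      · have hy' := t2.mem_tail hr (hA'.mem_tail.2 hA'.left_mem)
        have hz' := t2.mem_tail hr (hA'.mem_tail.2 hA'.right_mem)
        rw [k2 _ hy', k2 _ hz']
        exact o2 i' x' y' z' a' N' hA' hr
    · intro j x' y' hr
      simp only [Multiset.mem_cons, Multiset.mem_add] at hr
      rcases hr with hr | hr | hr
      · exact absurd (congrArg Prod.fst hr).symm (prim_mode_ne_modality _ _)
      · rw [k1 _ (t1.mem_tail hr (u := y') (by simp))]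
        exact b1 j x' y' hr
      · rw [k2 _ (t2.mem_tail hr (u := y') (by simp))]
        exact b2 j x' y' hr
  | @bracket j v y E W X t ih =>
    obtain ⟨hv, hn1⟩ := Multiset.nodup_cons.1 hn
    obtain ⟨c1, o1, b1⟩ := ih hn1
    have k : ∀ u ∈ y ::ₘ W, out ((.prim j.1, [v, y]) ::ₘ E) u = out E u := by
      intro u hu
      exact out_cons_of_ne (v := v) rfl fun h => hv (h ▸ hu)
    refine ⟨?_, ?_, ?_⟩
    · rw [card_out_cons rfl, t.out_eq_zero hv]
      rfl
    · intro i' x' y' z' a' N' hA' hr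
      rcases Multiset.mem_cons.1 hr with hr | hr
      · exact absurd (congrArg Prod.fst hr) (prim_mode_ne_modality _ _)
      · have hy' := t.mem_tail hr (hA'.mem_tail.2 hA'.left_mem)
        have hz' := t.mem_tail hr (hA'.mem_tail.2 hA'.right_mem)
        rw [k _ (Multiset.mem_cons_of_mem hy'), k _ (Multiset.mem_cons_of_mem hz')]
        exact o1 i' x' y' z' a' N' hA' hr
    · intro j' x' y' hr
      rcases Multiset.mem_cons.1 hr with hr | hr
      · have h2 := congrArg Prod.snd hr
        simp only [List.cons.injEq, and_true] at h2
        rw [h2.2, k _ (Multiset.mem_cons_self _ _), c1]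
      · rw [k _ (Multiset.mem_cons_of_mem (t.mem_tail hr (u := y') (by simp)))]
        exact b1 j' x' y' hr

open scoped Classical in
theorem eq_of_out_card {G : Multiset (Formula Pr × List V)} {u : V} (h : (out G u).card = 1)
    {r r' : Formula Pr × List V} (hr : r ∈ G) (hr' : r' ∈ G) (hu : r.2.head? = some u)
    (hu' : r'.2.head? = some u) : r = r' := by
  obtain ⟨s, hs⟩ := Multiset.card_eq_one.1 h
  have h1 : r ∈ out G u := Multiset.mem_filter.2 ⟨hr, hu⟩
  have h2 : r' ∈ out G u := Multiset.mem_filter.2 ⟨hr', hu'⟩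
  rw [hs, Multiset.mem_singleton] at h1 h2
  rw [h1, h2]

-- Taking `E₁ + E₂` inside `G`, rather than assuming `r₁ ≠ r₂`, counts multiplicities: two argument
-- leaves may have the same label and the same node.
open scoped Classical in
theorem out_eq_pair {G E₁ E₂ : Multiset (Formula Pr × List V)} {u : V}
    (h : (out G u).card = 2) (hG : E₁ + E₂ ≤ G) {r₁ r₂ : Formula Pr × List V} (h1 : r₁ ∈ E₁)
    (h2 : r₂ ∈ E₂) (hu1 : r₁.2.head? = some u) (hu2 : r₂.2.head? = some u) :
    {r₁, r₂} = out G u := by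
  refine Multiset.eq_of_le_of_card_le ?_ (by simp [h])
  refine Multiset.le_filter.2 ⟨le_trans ?_ hG, ?_⟩
  · exact add_le_add (Multiset.singleton_le.2 h1) (Multiset.singleton_le.2 h2)
  · intro r hr
    rcases Multiset.mem_cons.1 hr with rfl | hr
    · exact hu1
    · rw [Multiset.mem_singleton.1 hr]
      exact hu2

/-- The two readings of one hypergraph are compared from the top. Their subtrees are not known in
advance to use the same hyperedges, so the induction concerns two trees inside a common `G` that
share only their top hyperedge. `OutCard` then leaves no choice for the top hyperedges of the
arguments, except for the order of two at a commutative mode. -/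
theorem dbEq_of_le {G : Multiset (Formula Pr × List V)} (hG : OutCard S G) (h : S.Tree v E W X)
    (hn : (v ::ₘ W).Nodup) {E' : Multiset (Formula Pr × List V)} {W' : Multiset V} {X' : S.Db}
    (h' : S.Tree v E' W' X') (hn' : (v ::ₘ W').Nodup) (hE : E ≤ G) (hE' : E' ≤ G)
    {r : Formula Pr × List V} (hr : r ∈ E) (hr' : r ∈ E') (hv : r.2.head? = some v) :
    S.DbEq X X' := by
  induction h generalizing E' W' X' r with
  | form v A =>
    rw [Multiset.mem_singleton] at hr
    subst hr
    obtain ⟨A', rfl, h1, -⟩ := h'.eq_form (Multiset.nodup_cons.1 hn').1 hr'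
    exact .form h1.symm
  | @pair i v y z a N E₁ E₂ W₁ W₂ X Y hA t1 t2 ih1 ih2 =>
    obtain ⟨hn1, hn2, hv1, hv2, hd1, hd2, hyz, -⟩ := hA.nodup hn
    obtain rfl : r = (.prim i.1, a) := by
      simp only [Multiset.mem_cons, Multiset.mem_add] at hr
      rcases hr with hr | hr | hr
      · exact hr
      · exact absurd (t1.mem_att_of_head hr hv) hv1
      · exact absurd (t2.mem_att_of_head hr hv) hv2
    obtain ⟨E₁', E₂', W₁', W₂', X₁', X₂', t1', t2', rfl, rfl, rfl⟩ :=
      h'.eq_pair (Multiset.nodup_cons.1 hn').1 hA hr'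
    obtain ⟨hn1', hn2', -⟩ := hA.nodup hn'
    obtain ⟨r1, m1, d1⟩ := t1.exists_root
    obtain ⟨r2, m2, d2⟩ := t2.exists_root
    obtain ⟨r1', m1', d1'⟩ := t1'.exists_root
    obtain ⟨r2', m2', d2'⟩ := t2'.exists_root
    have l := (Multiset.le_cons_self _ _).trans hE
    have l' := (Multiset.le_cons_self _ _).trans hE'
    have l1 := (Multiset.le_add_right _ _).trans l
    have l2 := (Multiset.le_add_left _ _).trans l
    have l1' := (Multiset.le_add_right _ _).trans l'
    have l2' := (Multiset.le_add_left _ _).trans l'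
    obtain ⟨hc, hc'⟩ := hG.1 i v y z a N hA (Multiset.mem_of_le hE hr)
    by_cases hi : i ∈ S.C
    · obtain rfl : z = y := by
        rcases hA with ⟨hi', -⟩ | ⟨-, -, h, -⟩
        · exact absurd hi hi'
        · exact h
      have hp := (out_eq_pair (hc hi) l m1 m2 d1 d2).trans
        (out_eq_pair (hc hi) l' m1' m2' d1' d2').symm
      -- The two hyperedges leaving the shared node form the same unordered pair in both trees, so
      -- they match either straight or crosswise; the second case is a swap.
      have hm : r1' = r1 ∨ r1' = r2 := by
        have : r1' ∈ ({r1, r2} : Multiset (Formula Pr × List V)) := hp ▸ Multiset.mem_cons_self _ _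
        simpa using this
      rcases hm with rfl | rfl
      · obtain rfl : r2 = r2' := by simpa using hp
        exact .pair (ih1 hn1 t1' hn1' l1 l1' m1 m1' d1) (ih2 hn2 t2' hn2' l2 l2' m2 m2' d2)
      · obtain rfl : r1 = r2' := by
          rw [Multiset.pair_comm] at hp
          simpa using hp
        exact .swap hi (ih1 hn1 t2' hn2' l1 l2' m1 m2' d1) (ih2 hn2 t1' hn1' l2 l1' m2 m1' d2)
    · obtain rfl := eq_of_out_card (hc' hi).1 (Multiset.mem_of_le l1 m1)
        (Multiset.mem_of_le l1' m1') d1 d1'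
      obtain rfl := eq_of_out_card (hc' hi).2 (Multiset.mem_of_le l2 m2)
        (Multiset.mem_of_le l2' m2') d2 d2'
      exact .pair (ih1 hn1 t1' hn1' l1 l1' m1 m1' d1) (ih2 hn2 t2' hn2' l2 l2' m2 m2' d2)
  | @bracket j v y E W X t ih =>
    obtain ⟨hvW, hn1⟩ := Multiset.nodup_cons.1 hn
    obtain rfl : r = (.prim j.1, [v, y]) := by
      rcases Multiset.mem_cons.1 hr with hr | hr
      · exact hr
      · exact absurd (t.mem_att_of_head hr hv) hvW
    obtain ⟨E₁', W₁', X₁', t1', rfl, rfl, rfl⟩ := h'.eq_bracket (Multiset.nodup_cons.1 hn').1 hr'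
    obtain ⟨r1, m1, d1⟩ := t.exists_root
    obtain ⟨r1', m1', d1'⟩ := t1'.exists_root
    have l1 := (Multiset.le_cons_self _ _).trans hE
    have l1' := (Multiset.le_cons_self _ _).trans hE'
    obtain rfl := eq_of_out_card (hG.2 j v y (Multiset.mem_of_le hE hr)) (Multiset.mem_of_le l1 m1)
        (Multiset.mem_of_le l1' m1') d1 d1'
    exact .bracket (ih hn1 t1' (Multiset.nodup_cons.1 hn').2 l1 l1' m1 m1' d1)

end Tree

/-! ### Hypergraphs representing a database. -/

/-- `G` is the hypergraph of the database `X`, up to isomorphism. -/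
def Represents (S : ModeSystem Pr) (G : HL.Hypergraph (Formula Pr)) (X : S.Db) : Prop :=
  ∃ v W, G.ext = [v] ∧ G.nodes = v ::ₘ W ∧ S.Tree v G.edges W X

namespace Represents

variable {G G' : HL.Hypergraph (Formula Pr)} {X X' : S.Db}

theorem iso (h : S.Represents G X) (h' : S.Represents G' X) : G.Iso G' := by
  obtain ⟨v, W, he, hV, hT⟩ := h
  obtain ⟨v', W', he', hV', hT'⟩ := h'
  obtain ⟨f, hf, hE, hW⟩ := hT.exists_rename (hV ▸ G.nodup_nodes) hT'
  exact iso_of_map f (by simp [hV, hV', hf, hW]) hE (by simp [he, he', hf])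

theorem of_iso (h : S.Represents G X) (hG : G.Iso G') : S.Represents G' X := by
  obtain ⟨v, W, he, hV, hT⟩ := h
  obtain ⟨f, h1, h2, h3⟩ := hG.exists_map
  exact ⟨f v, W.map f, by simp [h3, he], by simp [h1, hV], h2 ▸ hT.map f⟩

theorem dbEq (h : S.Represents G X) (h' : S.Represents G X') : S.DbEq X X' := by
  obtain ⟨v, W, he, hV, hT⟩ := h
  obtain ⟨v', W', he', hV', hT'⟩ := h'
  obtain rfl : v = v' := by simpa using he.symm.trans he'
  have hn : (v ::ₘ W).Nodup := hV ▸ G.nodup_nodes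
  obtain ⟨r, hr, hv⟩ := hT.exists_root
  exact Tree.dbEq_of_le (hT.outCard hn).2 hT hn hT' (hV' ▸ G.nodup_nodes) le_rfl le_rfl hr hr hv

end Represents

end ModeSystem

/-! ### Inner nodes, and replacement of all hyperedges or all but the hole. -/

namespace HL.Hypergraph

variable {L : Type v} [Ranked L]

open scoped Classical in
/-- The multiset of the nodes that are not external. -/
noncomputable def inner (G : Hypergraph L) : Multiset G.V := G.nodes - ↑G.ext

open scoped Classical in
theorem nodes_eq {G : Hypergraph L} (h : G.ext.Nodup) : G.nodes = ↑G.ext + G.inner := by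
  rw [inner, add_tsub_cancel_of_le]
  exact (Multiset.le_iff_subset (Multiset.coe_nodup.2 h)).2 fun v _ => mem_nodes v

theorem inner_eq {G : Hypergraph L} {W : Multiset G.V} (h : G.nodes = ↑G.ext + W) :
    G.inner = W := by
  have hn := G.nodup_nodes
  rw [h, Multiset.nodup_add, Multiset.coe_nodup] at hn
  exact add_left_cancel ((nodes_eq hn.1).symm.trans h)

theorem Iso.handle_inner {a : L} {G : Hypergraph L} (h : G.Iso (Hypergraph.handle a)) :
    G.ext.Nodup ∧ G.inner = 0 := by
  have h1 := h.handle.1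
  refine ⟨?_, inner_eq (by rw [h1, add_zero])⟩
  have := G.nodup_nodes
  rwa [h1, Multiset.coe_nodup] at this

theorem nodes_replace_inner {G : Hypergraph L} {ι : Type} [Finite ι] {m : ι ↪ G.E}
    {H : ι → Hypergraph L} (hlen : ∀ i, (H i).ext.length = (G.att (m i)).length)
    (hnd : ∀ i, (H i).ext.Nodup) : (G.replace m H).nodes = G.nodes.map (inHost G m H) +
      msum (fun i => (H i).inner.map (inPart G m H i)) :=
  nodes_replace hlen _ fun i => nodes_eq (hnd i)

theorem edges_replaceAll {G : Hypergraph L} {H : G.E → Hypergraph L} :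
    (G.replace (Function.Embedding.refl _) H).edges =
      msum (fun e => (H e).edges.map (rename (inPart G (Function.Embedding.refl _) H e))) := by
  have h := edges_replace (G := G) (m := Function.Embedding.refl _) (H := H)
  have h2 : G.edges.map (rename (inHost G (Function.Embedding.refl _) H)) =
      msum (fun e => {(G.lab e, (G.att e).map (inHost G (Function.Embedding.refl _) H))}) := by
    rw [edges, map_msum]
    rfl
  rw [h2, add_comm] at h
  exact add_left_cancel h

theorem edges_fill {D : HoleGraph L} {a : L} {ha : Ranked.rk a = D.hole.length} :
    (D.fill a ha).edges = (a, D.hole) ::ₘ msum (fun d => {(D.lab d, D.att d)}) :=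
  msum_option (α := D.E) _

/-- The hyperedges of `D` other than the hole, as hyperedges of `D.fill a`. -/
def fillEmb (D : HoleGraph L) (a : L) (ha : Ranked.rk a = D.hole.length) :
    D.E ↪ (D.fill a ha).E := Function.Embedding.some

theorem edges_fill_replace {D : HoleGraph L} {a : L} {ha : Ranked.rk a = D.hole.length}
    {K : D.E → Hypergraph L} :
    ((D.fill a ha).replace (fillEmb D a ha) K).edges =
      (a, D.hole.map (inHost (D.fill a ha) (fillEmb D a ha) K)) ::ₘ
      msum (fun d => (K d).edges.map (rename (inPart (D.fill a ha) (fillEmb D a ha) K d))) := by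
  have h := edges_replace (G := D.fill a ha) (m := fillEmb D a ha) (H := K)
  have h2 : (D.fill a ha).edges.map (rename (inHost (D.fill a ha) (fillEmb D a ha) K)) =
      (a, D.hole.map (inHost (D.fill a ha) (fillEmb D a ha) K)) ::ₘ
      msum (fun d => {(D.lab d, (D.att d).map (inHost (D.fill a ha) (fillEmb D a ha) K))}) := by
    exact (map_msum _ _).trans (msum_option (α := D.E) _)
  rw [h2, Multiset.cons_add, add_comm (msum _), ← Multiset.cons_add] at h
  exact add_right_cancel h

end HL.Hypergraph

/-! ### Replacement corresponds to plugging databases into patterns and contexts. -/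

namespace ModeSystem

open HL HL.Hypergraph

variable {Pr : Type u} [Ranked Pr] {S : ModeSystem Pr}

theorem Tree.pairDb {V : Type} {r : Bool} {i : S.I} {v p q : V} {a : List V} {N : Multiset V}
    {E₁ E₂ : Multiset (Formula Pr × List V)} {W₁ W₂ : Multiset V} {X Y : S.Db}
    (hA : S.AttSide r i v p q a N) (h1 : S.Tree p E₁ W₁ X) (h2 : S.Tree q E₂ W₂ Y) :
    S.Tree v ((.prim i.1, a) ::ₘ (E₁ + E₂)) (N + (W₁ + W₂)) (S.pairDb r i X Y) := by
  cases r
  · rw [add_comm E₁, add_comm W₁]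
    exact .pair hA h2 h1
  · exact .pair hA h1 h2

namespace Represents

variable {G : HL.Hypergraph (Formula Pr)} {X : S.Db}

theorem exists_tree (h : S.Represents G X) :
    ∃ v, G.ext = [v] ∧ S.Tree v G.edges G.inner X := by
  obtain ⟨v, W, he, hV, hT⟩ := h
  refine ⟨v, he, ?_⟩
  rwa [inner_eq (W := W) (by rw [hV, he]; rfl)]

theorem ext_nodup (h : S.Represents G X) : G.ext.Nodup := by
  obtain ⟨v, W, he, -⟩ := h
  simp [he]

theorem ext_length (h : S.Represents G X) : G.ext.length = 1 := by
  obtain ⟨v, W, he, -⟩ := h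
  simp [he]

theorem handle (A : S.Fm) : S.Represents (HL.Hypergraph.handle (S.mu A)) (.form A) := by
  obtain ⟨h1, h2, h3⟩ := (Iso.refl (HL.Hypergraph.handle (S.mu A))).handle
  rw [rk_mu, List.length_eq_one_iff] at h3
  obtain ⟨v, hv⟩ := h3
  refine ⟨v, 0, hv, ?_, ?_⟩
  · rw [h1, hv]
    rfl
  · rw [h2, hv]
    exact .form v A

/-- Grafting a hypergraph at a leaf. -/
theorem graft {H M : HL.Hypergraph (Formula Pr)} {e : H.E} {v x : H.V}
    {E₀ : Multiset (Formula Pr × List H.V)} {W₀ : Multiset H.V}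
    {Δ : NLM.Ctx {p : Pr // Ranked.rk p = 1} S.I S.J} {Z : S.Db} (hatt : H.att e = [x])
    (hext : H.ext = [v]) (hV : H.nodes = v ::ₘ W₀) (hE : H.edges = E₀ + {(H.lab e, [x])})
    (hΔ : Tree.IsCtx S v x E₀ W₀ Δ) (hM : S.Represents M Z) :
    S.Represents (H.replaceOne e M) (Δ.plug Z) := by
  obtain ⟨y, W, he, hVM, hT⟩ := hM
  refine ⟨oneHost H e M v, W₀.map (oneHost H e M) + W.map (onePart H e M), ?_, ?_, ?_⟩
  · rw [replaceOne_ext, hext]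
    rfl
  · rw [nodes_replaceOne hatt he hVM, hV, Multiset.map_cons, Multiset.cons_add]
  · have h1 := edges_replaceOne (G := H) (e := e) (H := M)
    rw [hE, hatt, Multiset.map_add, Multiset.map_singleton, add_right_comm] at h1
    rw [add_right_cancel h1]
    refine hΔ _ ?_
    rw [oneHost_eq hatt he]
    exact hT.map _

theorem exists_att {H : HL.Hypergraph (Formula Pr)} {e : H.E} {A : S.Fm} (he : H.lab e = S.mu A) :
    ∃ x, H.att e = [x] := by
  rw [← List.length_eq_one_iff, ← H.rk_lab e, he, rk_mu]

/-- From a hyperedge to a place in the database; the formula found there is known only up to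
translation. -/
theorem exists_plug {H : HL.Hypergraph (Formula Pr)} (h : S.Represents H X) {e : H.E} {A : S.Fm}
    (he : H.lab e = S.mu A) : ∃ Δ A', X = NLM.Ctx.plug Δ (.form A') ∧ S.mu A' = S.mu A ∧
      ∀ M Z, S.Represents M Z → S.Represents (H.replaceOne e M) (Δ.plug Z) := by
  obtain ⟨v, W, hext, hV, hT⟩ := h
  obtain ⟨x, hx⟩ := exists_att he
  obtain ⟨Δ, A', E₀, rfl, hA, hE, hΔ⟩ := hT.exists_plug_form (hV ▸ H.nodup_nodes)
    (mem_edges.2 ⟨e, by rw [he, hx]⟩)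
  exact ⟨Δ, A', rfl, hA, fun M Z hM => graft hx hext hV (he ▸ hE) hΔ hM⟩

/-- From a place in the database to a hyperedge; here the label is the translation of the given
formula. -/
theorem exists_edge {H : HL.Hypergraph (Formula Pr)}
    {Δ : NLM.Ctx {p : Pr // Ranked.rk p = 1} S.I S.J} {A : S.Fm}
    (h : S.Represents H (Δ.plug (.form A))) : ∃ e, H.lab e = S.mu A ∧
      ∀ M Z, S.Represents M Z → S.Represents (H.replaceOne e M) (Δ.plug Z) := by
  obtain ⟨v, W, hext, hV, hT⟩ := h
  obtain ⟨x, E₀, W₀, E₁, W₁, h1, hE, hW, hΔ⟩ := hT.exists_of_plug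
  cases h1
  rw [add_zero] at hW
  subst hW
  obtain ⟨e, he⟩ := mem_edges.1 (hE ▸ Multiset.mem_add.2 (.inr (Multiset.mem_singleton_self _)))
  have he1 : H.lab e = S.mu A := congrArg Prod.fst he
  have he2 : H.att e = [x] := congrArg Prod.snd he
  exact ⟨e, he1, fun M Z hM => graft he2 hext hV (he1 ▸ hE) hΔ hM⟩

end Represents

theorem IsPat.edges {M : HL.Hypergraph (Formula Pr)} {i : S.I} {A B : Formula Pr}
    (h : S.IsPat M i A B) : ∃ v y z a N, S.Att i v y z a N ∧ M.nodes = v ::ₘ N ∧ M.ext = [v] ∧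
      M.edges = (.prim i.1, a) ::ₘ ({(A, [y])} + {(B, [z])}) := by
  obtain ⟨v, y, z, a, N, τ, hA, hV, he, ⟨l0, a0⟩, ⟨l1, a1⟩, ⟨l2, a2⟩⟩ := h
  refine ⟨v, y, z, a, N, hA, hV, he, ?_⟩
  rw [Hypergraph.edges, ← msum_equiv τ, msum_fin_three, l0, a0, l1, a1, l2, a2]
  rfl

theorem IsUPat.edges {M : HL.Hypergraph (Formula Pr)} {j : S.J} {A : Formula Pr}
    (h : S.IsUPat M j A) : ∃ v y, M.nodes = {v, y} ∧ M.ext = [v] ∧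
      M.edges = (.prim j.1, [v, y]) ::ₘ {(A, [y])} := by
  obtain ⟨v, y, τ, hV, he, ⟨l0, a0⟩, ⟨l1, a1⟩⟩ := h
  refine ⟨v, y, hV, he, ?_⟩
  rw [Hypergraph.edges, ← msum_equiv τ, msum_fin_two, l0, a0, l1, a1]
  rfl

theorem IsPat.represents {M : HL.Hypergraph (Formula Pr)} {i : S.I} {A B : S.Fm}
    (h : S.IsPat M i (S.mu A) (S.mu B)) : S.Represents M (.pair i (.form A) (.form B)) := by
  obtain ⟨v, y, z, a, N, hA, hV, he, hE⟩ := h.edges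
  refine ⟨v, N, he, hV, ?_⟩
  rw [hE]
  simpa using Tree.pair hA (.form y A) (.form z B)

theorem IsUPat.represents {M : HL.Hypergraph (Formula Pr)} {j : S.J} {A : S.Fm}
    (h : S.IsUPat M j (S.mu A)) : S.Represents M (.bracket j (.form A)) := by
  obtain ⟨v, y, hV, he, hE⟩ := h.edges
  refine ⟨v, {y}, he, hV, ?_⟩
  rw [hE]
  exact Tree.bracket v (.form y A)

/-- A handle has no inner nodes and one hyperedge on its external nodes, so replacing the mode
hyperedge by its handle changes nothing, while the argument trees are glued at `y` and `z`. -/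
theorem IsPat.represents_replaceAll {M : HL.Hypergraph (Formula Pr)} {i : S.I} {A B : Formula Pr}
    (h : S.IsPat M i A B) : ∃ τ : Fin 3 ≃ M.E,
      (M.lab (τ 0) = .prim i.1 ∧ M.lab (τ 1) = A ∧ M.lab (τ 2) = B) ∧
      ∀ (H : M.E → HL.Hypergraph (Formula Pr)) (X Y : S.Db),
        (H (τ 0)).Iso (HL.Hypergraph.handle (.prim i.1)) → S.Represents (H (τ 1)) X →
        S.Represents (H (τ 2)) Y → S.Represents (M.replaceAll H) (.pair i X Y) := by
  obtain ⟨v, y, z, a, N, τ, hA, hV, he, ⟨l0, a0⟩, ⟨l1, a1⟩, ⟨l2, a2⟩⟩ := h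
  refine ⟨τ, ⟨l0, l1, l2⟩, fun H X Y h0 h1 h2 => ?_⟩
  change S.Represents (M.replace (Function.Embedding.refl _) H) _
  obtain ⟨y', hy', t1⟩ := h1.exists_tree
  obtain ⟨z', hz', t2⟩ := h2.exists_tree
  obtain ⟨-, e0, len0⟩ := h0.handle
  have hlen : ∀ e, (H e).ext.length = (M.att e).length := by
    rw [τ.surjective.forall]
    intro k
    fin_cases k
    · exact len0.trans ((congrArg Ranked.rk l0).symm.trans (M.rk_lab (τ 0)))
    · exact (congrArg List.length hy').trans (congrArg List.length a1).symm
    · exact (congrArg List.length hz').trans (congrArg List.length a2).symm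
  have hnd : ∀ e, (H e).ext.Nodup := by
    rw [τ.surjective.forall]
    intro k
    fin_cases k
    · exact h0.handle_inner.1
    · exact h1.ext_nodup
    · exact h2.ext_nodup
  have hmap := map_inPart_ext (G := M) (m := Function.Embedding.refl _) hlen
  have hnode := nodes_replace_inner (G := M) (m := Function.Embedding.refl _) hlen hnd
  rw [← msum_equiv τ, msum_fin_three, h0.handle_inner.2, Multiset.map_zero, zero_add] at hnode
  have hedge := edges_replaceAll (H := H)
  rw [← msum_equiv τ, msum_fin_three, e0, Multiset.map_singleton, rename_mk, hmap, add_assoc,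
    Multiset.singleton_add] at hedge
  have hy := hmap (τ 1)
  have hz := hmap (τ 2)
  change _ = (M.att (τ 1)).map _ at hy
  change _ = (M.att (τ 2)).map _ at hz
  change _ = (_, (M.att (τ 0)).map _) ::ₘ _ at hedge
  rw [hy', a1] at hy
  rw [hz', a2] at hz
  rw [a0] at hedge
  simp only [List.map_cons, List.map_nil, List.cons.injEq, and_true] at hy hz
  have t1' := t1.map (inPart M (Function.Embedding.refl _) H (τ 1))
  have t2' := t2.map (inPart M (Function.Embedding.refl _) H (τ 2))
  rw [hy] at t1'
  rw [hz] at t2'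
  have hT := Tree.pair (hA.map (inHost M _ H)) t1' t2'
  rw [← hedge] at hT
  refine ⟨_, _, congrArg (List.map _) he, hnode.trans ?_, hT⟩
  rw [hV, Multiset.map_cons, Multiset.cons_add]
  rfl

theorem IsUPat.represents_replaceAll {M : HL.Hypergraph (Formula Pr)} {j : S.J} {A : Formula Pr}
    (h : S.IsUPat M j A) : ∃ τ : Fin 2 ≃ M.E,
      (M.lab (τ 0) = .prim j.1 ∧ M.lab (τ 1) = A) ∧
      ∀ (H : M.E → HL.Hypergraph (Formula Pr)) (X : S.Db),
        (H (τ 0)).Iso (HL.Hypergraph.handle (.prim j.1)) → S.Represents (H (τ 1)) X →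
        S.Represents (M.replaceAll H) (.bracket j X) := by
  obtain ⟨v, y, τ, hV, he, ⟨l0, a0⟩, ⟨l1, a1⟩⟩ := h
  refine ⟨τ, ⟨l0, l1⟩, fun H X h0 h1 => ?_⟩
  change S.Represents (M.replace (Function.Embedding.refl _) H) _
  obtain ⟨y', hy', t1⟩ := h1.exists_tree
  obtain ⟨-, e0, len0⟩ := h0.handle
  have hlen : ∀ e, (H e).ext.length = (M.att e).length := by
    rw [τ.surjective.forall]
    intro k
    fin_cases k
    · exact len0.trans ((congrArg Ranked.rk l0).symm.trans (M.rk_lab (τ 0)))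
    · exact (congrArg List.length hy').trans (congrArg List.length a1).symm
  have hnd : ∀ e, (H e).ext.Nodup := by
    rw [τ.surjective.forall]
    intro k
    fin_cases k
    · exact h0.handle_inner.1
    · exact h1.ext_nodup
  have hmap := map_inPart_ext (G := M) (m := Function.Embedding.refl _) hlen
  have hnode := nodes_replace_inner (G := M) (m := Function.Embedding.refl _) hlen hnd
  rw [← msum_equiv τ, msum_fin_two, h0.handle_inner.2, Multiset.map_zero, zero_add] at hnode
  have hedge := edges_replaceAll (H := H)
  rw [← msum_equiv τ, msum_fin_two, e0, Multiset.map_singleton, rename_mk, hmap,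
    Multiset.singleton_add] at hedge
  have hy := hmap (τ 1)
  change _ = (M.att (τ 1)).map _ at hy
  change _ = (_, (M.att (τ 0)).map _) ::ₘ _ at hedge
  rw [hy', a1] at hy
  rw [a0] at hedge
  simp only [List.map_cons, List.map_nil, List.cons.injEq, and_true] at hy
  have t1' := t1.map (inPart M (Function.Embedding.refl _) H (τ 1))
  rw [hy] at t1'
  have hT := Tree.bracket (j := j) (inHost M _ H v) t1'
  rw [List.map_cons, List.map_cons, List.map_nil] at hedge
  rw [← hedge] at hT
  refine ⟨_, _, congrArg (List.map _) he, hnode.trans ?_, hT⟩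
  rw [hV, Multiset.insert_eq_cons, Multiset.map_cons, Multiset.map_singleton, Multiset.cons_add,
    Multiset.singleton_add]
  rfl

theorem IsHole.represents_replace {r : Bool} {D : HoleGraph (Formula Pr)} {i : S.I}
    {B : Formula Pr} (h : S.IsHole r D i B) : ∃ τ : Fin 2 ≃ D.E,
      (D.lab (τ 0) = .prim i.1 ∧ D.lab (τ 1) = B) ∧
      ∀ (l : Formula Pr) (hl : Ranked.rk l = D.hole.length)
        (K : D.E → HL.Hypergraph (Formula Pr)) (X : S.Db) (F : S.Fm),
        (K (τ 0)).Iso (HL.Hypergraph.handle (.prim i.1)) → S.Represents (K (τ 1)) X →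
        S.mu F = l → S.Represents ((D.fill l hl).replace (fillEmb D l hl) K)
          (S.pairDb r i X (.form F)) := by
  obtain ⟨v, p, q, a, N, τ, hA, hV, he, hh, ⟨l0, a0⟩, ⟨l1, a1⟩⟩ := h
  refine ⟨τ, ⟨l0, l1⟩, fun l hl K X F h0 h1 hF => ?_⟩
  subst hF
  obtain ⟨p', hp', t1⟩ := h1.exists_tree
  obtain ⟨-, e0, len0⟩ := h0.handle
  have hlen : ∀ d, (K d).ext.length = (D.att d).length := by
    rw [τ.surjective.forall]
    intro k
    fin_cases k
    · exact len0.trans ((congrArg Ranked.rk l0).symm.trans (D.rk_lab (τ 0)))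
    · exact (congrArg List.length hp').trans (congrArg List.length a1).symm
  have hnd : ∀ d, (K d).ext.Nodup := by
    rw [τ.surjective.forall]
    intro k
    fin_cases k
    · exact h0.handle_inner.1
    · exact h1.ext_nodup
  have hmap := map_inPart_ext (G := D.fill (S.mu F) hl) (m := fillEmb D (S.mu F) hl) hlen
  have hnode := nodes_replace_inner (G := D.fill (S.mu F) hl) (m := fillEmb D (S.mu F) hl)
    hlen hnd
  rw [← msum_equiv τ, msum_fin_two, h0.handle_inner.2, Multiset.map_zero, zero_add] at hnode
  have hedge := edges_fill_replace (D := D) (a := S.mu F) (ha := hl) (K := K)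
  rw [← msum_equiv τ, msum_fin_two, e0, Multiset.map_singleton, rename_mk, hmap,
    Multiset.singleton_add, hh] at hedge
  have hy := hmap (τ 1)
  change _ = (D.att (τ 1)).map _ at hy
  change _ = _ ::ₘ (_, (D.att (τ 0)).map _) ::ₘ _ at hedge
  rw [hp', a1] at hy
  change [inPart (D.fill (S.mu F) hl) (fillEmb D (S.mu F) hl) K (τ 1) p'] =
    [inHost (D.fill (S.mu F) hl) (fillEmb D (S.mu F) hl) K p] at hy
  rw [a0] at hedge
  simp only [List.cons.injEq, and_true] at hy
  have t1' := t1.map (inPart (D.fill (S.mu F) hl) (fillEmb D (S.mu F) hl) K (τ 1))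
  rw [hy] at t1'
  have hT := Tree.pairDb (hA.map (inHost (D.fill (S.mu F) hl) (fillEmb D (S.mu F) hl) K)) t1'
    (.form _ F)
  rw [Multiset.cons_swap, ← Multiset.singleton_add (S.mu F, _), add_comm {_}] at hedge
  refine ⟨_, _, congrArg (List.map _) he, hnode.trans ?_, (congrArg
    (fun E => S.Tree _ E _ _) hedge).mpr hT⟩
  refine (congrArg (· + _) ((congrArg (Multiset.map _) hV).trans (Multiset.map_cons _ v N))).trans ?_
  simp only [add_zero]
  exact Multiset.cons_add _ _ _

theorem IsUHole.represents_replace {D : HoleGraph (Formula Pr)} {j : S.J}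
    (h : S.IsUHole D j) : ∃ τ : Fin 1 ≃ D.E, D.lab (τ 0) = .prim j.1 ∧
      ∀ (l : Formula Pr) (hl : Ranked.rk l = D.hole.length)
        (K : D.E → HL.Hypergraph (Formula Pr)) (F : S.Fm),
        (K (τ 0)).Iso (HL.Hypergraph.handle (.prim j.1)) →
        S.mu F = l → S.Represents ((D.fill l hl).replace (fillEmb D l hl) K)
          (.bracket j (.form F)) := by
  obtain ⟨v, y, τ, hV, he, hh, ⟨l0, a0⟩⟩ := h
  refine ⟨τ, l0, fun l hl K F h0 hF => ?_⟩
  subst hF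
  obtain ⟨-, e0, len0⟩ := h0.handle
  have hlen : ∀ d, (K d).ext.length = (D.att d).length := by
    rw [τ.surjective.forall]
    intro k
    fin_cases k
    exact len0.trans ((congrArg Ranked.rk l0).symm.trans (D.rk_lab (τ 0)))
  have hnd : ∀ d, (K d).ext.Nodup := by
    rw [τ.surjective.forall]
    intro k
    fin_cases k
    exact h0.handle_inner.1
  have hmap := map_inPart_ext (G := D.fill (S.mu F) hl) (m := fillEmb D (S.mu F) hl) hlen
  have hnode := nodes_replace_inner (G := D.fill (S.mu F) hl) (m := fillEmb D (S.mu F) hl)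
    hlen hnd
  rw [← msum_equiv τ, msum_fin_one, h0.handle_inner.2, Multiset.map_zero, add_zero] at hnode
  have hedge := edges_fill_replace (D := D) (a := S.mu F) (ha := hl) (K := K)
  rw [← msum_equiv τ, msum_fin_one, e0, Multiset.map_singleton, rename_mk, hmap, hh] at hedge
  change _ = _ ::ₘ {(_, (D.att (τ 0)).map _)} at hedge
  rw [a0] at hedge
  have hT := Tree.bracket (j := j)
    (inHost (D.fill (S.mu F) hl) (fillEmb D (S.mu F) hl) K v)
    (.form (inHost (D.fill (S.mu F) hl) (fillEmb D (S.mu F) hl) K y) F)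
  rw [← Multiset.singleton_add, add_comm] at hT
  refine ⟨_, _, congrArg (List.map _) he, hnode.trans ?_, (congrArg
    (fun E => S.Tree _ E _ _) hedge).mpr hT⟩
  exact congrArg (fun s => Multiset.map _ s) hV

/-! ### The hypergraph of a database represents it -/

/-- The labels `l₁` and `l₂` are arbitrary: the hyperedges carrying them occur on both sides of the
identity for replacement and cancel. This is why the labels used in `htree` do not matter. -/
theorem represents_replace_pair {M : HL.Hypergraph (Formula Pr)} {i : S.I} {l₁ l₂ : Formula Pr}
    {v y z : M.V} {a : List M.V} {N : Multiset M.V} (hA : S.Att i v y z a N)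
    (hV : M.nodes = v ::ₘ N) (he : M.ext = [v])
    (hE : M.edges = (.prim i.1, a) ::ₘ ({(l₁, [y])} + {(l₂, [z])})) {m : Fin 2 ↪ M.E}
    (hm0 : M.lab (m 0) = l₁ ∧ M.att (m 0) = [y]) (hm1 : M.lab (m 1) = l₂ ∧ M.att (m 1) = [z])
    {H : Fin 2 → HL.Hypergraph (Formula Pr)} {X Y : S.Db} (h0 : S.Represents (H 0) X)
    (h1 : S.Represents (H 1) Y) : S.Represents (M.replace m H) (.pair i X Y) := by
  obtain ⟨y', hy', t1⟩ := h0.exists_tree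
  obtain ⟨z', hz', t2⟩ := h1.exists_tree
  have hlen : ∀ k, (H k).ext.length = (M.att (m k)).length := by
    intro k
    fin_cases k
    · exact (congrArg List.length hy').trans (congrArg List.length hm0.2).symm
    · exact (congrArg List.length hz').trans (congrArg List.length hm1.2).symm
  have hnd : ∀ k, (H k).ext.Nodup := by
    intro k
    fin_cases k
    · exact h0.ext_nodup
    · exact h1.ext_nodup
  have hmap := map_inPart_ext hlen
  have hnode := nodes_replace_inner hlen hnd
  have hedge := edges_replace (G := M) (m := m) (H := H)
  have hy := hmap 0
  have hz := hmap 1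
  rw [msum_fin_two] at hnode
  rw [msum_fin_two, msum_fin_two, hE, hm0.1, hm0.2, hm1.1, hm1.2, Multiset.map_cons,
    Multiset.map_add, Multiset.map_singleton, Multiset.map_singleton, Multiset.cons_add,
    add_comm ({_} + {_}), ← Multiset.cons_add] at hedge
  have hedge := add_right_cancel hedge
  rw [hy', hm0.2] at hy
  rw [hz', hm1.2] at hz
  simp only [List.map_cons, List.map_nil, List.cons.injEq, and_true] at hy hz
  have t1' := t1.map (inPart M m H 0)
  have t2' := t2.map (inPart M m H 1)
  rw [hy] at t1'
  rw [hz] at t2'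
  have hT := Tree.pair (hA.map (inHost M m H)) t1' t2'
  refine ⟨_, _, congrArg (List.map _) he, hnode.trans ?_, (congrArg
    (fun E => S.Tree _ E _ _) hedge).mpr hT⟩
  rw [hV, Multiset.map_cons, Multiset.cons_add]
  rfl

theorem represents_replaceOne_bracket {M H : HL.Hypergraph (Formula Pr)} {j : S.J}
    {l : Formula Pr} {v y : M.V} (hV : M.nodes = {v, y}) (he : M.ext = [v])
    (hE : M.edges = (.prim j.1, [v, y]) ::ₘ {(l, [y])}) {e : M.E} (hl : M.lab e = l)
    (ha : M.att e = [y]) {X : S.Db} (h : S.Represents H X) :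
    S.Represents (M.replaceOne e H) (.bracket j X) := by
  obtain ⟨y', W, hy', hVH, t⟩ := h
  have hnode := nodes_replaceOne ha hy' hVH
  have hedge := edges_replaceOne (G := M) (e := e) (H := H)
  rw [hE, hl, ha, Multiset.map_cons, Multiset.map_singleton, Multiset.cons_add,
    add_comm {_}, ← Multiset.cons_add] at hedge
  have hedge := add_right_cancel hedge
  have t' := t.map (onePart M e H)
  rw [← oneHost_eq ha hy'] at t'
  have hT := Tree.bracket (j := j) (oneHost M e H v) t'
  refine ⟨_, _, congrArg (List.map _) he, hnode.trans ?_, (congrArg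
    (fun E => S.Tree _ E _ _) hedge).mpr hT⟩
  rw [hV, Multiset.insert_eq_cons, Multiset.map_cons, Multiset.map_singleton, Multiset.cons_add,
    Multiset.singleton_add]
  rfl

theorem represents_htree (X : S.Db) : S.Represents (S.htree X) X := by
  induction X with
  | form A => exact Represents.handle A
  | pair i X Y hX hY =>
    by_cases h : i ∈ S.C
    · simp only [htree, dif_pos h]
      exact represents_replace_pair
        (M := K (.prim i.1) (dummy Pr).1 (dummy Pr).1 (S.rk_comm i h) (dummy Pr).2 (dummy Pr).2)
        (v := (0 : Fin 2)) (y := (1 : Fin 2)) (z := (1 : Fin 2)) (.inr ⟨h, rfl, rfl, rfl⟩)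
        (msum_fin_two _) rfl ((msum_fin_three _).trans (add_assoc _ _ _)) ⟨rfl, rfl⟩ ⟨rfl, rfl⟩
        hX hY
    · simp only [htree, dif_neg h]
      exact represents_replace_pair
        (M := R (.prim i.1) (dummy Pr).1 (dummy Pr).1 (S.rk_mode i h) (dummy Pr).2 (dummy Pr).2)
        (v := (0 : Fin 3)) (y := (1 : Fin 3)) (z := (2 : Fin 3)) (.inl ⟨h, rfl, rfl⟩)
        ((msum_fin_three _).trans (add_assoc _ _ _)) rfl
        ((msum_fin_three _).trans (add_assoc _ _ _)) ⟨rfl, rfl⟩ ⟨rfl, rfl⟩ hX hY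
  | bracket j X hX =>
    simp only [htree]
    exact represents_replaceOne_bracket
      (M := U (.prim j.1) (dummy Pr).1 (S.rk_modality j) (dummy Pr).2)
      (v := (0 : Fin 2)) (y := (1 : Fin 2)) (msum_fin_two _) rfl (msum_fin_two _)
      (e := (1 : Fin 2)) rfl rfl hX

/-- Once filled, the hole is one more argument hyperedge, so the result has the shape of an ordinary
pattern, with the argument and the filled hole at `p` and `q`. -/
theorem IsHole.fill {r : Bool} {D : HoleGraph (Formula Pr)} {i : S.I} {B : Formula Pr}
    (h : S.IsHole r D i B) (l : Formula Pr) (hl : Ranked.rk l = D.hole.length) :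
    ∃ (v p q : (D.fill l hl).V) (a : List (D.fill l hl).V) (N : Multiset (D.fill l hl).V)
      (e : (D.fill l hl).E), e = none ∧ S.AttSide r i v p q a N ∧ (D.fill l hl).nodes = v ::ₘ N ∧
      (D.fill l hl).ext = [v] ∧ (D.fill l hl).lab e = l ∧ (D.fill l hl).att e = [q] ∧
      (D.fill l hl).edges = (.prim i.1, a) ::ₘ ({(B, [p])} + {(l, [q])}) := by
  obtain ⟨v, p, q, a, N, τ, hA, hV, he, hh, ⟨l0, a0⟩, ⟨l1, a1⟩⟩ := h
  refine ⟨v, p, q, a, N, none, rfl, hA, hV, he, rfl, hh, edges_fill.trans ?_⟩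
  rw [← msum_equiv τ, msum_fin_two, l0, a0, l1, a1, hh, Multiset.singleton_add,
    Multiset.cons_swap]
  exact congrArg (Multiset.cons _) (Multiset.cons_swap _ _ _)

theorem IsUHole.fill {D : HoleGraph (Formula Pr)} {j : S.J}
    (h : S.IsUHole D j) (l : Formula Pr) (hl : Ranked.rk l = D.hole.length) :
    ∃ (v y : (D.fill l hl).V) (e : (D.fill l hl).E), e = none ∧ (D.fill l hl).nodes = {v, y} ∧
      (D.fill l hl).ext = [v] ∧ (D.fill l hl).lab e = l ∧ (D.fill l hl).att e = [y] ∧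
      (D.fill l hl).edges = (.prim j.1, [v, y]) ::ₘ {(l, [y])} := by
  obtain ⟨v, y, τ, hV, he, hh, ⟨l0, a0⟩⟩ := h
  refine ⟨v, y, none, rfl, hV, he, rfl, hh, edges_fill.trans ?_⟩
  rw [← msum_equiv τ, msum_fin_one, l0, a0, hh]
  exact Multiset.cons_swap _ _ _

theorem IsHole.represents_replaceOne {r : Bool} {D : HoleGraph (Formula Pr)} {i : S.I} {B : S.Fm}
    (h : S.IsHole r D i (S.mu B)) (l : Formula Pr) (hl : Ranked.rk l = D.hole.length)
    {G : HL.Hypergraph (Formula Pr)} {X : S.Db} (hG : S.Represents G X) :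
    S.Represents ((D.fill l hl).replaceOne none G) (S.pairDb r i (.form B) X) := by
  obtain ⟨v, p, q, a, N, e, he', hA, hV, he, hle, hae, hE⟩ := h.fill l hl
  rw [← he']
  obtain ⟨q', W, hq', hVG, t⟩ := hG
  have hnode := nodes_replaceOne hae hq' hVG
  have hedge := edges_replaceOne (G := D.fill l hl) (e := e) (H := G)
  rw [hE, hle, hae, Multiset.map_cons, Multiset.map_add, Multiset.map_singleton,
    Multiset.map_singleton, Multiset.cons_add, add_right_comm, ← Multiset.cons_add] at hedge
  have hedge := add_right_cancel hedge
  have t' := t.map (onePart (D.fill l hl) e G)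
  rw [← oneHost_eq hae hq'] at t'
  have hT := Tree.pairDb (hA.map (oneHost (D.fill l hl) e G)) (.form _ B) t'
  refine ⟨_, _, congrArg (List.map _) he, hnode.trans ?_, (congrArg
    (fun E => S.Tree _ E _ _) hedge).mpr hT⟩
  rw [hV, Multiset.map_cons, Multiset.cons_add, zero_add]
  rfl

theorem IsUHole.represents_replaceOne {D : HoleGraph (Formula Pr)} {j : S.J}
    (h : S.IsUHole D j) (l : Formula Pr) (hl : Ranked.rk l = D.hole.length)
    {G : HL.Hypergraph (Formula Pr)} {X : S.Db} (hG : S.Represents G X) :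
    S.Represents ((D.fill l hl).replaceOne none G) (.bracket j X) := by
  obtain ⟨v, y, e, he', hV, he, hle, hae, hE⟩ := h.fill l hl
  rw [← he']
  exact represents_replaceOne_bracket hV he hE hle hae hG

/-! ### From the multimodal calculus to the hypergraph calculus -/

theorem Represents.derivable {G G' : HL.Hypergraph (Formula Pr)} {X : S.Db} {T : Formula Pr}
    (hG : S.Represents G X) (hG' : S.Represents G' X) (h : HL.Derivable G T) :
    HL.Derivable G' T := .iso (hG.iso hG') h

theorem Tree.of_plug_mono {Δ : NLM.Ctx {p : Pr // Ranked.rk p = 1} S.I S.J} {X Y : S.Db}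
    (h : ∀ (V : Type) (v : V) E W, S.Tree v E W X → S.Tree v E W Y) {V : Type} {v : V}
    {E : Multiset (Formula Pr × List V)} {W : Multiset V} (hX : S.Tree v E W (Δ.plug X)) :
    S.Tree v E W (Δ.plug Y) := by
  obtain ⟨x, E₀, W₀, E₁, W₁, h1, rfl, rfl, h2⟩ := hX.exists_of_plug
  have := h2 id (h _ _ _ _ h1)
  rwa [rename_id, Multiset.map_id, Multiset.map_id] at this

theorem Tree.swap {c : S.I} (hc : c ∈ S.C) {X Y : S.Db} {V : Type} {v : V}
    {E : Multiset (Formula Pr × List V)} {W : Multiset V} (h : S.Tree v E W (.pair c X Y)) :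
    S.Tree v E W (.pair c Y X) := by
  cases h with
  | @pair _ _ _ _ _ N E₁ E₂ W₁ W₂ _ _ hA h1 h2 =>
    rw [add_comm E₁, add_comm W₁]
    refine .pair ?_ h2 h1
    rcases hA with ⟨hi, -⟩ | ⟨-, rfl, rfl, rfl⟩
    · exact absurd hc hi
    · exact .inr ⟨hc, rfl, rfl, rfl⟩

/-- The rule is applied to the hypergraph of `Δ[A]`, with a handle above the mode and `htree X`
above the argument. The conclusion represents the required database, and isomorphism carries
derivability to any other representing hypergraph. -/
theorem derivable_divL {r : Bool} {i : S.I} {X : S.Db} {A B T : S.Fm}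
    {Δ : NLM.Ctx {p : Pr // Ranked.rk p = 1} S.I S.J}
    (ih : ∀ G, S.Represents G (Δ.plug (.form A)) → HL.Derivable G (S.mu T))
    (ih' : ∀ G, S.Represents G X → HL.Derivable G (S.mu B)) {G : HL.Hypergraph (Formula Pr)}
    (hG : S.Represents G (Δ.plug (S.pairDb r i X (.form (S.divFm r i B A))))) :
    HL.Derivable G (S.mu T) := by
  obtain ⟨e, he, hgraft⟩ := (represents_htree (Δ.plug (.form A))).exists_edge
  obtain ⟨D, hD, hmu, hH⟩ := exists_mu_divFm r i B A
  obtain ⟨τ, ⟨l0, l1⟩, hrep⟩ := hH.represents_replace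
  let K : D.E → HL.Hypergraph (Formula Pr) :=
    fun d => ![HL.Hypergraph.handle (.prim i.1), S.htree X] (τ.symm d)
  have hK0 : K (τ 0) = HL.Hypergraph.handle (.prim i.1) := by simp [K]
  have hK1 : K (τ 1) = S.htree X := by simp [K]
  refine Represents.derivable (hgraft _ _ (hrep _ rfl K X _ (hK0 ▸ Iso.refl _)
    (hK1 ▸ represents_htree X) hmu)) hG
    (HL.Derivable.divL _ e _ _ D hD K he (ih _ (represents_htree _)) ?_)
  rw [τ.surjective.forall]
  intro k
  fin_cases k
  · change HL.Derivable (K (τ 0)) (D.lab (τ 0))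
    rw [hK0, l0]
    exact .ax _
  · change HL.Derivable (K (τ 1)) (D.lab (τ 1))
    rw [hK1, l1]
    exact ih' _ (represents_htree X)

theorem derivable_divR {r : Bool} {i : S.I} {X : S.Db} {A B : S.Fm}
    (ih : ∀ G, S.Represents G (S.pairDb r i (.form B) X) → HL.Derivable G (S.mu A))
    {G : HL.Hypergraph (Formula Pr)} (hG : S.Represents G X) :
    HL.Derivable G (S.mu (S.divFm r i B A)) := by
  obtain ⟨D, hD, hmu, hH⟩ := exists_mu_divFm r i B A
  have hrk : Ranked.rk (Formula.div (S.mu A) D hD) = 1 := hmu ▸ rk_mu _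
  rw [hmu]
  exact .divR G _ D hD (hG.ext_length.trans hrk.symm)
    (ih _ (hH.represents_replaceOne _ rfl hG))

/-- Quantifying over all representing hypergraphs lets the left rules for products and diamonds act
inside the given `G`, with no comparison to `htree` at intermediate stages. -/
theorem Der.derivable {X : S.Db} {T : S.Fm} (h : S.Der X T) {G : HL.Hypergraph (Formula Pr)}
    (hG : S.Represents G X) : HL.Derivable G (S.mu T) := by
  induction h generalizing G with
  | ax T => exact Represents.derivable (Represents.handle T) hG (.ax _)
  | prodL Δ i A B U _ ih =>
    obtain ⟨e, he, hgraft⟩ := hG.exists_edge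
    obtain ⟨M, hM, hP⟩ := exists_mu_prod i A B
    exact .timesL G e M _ (he.trans hM) (ih (hgraft _ _ hP.represents))
  | prodR i X Y A B _ _ ihX ihY =>
    obtain ⟨M, hM, hP⟩ := exists_mu_prod i A B
    obtain ⟨τ, ⟨l0, l1, l2⟩, hrep⟩ := hP.represents_replaceAll
    let H : M.E → HL.Hypergraph (Formula Pr) :=
      fun e => ![HL.Hypergraph.handle (.prim i.1), S.htree X, S.htree Y] (τ.symm e)
    have h0 : H (τ 0) = HL.Hypergraph.handle (.prim i.1) := by simp [H]
    have h1 : H (τ 1) = S.htree X := by simp [H]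
    have h2 : H (τ 2) = S.htree Y := by simp [H]
    rw [hM]
    refine Represents.derivable (hrep H X Y (h0 ▸ Iso.refl _) (h1 ▸ represents_htree X)
      (h2 ▸ represents_htree Y)) hG (.timesR M H ?_)
    rw [τ.surjective.forall]
    intro k
    fin_cases k
    · change HL.Derivable (H (τ 0)) (M.lab (τ 0))
      rw [h0, l0]
      exact .ax _
    · change HL.Derivable (H (τ 1)) (M.lab (τ 1))
      rw [h1, l1]
      exact ihX (represents_htree X)
    · change HL.Derivable (H (τ 2)) (M.lab (τ 2))
      rw [h2, l2]
      exact ihY (represents_htree Y)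
  | ldivL Δ i X A B U _ _ ih ih' =>
    exact derivable_divL (r := true) (fun _ => ih) (fun _ => ih') hG
  | rdivL Δ i X A B U _ _ ih ih' =>
    exact derivable_divL (r := false) (fun _ => ih) (fun _ => ih') hG
  | ldivR i X A B _ ih => exact derivable_divR (r := true) (fun _ => ih) hG
  | rdivR i X A B _ ih => exact derivable_divR (r := false) (fun _ => ih) hG
  | diaL Δ j A U _ ih =>
    obtain ⟨e, he, hgraft⟩ := hG.exists_edge
    obtain ⟨M, hM, hP⟩ := exists_mu_dia j A
    exact .timesL G e M _ (he.trans hM) (ih (hgraft _ _ hP.represents))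
  | diaR j X A _ ih =>
    obtain ⟨M, hM, hP⟩ := exists_mu_dia j A
    obtain ⟨τ, ⟨l0, l1⟩, hrep⟩ := hP.represents_replaceAll
    let H : M.E → HL.Hypergraph (Formula Pr) :=
      fun e => ![HL.Hypergraph.handle (.prim j.1), S.htree X] (τ.symm e)
    have h0 : H (τ 0) = HL.Hypergraph.handle (.prim j.1) := by simp [H]
    have h1 : H (τ 1) = S.htree X := by simp [H]
    rw [hM]
    refine Represents.derivable (hrep H X (h0 ▸ Iso.refl _) (h1 ▸ represents_htree X)) hG
      (.timesR M H ?_)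
    rw [τ.surjective.forall]
    intro k
    fin_cases k
    · change HL.Derivable (H (τ 0)) (M.lab (τ 0))
      rw [h0, l0]
      exact .ax _
    · change HL.Derivable (H (τ 1)) (M.lab (τ 1))
      rw [h1, l1]
      exact ih (represents_htree X)
  | boxL Δ j A U _ ih =>
    obtain ⟨e, he, hgraft⟩ := (represents_htree (Δ.plug (.form A))).exists_edge
    obtain ⟨D, hD, hmu, hH⟩ := exists_mu_box j A
    obtain ⟨τ, l0, hrep⟩ := hH.represents_replace
    refine Represents.derivable (hgraft _ _ (hrep _ rfl
      (fun _ => HL.Hypergraph.handle (.prim j.1)) _ (Iso.refl _) hmu)) hG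
      (HL.Derivable.divL _ e _ _ D hD _ he (ih (represents_htree _)) ?_)
    rw [τ.surjective.forall]
    intro k
    rw [Subsingleton.elim k 0, l0]
    exact .ax _
  | boxR j X A _ ih =>
    obtain ⟨D, hD, hmu, hH⟩ := exists_mu_box j A
    have hrk : Ranked.rk (Formula.div (S.mu A) D hD) = 1 := hmu ▸ rk_mu _
    rw [hmu]
    exact .divR G _ D hD (hG.ext_length.trans hrk.symm)
      (ih (hH.represents_replaceOne _ rfl hG))
  -- The same `G` represents both databases, so the induction hypothesis already gives the
  -- conclusion.
  | perm Δ c X Y U hc _ ih =>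
    obtain ⟨v, W, hext, hV, hT⟩ := hG
    exact ih ⟨v, W, hext, hV, hT.of_plug_mono fun _ _ _ _ => Tree.swap hc⟩
  | assocL Δ a X Y Z U ha => exact ha.elim
  | assocR Δ a X Y Z U ha => exact ha.elim

/-! ### Recognizing patterns in the hypergraph of a database -/

section

variable {V : Type} {r : Bool} {i : S.I} {v y z : V} {a : List V} {N W W₁ W₂ : Multiset V}
  {E E₁ E₂ : Multiset (Formula Pr × List V)} {X X₁ X₂ : S.Db}

theorem AttSide.nodup (h : S.AttSide r i v y z a N) (hn : (v ::ₘ (N + (W₁ + W₂))).Nodup) :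
    (y ::ₘ W₁).Nodup ∧ (z ::ₘ W₂).Nodup ∧ (∀ u ∈ W₂, u ∉ y ::ₘ W₁) ∧ (i ∉ S.C → y ≠ z) := by
  cases r
  · rw [add_comm W₁] at hn
    obtain ⟨h1, h2, -, -, h3, -, h5, -⟩ := Att.nodup h hn
    exact ⟨h2, h1, h3, fun hi => (h5 hi).symm⟩
  · obtain ⟨h1, h2, -, -, -, h4, h5, -⟩ := Att.nodup h hn
    exact ⟨h1, h2, h4, h5⟩

theorem Tree.eq_pairDb (h : S.Tree v E W X) (hv : v ∉ W) (hA : S.AttSide r i v y z a N)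
    (hr : (.prim i.1, a) ∈ E) :
    ∃ E₁ E₂ W₁ W₂ X₁ X₂, S.Tree y E₁ W₁ X₁ ∧ S.Tree z E₂ W₂ X₂ ∧ X = S.pairDb r i X₁ X₂ ∧
      E = (.prim i.1, a) ::ₘ (E₁ + E₂) ∧ W = N + (W₁ + W₂) := by
  cases r
  · obtain ⟨E₁, E₂, W₁, W₂, X₁, X₂, h1, h2, h3, h4, h5⟩ := h.eq_pair hv hA hr
    exact ⟨E₂, E₁, W₂, W₁, X₂, X₁, h2, h1, h3, by rw [h4, add_comm E₁], by rw [h5, add_comm W₁]⟩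
  · exact h.eq_pair hv hA hr

/-- Two sibling trees, one of which contains a leaf at the root of the first one: either the first
tree is this leaf, or the mode is commutative and the second tree is this leaf. -/
theorem Tree.eq_form_left_or_right (hA : S.AttSide r i v y z a N)
    (hn : (v ::ₘ (N + (W₁ + W₂))).Nodup) (h1 : S.Tree y E₁ W₁ X₁) (h2 : S.Tree z E₂ W₂ X₂)
    {A : S.Fm} {E' : Multiset (Formula Pr × List V)} (hE : E₁ + E₂ = (S.mu A, [y]) ::ₘ E') :
    (∃ A', X₁ = .form A' ∧ S.mu A' = S.mu A ∧ W₁ = 0 ∧ E₂ = E') ∨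
      (i ∈ S.C ∧ z = y ∧ ∃ A', X₂ = .form A' ∧ S.mu A' = S.mu A ∧ W₂ = 0 ∧ E₁ = E') := by
  obtain ⟨n1, n2, d, hyz⟩ := hA.nodup hn
  rcases Multiset.mem_add.1 (hE ▸ Multiset.mem_cons_self _ _ : (S.mu A, [y]) ∈ E₁ + E₂) with h | h
  · left
    obtain ⟨A', rfl, hm, rfl, rfl⟩ := h1.eq_form (Multiset.nodup_cons.1 n1).1 h
    exact ⟨A', rfl, hm, rfl, (Multiset.cons_inj_right _).1 hE⟩
  · right
    have hm := h2.mem_att h (List.mem_singleton_self y)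
    rcases Multiset.mem_cons.1 hm with rfl | hm
    · obtain ⟨A', rfl, hmu, rfl, rfl⟩ := h2.eq_form (Multiset.nodup_cons.1 n2).1 h
      refine ⟨by_contra fun hi => hyz hi rfl, rfl, A', rfl, hmu, rfl, ?_⟩
      rw [add_comm] at hE
      exact (Multiset.cons_inj_right _).1 hE
    · exact absurd (Multiset.mem_cons_self _ _) (d _ hm)

/-- One subtree is the leaf `A`, so all remaining hyperedges belong to the other one. That subtree
contains the leaf `B` at its root and hence is this leaf. -/
theorem Tree.eq_forms (hA : S.Att i v y z a N) (hn : (v ::ₘ (N + (W₁ + W₂))).Nodup)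
    (h1 : S.Tree y E₁ W₁ X₁) (h2 : S.Tree z E₂ W₂ X₂) {A B : S.Fm}
    {E' : Multiset (Formula Pr × List V)}
    (hE : E₁ + E₂ = (S.mu A, [y]) ::ₘ (S.mu B, [z]) ::ₘ E') :
    ∃ A' B', X₁ = .form A' ∧ X₂ = .form B' ∧ ((S.mu A' = S.mu A ∧ S.mu B' = S.mu B) ∨
      (i ∈ S.C ∧ S.mu A' = S.mu B ∧ S.mu B' = S.mu A)) ∧ E' = 0 ∧ W₁ = 0 ∧ W₂ = 0 := by
  obtain ⟨n1, n2, -⟩ := hA.nodup hn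
  rcases Tree.eq_form_left_or_right (r := true) hA hn h1 h2 hE with
    ⟨A', rfl, hm, rfl, rfl⟩ | ⟨hi, rfl, A', rfl, hm, rfl, rfl⟩
  · obtain ⟨B', rfl, hm', hE', rfl⟩ := h2.eq_form (Multiset.nodup_cons.1 n2).1
      (Multiset.mem_cons_self _ _)
    exact ⟨A', B', rfl, rfl, .inl ⟨hm, hm'⟩, (Multiset.cons_inj_right _).1 hE', rfl, rfl⟩
  · obtain ⟨B', rfl, hm', hE', rfl⟩ := h1.eq_form (Multiset.nodup_cons.1 n1).1
      (Multiset.mem_cons_self _ _)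
    exact ⟨B', A', rfl, rfl, .inr ⟨hi, hm', hm⟩, (Multiset.cons_inj_right _).1 hE', rfl, rfl⟩

end

/-- Collapsing the inserted `M` onto `x` is the identity on the host, so it moves the context found
in the replacement back into `H`. Plugging in a leaf there restores the removed hyperedge. -/
theorem represents_of_isCtx {H M : HL.Hypergraph (Formula Pr)} {e : H.E} {x : H.V} {w : M.V}
    (hx : H.att e = [x]) {Eh : Multiset (Formula Pr × List H.V)}
    (hEh : H.edges = (H.lab e, [x]) ::ₘ Eh) {v' : (H.replaceOne e M).V}
    {W₀ : Multiset (H.replaceOne e M).V} (hext : (H.replaceOne e M).ext = [v'])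
    (hV : H.nodes.map (oneHost H e M) = v' ::ₘ W₀)
    {Δ : NLM.Ctx {p : Pr // Ranked.rk p = 1} S.I S.J}
    (hΔ : Tree.IsCtx S v' (onePart H e M w) (Eh.map (rename (oneHost H e M))) W₀ Δ)
    {F : S.Fm} (hF : S.mu F = H.lab e) : S.Represents H (Δ.plug (.form F)) := by
  obtain ⟨ρ, h1, h2⟩ := exists_retraction_host (H := M) hx
  have hρ : ρ ∘ oneHost H e M = id := funext h1
  refine ⟨ρ v', W₀.map ρ, ?_, ?_, ?_⟩
  · rw [replaceOne_ext] at hext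
    have := congrArg (List.map ρ) hext
    rwa [List.map_map, hρ, List.map_id] at this
  · have := congrArg (Multiset.map ρ) hV
    rwa [Multiset.map_map, hρ, Multiset.map_id, Multiset.map_cons] at this
  · have := hΔ ρ (Tree.form _ F)
    rwa [Multiset.map_map, rename_comp, hρ, rename_id, Multiset.map_id, h2, hF, add_zero, add_comm,
      Multiset.singleton_add, ← hEh] at this

/-- The mode hyperedge of `M` must be the top hyperedge of a pair inside the tree. The argument
hyperedges of `M` hang on nodes that the context does not contain, so they lie in the two subtrees
and exhaust them. The hyperedges left for the context are then exactly those of `H` other than `e`.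
-/
theorem IsPat.of_represents {M H : HL.Hypergraph (Formula Pr)} {i : S.I} {A B : S.Fm}
    (hP : S.IsPat M i (S.mu A) (S.mu B)) {e : H.E} {x : H.V} (hx : H.att e = [x]) {X : S.Db}
    (h : S.Represents (H.replaceOne e M) X) :
    ∃ Δ A' B', X = NLM.Ctx.plug Δ (.pair i (.form A') (.form B')) ∧
      ((S.mu A' = S.mu A ∧ S.mu B' = S.mu B) ∨
        (i ∈ S.C ∧ S.mu A' = S.mu B ∧ S.mu B' = S.mu A)) ∧
      ∀ F, S.mu F = H.lab e → S.Represents H (Δ.plug (.form F)) := by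
  obtain ⟨v, y, z, a, N, hA, hVM, heM, hEM⟩ := hP.edges
  obtain ⟨v', W, hext, hVG, hT⟩ := h
  have hn : (v' ::ₘ W).Nodup := hVG ▸ nodup_nodes _
  have hnode := nodes_replaceOne hx heM hVM
  have hedge := edges_replaceOne (G := H) (e := e) (H := M)
  obtain ⟨Eh, hEh⟩ := Multiset.exists_cons_of_mem
    (mem_edges.2 ⟨e, by rw [hx]⟩ : (H.lab e, [x]) ∈ H.edges)
  have hA' := hA.map (onePart H e M)
  rw [hEh, hx, hEM, Multiset.map_cons, Multiset.map_cons, Multiset.map_add, Multiset.map_singleton,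
    Multiset.map_singleton, Multiset.cons_add, add_comm, Multiset.singleton_add] at hedge
  replace hedge := (Multiset.cons_inj_right _).1 hedge
  obtain ⟨Δ, Y, x', E₀, W₀, E₁, W₁, rfl, t, n, hr, hh, hE, hW, hΔ⟩ :=
    hT.exists_plug_of_mem hn (r := (.prim i.1, a.map (onePart H e M)))
      (hedge ▸ Multiset.mem_add.2 (.inr (Multiset.mem_cons_self _ _)))
  obtain rfl : onePart H e M v = x' := Option.some_injective _ (hA'.head.symm.trans hh)
  obtain ⟨E₁, E₂, W₁, W₂, X₁, X₂, t1, t2, rfl, rfl, rfl⟩ :=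
    t.eq_pair (Multiset.nodup_cons.1 n).1 hA' hr
  rw [hE, Multiset.add_cons, Multiset.add_cons] at hedge
  replace hedge := (Multiset.cons_inj_right _).1 hedge
  -- The nodes in `N` are inner nodes of the subtree, and the nodes of the whole tree are distinct.
  have hN : ∀ u ∈ N.map (onePart H e M), u ∉ v' ::ₘ W₀ := by
    intro u hu hu'
    rw [hW, ← add_assoc, ← Multiset.cons_add, ← Multiset.cons_add] at hn
    have := (Multiset.nodup_add.1 (Multiset.nodup_add.1 hn).1).2.2
    exact Multiset.disjoint_left.1 this hu' hu
  -- Plugging in a leaf, which has no inner nodes, shows that all nodes of the context hyperedges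
  -- lie in `v' ::ₘ W₀`.
  have hleaf : ∀ (l : Formula Pr) (u), u ∈ N.map (onePart H e M) → (l, [u]) ∉ E₀ := by
    intro l u hu hl
    exact hN u hu (hΔ.mem_att (.form _ A) hl (List.mem_singleton_self u) (Multiset.notMem_zero _))
  obtain ⟨R₁, hR₁⟩ : ∃ R₁, E₁ + E₂ = (S.mu A, [onePart H e M y]) ::ₘ R₁ := by
    refine Multiset.exists_cons_of_mem ?_
    refine (Multiset.mem_add.1 (?_ : _ ∈ E₀ + (E₁ + E₂))).resolve_left
      (hleaf _ _ hA'.left_mem)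
    rw [hedge]
    simp
  rw [hR₁, Multiset.add_cons, Multiset.singleton_add, rename_mk, rename_mk, List.map_singleton,
    List.map_singleton, Multiset.add_cons] at hedge
  replace hedge := (Multiset.cons_inj_right _).1 hedge
  obtain ⟨R, rfl⟩ : ∃ R, R₁ = (S.mu B, [onePart H e M z]) ::ₘ R := by
    refine Multiset.exists_cons_of_mem ?_
    refine (Multiset.mem_add.1 (?_ : _ ∈ E₀ + R₁)).resolve_left (hleaf _ _ hA'.right_mem)
    rw [hedge]
    simp
  obtain ⟨A', B', rfl, rfl, hAB, rfl, rfl, rfl⟩ := Tree.eq_forms hA' n t1 t2 hR₁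
  refine ⟨Δ, A', B', rfl, hAB, fun F hF => ?_⟩
  rw [Multiset.add_cons, add_zero, add_comm, Multiset.singleton_add] at hedge
  replace hedge := (Multiset.cons_inj_right _).1 hedge
  rw [hedge] at hΔ
  refine represents_of_isCtx hx hEh hext ?_ hΔ hF
  rw [hVG, hW, add_zero, add_zero, ← Multiset.cons_add] at hnode
  exact (add_right_cancel hnode).symm

theorem IsUPat.of_represents {M H : HL.Hypergraph (Formula Pr)} {j : S.J} {A : S.Fm}
    (hP : S.IsUPat M j (S.mu A)) {e : H.E} {x : H.V} (hx : H.att e = [x]) {X : S.Db}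
    (h : S.Represents (H.replaceOne e M) X) :
    ∃ Δ A', X = NLM.Ctx.plug Δ (.bracket j (.form A')) ∧ S.mu A' = S.mu A ∧
      ∀ F, S.mu F = H.lab e → S.Represents H (Δ.plug (.form F)) := by
  obtain ⟨v, y, hVM, heM, hEM⟩ := hP.edges
  obtain ⟨v', W, hext, hVG, hT⟩ := h
  have hn : (v' ::ₘ W).Nodup := hVG ▸ nodup_nodes _
  have hnode := nodes_replaceOne hx heM hVM
  have hedge := edges_replaceOne (G := H) (e := e) (H := M)
  obtain ⟨Eh, hEh⟩ := Multiset.exists_cons_of_mem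
    (mem_edges.2 ⟨e, by rw [hx]⟩ : (H.lab e, [x]) ∈ H.edges)
  rw [hEh, hx, hEM, Multiset.map_cons, Multiset.map_cons, Multiset.map_singleton,
    Multiset.cons_add, add_comm, Multiset.singleton_add] at hedge
  replace hedge := (Multiset.cons_inj_right _).1 hedge
  obtain ⟨Δ, Y, x', E₀, W₀, E₁, W₁, rfl, t, n, hr, hh, hE, hW, hΔ⟩ :=
    hT.exists_plug_of_mem hn (r := (.prim j.1, [onePart H e M v, onePart H e M y]))
      (hedge ▸ Multiset.mem_add.2 (.inr (Multiset.mem_cons_self _ _)))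
  obtain rfl : onePart H e M v = x' := Option.some_injective _ hh
  obtain ⟨E₁, W₁, X₁, t1, rfl, rfl, rfl⟩ := t.eq_bracket (Multiset.nodup_cons.1 n).1 hr
  rw [hE, Multiset.add_cons, Multiset.add_cons] at hedge
  replace hedge := (Multiset.cons_inj_right _).1 hedge
  have hN : onePart H e M y ∉ v' ::ₘ W₀ := by
    intro hu'
    rw [hW, ← Multiset.cons_add] at hn
    exact Multiset.disjoint_left.1 (Multiset.nodup_add.1 hn).2.2 hu' (Multiset.mem_cons_self _ _)
  have hm : (S.mu A, [onePart H e M y]) ∈ E₁ := by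
    refine (Multiset.mem_add.1 (?_ : _ ∈ E₀ + E₁)).resolve_left fun hl => ?_
    · rw [hedge]
      simp
    · exact hN (hΔ.mem_att (.form _ A) hl (List.mem_singleton_self _) (Multiset.notMem_zero _))
  obtain ⟨A', rfl, hA', rfl, rfl⟩ :=
    t1.eq_form (Multiset.nodup_cons.1 (Multiset.nodup_cons.1 n).2).1 hm
  refine ⟨Δ, A', rfl, hA', fun F hF => ?_⟩
  rw [rename_mk, List.map_singleton] at hedge
  rw [add_right_cancel hedge] at hΔ
  refine represents_of_isCtx hx hEh hext ?_ hΔ hF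
  rw [hVG, hW, Multiset.map_singleton, ← Multiset.cons_add] at hnode
  exact (add_right_cancel hnode).symm

/-- Collapsing the host onto the external node of `M` turns a tree made of the hyperedges of `M`
inside the replacement into a tree in `M` itself. -/
theorem represents_part {H M : HL.Hypergraph (Formula Pr)} {e : H.E} {q : H.V} {g : M.V}
    (hg : M.ext = [g]) {X : S.Db} (h : S.Tree (oneHost H e M q)
      (M.edges.map (rename (onePart H e M))) (M.inner.map (onePart H e M)) X) :
    S.Represents M X := by
  obtain ⟨ρ, h1, h2⟩ := exists_retraction_part (G := H) (e := e) hg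
  have hρ : ρ ∘ onePart H e M = id := funext h2
  have := h.map ρ
  rw [Multiset.map_map, Multiset.map_map, rename_comp, hρ, rename_id, Multiset.map_id,
    Multiset.map_id, h1] at this
  refine ⟨g, M.inner, hg, ?_, this⟩
  rw [nodes_eq (by rw [hg]; exact List.nodup_singleton g), hg]
  rfl

theorem nodes_eq_cons_inner {M : HL.Hypergraph (Formula Pr)} {g : M.V} (hg : M.ext = [g]) :
    M.nodes = g ::ₘ M.inner := by
  rw [nodes_eq (by rw [hg]; exact List.nodup_singleton g), hg]
  rfl

/-- The mode hyperedge of the pattern starts at the external node, so `Y` is a pair. The leaf `B` is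
an entire component of it, and the other component consists exactly of `G`. -/
theorem IsHole.of_represents {r : Bool} {D : HoleGraph (Formula Pr)} {i : S.I} {B : S.Fm}
    (h : S.IsHole r D i (S.mu B)) (l : Formula Pr) (hl : Ranked.rk l = D.hole.length)
    {G : HL.Hypergraph (Formula Pr)} (hG : Ranked.rk G = D.hole.length) {Y : S.Db}
    (hY : S.Represents ((D.fill l hl).replaceOne none G) Y) :
    ∃ r' B' X, Y = S.pairDb r' i (.form B') X ∧ S.mu B' = S.mu B ∧ (r' = r ∨ i ∈ S.C) ∧
      S.Represents G X := by
  obtain ⟨v, p, q, a, N, e, he', hA, hV, he, hle, hae, hE⟩ := h.fill l hl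
  have hlen : G.ext.length = 1 := by
    rw [he'] at hae
    exact Eq.trans hG (congrArg List.length hae)
  rw [← he'] at hY
  clear he'
  generalize D.fill l hl = H at *
  obtain ⟨g, hg⟩ := List.length_eq_one_iff.1 hlen
  obtain ⟨v', W, hext, hVG, hT⟩ := hY
  have hn : (v' ::ₘ W).Nodup := hVG ▸ nodup_nodes _
  have hnode := nodes_replaceOne hae hg (nodes_eq_cons_inner hg)
  have hedge := edges_replaceOne (G := H) (e := e) (H := G)
  obtain rfl : oneHost H e G v = v' := by
    rw [replaceOne_ext, he] at hext
    simpa using hext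
  rw [hE, hle, hae, Multiset.map_cons, Multiset.map_add, Multiset.map_singleton,
    Multiset.map_singleton, Multiset.cons_add, add_right_comm, ← Multiset.cons_add] at hedge
  replace hedge := add_right_cancel hedge
  have hA' := hA.map (oneHost H e G)
  obtain ⟨E₁, E₂, W₁, W₂, X₁, X₂, t1, t2, rfl, hE', rfl⟩ :=
    hT.eq_pairDb (Multiset.nodup_cons.1 hn).1 hA' (hedge ▸ Multiset.mem_cons_self _ _)
  rw [hE'] at hedge
  replace hedge := (Multiset.cons_inj_right _).1 hedge
  rw [hVG, hV, Multiset.map_cons, Multiset.cons_add] at hnode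
  have hW := add_left_cancel ((Multiset.cons_inj_right _).1 hnode)
  rcases Tree.eq_form_left_or_right hA' hn t1 t2 hedge with
    ⟨B', rfl, hm, rfl, rfl⟩ | ⟨hi, hqp, B', rfl, hm, rfl, rfl⟩
  · rw [zero_add] at hW
    subst hW
    exact ⟨r, B', X₂, rfl, hm, .inl rfl, represents_part hg t2⟩
  · rw [add_zero] at hW
    subst hW
    -- For a commutative mode the leaf may be the component on the other side, which reverses the
    -- direction.
    exact ⟨!r, B', X₁, by cases r <;> rfl, hm, .inr hi, represents_part hg t1⟩

theorem IsUHole.of_represents {D : HoleGraph (Formula Pr)} {j : S.J}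
    (h : S.IsUHole D j) (l : Formula Pr) (hl : Ranked.rk l = D.hole.length)
    {G : HL.Hypergraph (Formula Pr)} (hG : Ranked.rk G = D.hole.length) {Y : S.Db}
    (hY : S.Represents ((D.fill l hl).replaceOne none G) Y) :
    ∃ X, Y = .bracket j X ∧ S.Represents G X := by
  obtain ⟨v, y, e, he', hV, he, hle, hae, hE⟩ := h.fill l hl
  have hlen : G.ext.length = 1 := by
    rw [he'] at hae
    exact Eq.trans hG (congrArg List.length hae)
  rw [← he'] at hY
  clear he'
  generalize D.fill l hl = H at *
  obtain ⟨g, hg⟩ := List.length_eq_one_iff.1 hlen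
  obtain ⟨v', W, hext, hVG, hT⟩ := hY
  have hn : (v' ::ₘ W).Nodup := hVG ▸ nodup_nodes _
  have hnode := nodes_replaceOne hae hg (nodes_eq_cons_inner hg)
  have hedge := edges_replaceOne (G := H) (e := e) (H := G)
  obtain rfl : oneHost H e G v = v' := by
    rw [replaceOne_ext, he] at hext
    simpa using hext
  rw [hE, hle, hae, Multiset.map_cons, Multiset.map_singleton,
    Multiset.cons_add, add_comm {_}, ← Multiset.cons_add] at hedge
  replace hedge := add_right_cancel hedge
  obtain ⟨E₁, W₁, X₁, t1, rfl, hE', rfl⟩ :=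
    hT.eq_bracket (Multiset.nodup_cons.1 hn).1 (hedge ▸ Multiset.mem_cons_self _ _)
  rw [hE'] at hedge
  replace hedge := (Multiset.cons_inj_right _).1 hedge
  rw [hVG, hV, Multiset.insert_eq_cons, Multiset.map_cons, Multiset.map_singleton,
    Multiset.cons_add, Multiset.singleton_add] at hnode
  have hW := (Multiset.cons_inj_right _).1 ((Multiset.cons_inj_right _).1 hnode)
  subst hW hedge
  exact ⟨X₁, rfl, represents_part hg t1⟩

/-! ### From the hypergraph calculus to the multimodal calculus -/

theorem prim_mem_labels_mode (i : S.I) : Formula.prim i.1 ∈ S.labels :=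
  .inr ⟨i.1, .inl i.2, rfl⟩

theorem prim_mem_labels_modality (j : S.J) : Formula.prim j.1 ∈ S.labels :=
  .inr ⟨j.1, .inr j.2, rfl⟩

theorem mu_mem_labels (A : S.Fm) : S.mu A ∈ S.labels := .inl ⟨A, rfl⟩

theorem prim_ne_mu_of_mem {x : Pr} (hx : x ∈ S.I ∪ S.J) (A : S.Fm) : Formula.prim x ≠ S.mu A := by
  rcases hx with hx | hx
  · exact prim_mode_ne_mu ⟨x, hx⟩ A
  · exact prim_modality_ne_mu ⟨x, hx⟩ A

theorem exists_mu_of_times_mem {M : HL.Hypergraph (Formula Pr)} (h : Formula.times M ∈ S.labels) :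
    ∃ F, Formula.times M = S.mu F := by
  rcases h with ⟨F, hF⟩ | ⟨p, -, hp⟩
  · exact ⟨F, hF.symm⟩
  · exact absurd hp (Formula.prim_ne_times _ _)

theorem exists_mu_of_div_mem {N : Formula Pr} {D : HoleGraph (Formula Pr)}
    {hD : Ranked.rk N = D.ext.length} (h : Formula.div N D hD ∈ S.labels) :
    ∃ F, Formula.div N D hD = S.mu F := by
  rcases h with ⟨F, hF⟩ | ⟨p, -, hp⟩
  · exact ⟨F, hF.symm⟩
  · exact absurd hp (Formula.prim_ne_div _ _ _ _)

/-- The first part keeps derivations inside the fragment. The second part, two distinct hyperedges,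
prevents a hypergraph containing a pattern from being a handle. -/
theorem lab_mem_of_times_eq_mu {M : HL.Hypergraph (Formula Pr)} {F : S.Fm}
    (h : Formula.times M = S.mu F) :
    (∀ e, M.lab e ∈ S.labels) ∧ ∃ e e' : M.E, e ≠ e' := by
  rcases times_eq_mu h with ⟨i, A, B, rfl, v, y, z, a, N, τ, -, -, -, h0, h1, h2⟩ |
    ⟨j, A, rfl, v, y, τ, -, -, h0, h1⟩
  · refine ⟨?_, τ 0, τ 1, τ.injective.ne (by decide)⟩
    rw [τ.surjective.forall]
    intro k
    fin_cases k
    · exact h0.1 ▸ prim_mem_labels_mode i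
    · exact h1.1 ▸ mu_mem_labels A
    · exact h2.1 ▸ mu_mem_labels B
  · refine ⟨?_, τ 0, τ 1, τ.injective.ne (by decide)⟩
    rw [τ.surjective.forall]
    intro k
    fin_cases k
    · exact h0.1 ▸ prim_mem_labels_modality j
    · exact h1.1 ▸ mu_mem_labels A

theorem lab_mem_of_div_eq_mu {N : Formula Pr} {D : HoleGraph (Formula Pr)}
    {hD : Ranked.rk N = D.ext.length} {F : S.Fm} (h : Formula.div N D hD = S.mu F) :
    (∀ e, D.lab e ∈ S.labels) ∧ N ∈ Set.range S.mu := by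
  rcases div_eq_mu h with ⟨r, i, B, A, rfl, rfl, v, p, q, a, N, τ, -, -, -, -, h0, h1⟩ |
    ⟨j, A, rfl, rfl, v, y, τ, -, -, -, h0⟩
  · refine ⟨?_, A, rfl⟩
    rw [τ.surjective.forall]
    intro k
    fin_cases k
    · exact h0.1 ▸ prim_mem_labels_mode i
    · exact h1.1 ▸ mu_mem_labels B
  · refine ⟨?_, A, rfl⟩
    rw [τ.surjective.forall]
    intro k
    rw [Subsingleton.elim k 0, h0.1]
    exact prim_mem_labels_modality j

theorem lab_replaceOne_mem {H M : HL.Hypergraph (Formula Pr)} {e : H.E}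
    (hH : ∀ e, H.lab e ∈ S.labels) (hM : ∀ e, M.lab e ∈ S.labels) :
    ∀ e', (H.replaceOne e M).lab e' ∈ S.labels := by
  rintro (e' | ⟨_, e'⟩)
  · exact hH e'.1
  · exact hM e'

/-- The second conclusion is a strengthening needed by the induction: the mode hyperedges of
patterns give rise to premises of `timesR` and `divL` whose succedent is a mode or modality. Apart
from isomorphism, only axioms and left rules can end in such a succedent, and the left rules are
impossible: the antecedent of a premise would be a handle, which has a single hyperedge, labeled by
a mode or modality. -/
theorem of_derivable {G : HL.Hypergraph (Formula Pr)} {B : Formula Pr} (h : HL.Derivable G B)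
    (hG : ∀ e, G.lab e ∈ S.labels) :
    (B ∈ Set.range S.mu → ∃ X T, B = S.mu T ∧ S.Represents G X ∧ S.Der X T) ∧
    ∀ x ∈ S.I ∪ S.J, B = .prim x → G.Iso (HL.Hypergraph.handle (.prim x)) := by
  induction h with
  | @iso G H A hiso _ ih =>
    obtain ⟨σ, τ, hatt, hlab, hext⟩ := id hiso
    obtain ⟨ih1, ih2⟩ := ih fun e => hlab e ▸ hG (τ e)
    refine ⟨fun hA => ?_, fun x hx hA => hiso.symm.trans (ih2 x hx hA)⟩
    obtain ⟨X, T, h1, h2, h3⟩ := ih1 hA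
    exact ⟨X, T, h1, h2.of_iso hiso, h3⟩
  | ax A =>
    refine ⟨?_, ?_⟩
    · rintro ⟨T, rfl⟩
      exact ⟨.form T, T, rfl, Represents.handle T, .ax T⟩
    · rintro x - rfl
      exact Iso.refl _
  | timesL H e M A he _ ih =>
    obtain ⟨F, hF⟩ := exists_mu_of_times_mem (he ▸ hG e)
    obtain ⟨hM, e₁, e₂, hne⟩ := lab_mem_of_times_eq_mu hF
    obtain ⟨ih1, ih2⟩ := ih (lab_replaceOne_mem hG hM)
    obtain ⟨x, hx⟩ := Represents.exists_att (he.trans hF)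
    refine ⟨fun hA => ?_, fun p hp hA => ?_⟩
    · obtain ⟨X, T, h1, h2, h3⟩ := ih1 hA
      rcases times_eq_mu hF with ⟨i, A, B, rfl, hP⟩ | ⟨j, A, rfl, hP⟩
      · obtain ⟨Δ, A', B', rfl, hAB, hrep⟩ := hP.of_represents hx h2
        refine ⟨_, T, h1, hrep (.prod i A' B') ?_, .prodL Δ i A' B' T h3⟩
        rw [he, hF]
        rcases hAB with ⟨hA, hB⟩ | ⟨hi, hA, hB⟩
        · exact mu_prod_congr hA hB
        · rw [mu_prod_swap hi]
          exact mu_prod_congr hB hA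
      · obtain ⟨Δ, A', rfl, hA', hrep⟩ := hP.of_represents hx h2
        refine ⟨_, T, h1, hrep (.dia j A') ?_, .diaL Δ j A' T h3⟩
        rw [he, hF]
        exact mu_dia_congr hA'
    -- The two hyperedges of the inserted pattern stay distinct in the replacement, but a handle has
    -- only one.
    · obtain ⟨σ, τ, -⟩ := ih2 p hp hA
      have := τ.injective (Subsingleton.elim (α := Unit) (τ (.inr ⟨(), e₁⟩)) (τ (.inr ⟨(), e₂⟩)))
      refine absurd ?_ hne
      have hs := Sum.inr.inj this
      cases hs
      rfl
  | timesR M H _ ih =>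
    refine ⟨?_, fun x _ hx => absurd hx.symm (Formula.prim_ne_times _ _)⟩
    rintro ⟨T, hT⟩
    have hH : ∀ m e, (H m).lab e ∈ S.labels := fun m e => hG (.inr ⟨m, e⟩)
    rcases times_eq_mu hT.symm with ⟨i, A, B, rfl, hP⟩ | ⟨j, A, rfl, hP⟩
    · obtain ⟨τ, ⟨l0, l1, l2⟩, hrep⟩ := hP.represents_replaceAll
      have h0 := (ih (τ 0) (hH _)).2 i.1 (.inl i.2) l0
      obtain ⟨X, A', hA', hX, dX⟩ := (ih (τ 1) (hH _)).1 ⟨A, l1.symm⟩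
      obtain ⟨Y, B', hB', hY, dY⟩ := (ih (τ 2) (hH _)).1 ⟨B, l2.symm⟩
      refine ⟨_, .prod i A' B', ?_, hrep H X Y h0 hX hY, .prodR i X Y A' B' dX dY⟩
      rw [← hT]
      exact mu_prod_congr (l1.symm.trans hA') (l2.symm.trans hB')
    · obtain ⟨τ, ⟨l0, l1⟩, hrep⟩ := hP.represents_replaceAll
      have h0 := (ih (τ 0) (hH _)).2 j.1 (.inr j.2) l0
      obtain ⟨X, A', hA', hX, dX⟩ := (ih (τ 1) (hH _)).1 ⟨A, l1.symm⟩
      refine ⟨_, .dia j A', ?_, hrep H X h0 hX, .diaR j X A' dX⟩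
      rw [← hT]
      exact mu_dia_congr (l1.symm.trans hA')
  | divL H e A N D hD K he _ _ ih ihK =>
    -- The filled hole is a hyperedge of the conclusion, so its label is a translation; this
    -- controls `N` and the labels of `D`.
    obtain ⟨F, hF⟩ := exists_mu_of_div_mem (hD := hD)
      (hG (.inr ⟨(), .inl ⟨none, fun d => Option.some_ne_none d⟩⟩) : Formula.div N D hD ∈ S.labels)
    obtain ⟨hDl, N', rfl⟩ := lab_mem_of_div_eq_mu hF
    have hK : ∀ d e', (K d).lab e' ∈ S.labels := fun d e' => hG (.inr ⟨(), .inr ⟨d, e'⟩⟩)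
    -- The hyperedge `e` is absent from the conclusion, but its label is `N`, the translation of the
    -- numerator. All other hyperedges of `H` survive.
    have hH : ∀ e', H.lab e' ∈ S.labels := by
      intro e'
      by_cases hee : e = e'
      · rw [← hee, he]
        exact mu_mem_labels N'
      · exact hG (.inl ⟨e', fun _ => hee⟩)
    obtain ⟨ih1, ih2⟩ := ih hH
    refine ⟨fun hA => ?_, fun p hp hA => ?_⟩
    · obtain ⟨X, T, h1, h2, h3⟩ := ih1 hA
      obtain ⟨Δ, A', rfl, hA', hgraft⟩ := h2.exists_plug he
      rcases div_eq_mu hF with ⟨r, i, B, A, rfl, hN, hP⟩ | ⟨j, A, rfl, hN, hP⟩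
      · obtain ⟨τ, ⟨l0, l1⟩, hrep⟩ := hP.represents_replace
        have h0 := (ihK (τ 0) (hK _)).2 i.1 (.inl i.2) l0
        obtain ⟨Y, B', hB', hY, dY⟩ := (ihK (τ 1) (hK _)).1 ⟨B, l1.symm⟩
        refine ⟨_, T, h1, hgraft _ _ (hrep _ rfl K Y (S.divFm r i B' A') h0 hY ?_), h3.divL dY⟩
        exact (mu_divFm_congr (hA'.trans hN) (hB'.symm.trans l1)).trans hF.symm
      · obtain ⟨τ, l0, hrep⟩ := hP.represents_replace
        have h0 := (ihK (τ 0) (hK _)).2 j.1 (.inr j.2) l0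
        refine ⟨_, T, h1, hgraft _ _ (hrep _ rfl K (.box j A') h0 ?_), .boxL Δ j A' T h3⟩
        exact (mu_box_congr (hA'.trans hN)).trans hF.symm
    · obtain ⟨σ, τ, -, hlab, -⟩ := ih2 p hp hA
      exact absurd ((hlab e).trans he) (prim_ne_mu_of_mem hp N')
  | divR F N D hD hrk _ ih =>
    refine ⟨?_, fun x _ hx => absurd hx.symm (Formula.prim_ne_div _ _ _ _)⟩
    rintro ⟨T, hT⟩
    obtain ⟨hDl, N', hN'⟩ := lab_mem_of_div_eq_mu hT.symm
    -- The host of the replacement carries the succedent itself as the label of the hole. It is a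
    -- translation, so all labels of the host are admissible.
    obtain ⟨ih1, -⟩ := ih (lab_replaceOne_mem (by
      rintro (_ | d)
      · have hmem : Formula.div N D hD ∈ S.labels := .inl ⟨T, hT⟩
        exact hmem
      · exact hDl d) hG)
    obtain ⟨Y, A', hA', hY, dY⟩ := ih1 ⟨N', hN'⟩
    rcases div_eq_mu hT.symm with ⟨r, i, B, A, rfl, hN, hP⟩ | ⟨j, A, rfl, hN, hP⟩
    · obtain ⟨r', B', X, rfl, hB', hr, hX⟩ := hP.of_represents _ rfl hrk hY
      refine ⟨X, S.divFm r i B' A', ?_, hX,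
        Der.divR (Der.comm (Δ := .hole) (hr.imp_left Eq.symm) dY)⟩
      rw [← hT]
      exact mu_divFm_congr (hN.symm.trans hA') hB'.symm
    · obtain ⟨X, rfl, hX⟩ := hP.of_represents _ rfl hrk hY
      refine ⟨X, .box j A', ?_, hX, .boxR j X A' dY⟩
      rw [← hT]
      exact mu_box_congr (hN.symm.trans hA')

theorem Tree.lab_mem {V : Type} {v : V} {E : Multiset (Formula Pr × List V)} {W : Multiset V}
    {X : S.Db} (h : S.Tree v E W X) : ∀ r ∈ E, r.1 ∈ S.labels := by
  induction h with
  | form v A =>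
    intro r hr
    rw [Multiset.mem_singleton.1 hr]
    exact mu_mem_labels A
  | pair _ _ _ h1 h2 =>
    intro r hr
    simp only [Multiset.mem_cons, Multiset.mem_add] at hr
    rcases hr with rfl | hr | hr
    · exact prim_mem_labels_mode _
    · exact h1 r hr
    · exact h2 r hr
  | bracket v _ ih =>
    intro r hr
    rcases Multiset.mem_cons.1 hr with rfl | hr
    · exact prim_mem_labels_modality _
    · exact ih r hr

theorem Represents.lab_mem {G : HL.Hypergraph (Formula Pr)} {X : S.Db} (h : S.Represents G X) :
    ∀ e, G.lab e ∈ S.labels := by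
  obtain ⟨v, W, -, -, hT⟩ := h
  exact fun e => hT.lab_mem _ (mem_edges.2 ⟨e, rfl⟩)

end ModeSystem

theorem theorem1 {Pr : Type*} [HL.Ranked Pr] (S : ModeSystem Pr) :
    (∀ (X : S.Db) (T : S.Fm),
      NLM.Derivable S.C ∅ X T ↔ HL.Derivable (S.htree X) (S.mu T)) ∧
    (∀ (G : HL.Hypergraph (HL.Formula Pr)) (B : HL.Formula Pr),
      (∀ e, G.lab e ∈ S.labels) → B ∈ Set.range S.mu → HL.Derivable G B →
        ∃ (X : S.Db) (T : S.Fm),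
          G.Iso (S.htree X) ∧ B = S.mu T ∧ NLM.Derivable S.C ∅ X T) := by
  refine ⟨fun X T => ⟨fun h => ModeSystem.Der.derivable h (ModeSystem.represents_htree X),
    fun h => ?_⟩, fun G B hG hB h => ?_⟩
  · have hX := ModeSystem.represents_htree X
    obtain ⟨X', T', hT, hX', hd⟩ := (ModeSystem.of_derivable h hX.lab_mem).1 ⟨T, rfl⟩
    -- The induction yields a derivation for some `X'` and `T'`. Since `X'` is represented by `htree
    -- X` and `T'` has the translation of `T`, invariance gives the sequent asked for.
    exact ModeSystem.Der.congr hd (hX'.dbEq hX) hT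
  · obtain ⟨X, T, hT, hX, hd⟩ := (ModeSystem.of_derivable h hG).1 hB
    exact ⟨X, T, hX.iso (ModeSystem.represents_htree X), hT, hd⟩
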